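/- **Setting.** Let $m>0$ and let $q=(q_n)_{n\in\mathbb Z}$ be real with $q_n\neq1$ for all $n$ and $\sum_{n}(1+|n|)|q_n|<\infty$ (that is, $q\in\ell^1_1$); put $\tilde q_n=q_n/(1-q_n)$. For ${\bf w}_n=(u_n,v_n)\in\mathbb C^2$ let $$(\mathcal D{\bf w})_n=\big(mu_n+v_{n+1}-v_n+q_nv_n,\ u_{n-1}-u_n-mv_n+q_nu_n\big).$$ For $0<|z|\le1$ (with $z=\mathrm e^{\mathrm i\theta}$) let $\lambda=\lambda(z)$ be the square root of $m^2+2-z-z^{-1}$ with $\operatorname{Re}\lambda\ge0$, and let ${\bf w}^\pm(z)=(u^\pm,v^\pm)$ be the Jost solutions: the solutions of $\mathcal D{\bf w}=\lambda{\bf w}$ such that ${\bf h}^\pm_n(z):=z^{\mp n}{\bf w}^\pm_n(z)$ tends to $\big(1,\frac{z^{\mp1}-1}{m+\lambda}\big)$ as $n\to\pm\infty$. With $A^+_n=\mathrm{diag}(1,1-q_n)$, $A^-_n=\mathrm{diag}(1-q_n,1)$, the Jost coefficients $a^\pm_{n,k},b^\pm_{n,k}$ are the coefficients in $$A^\pm_n{\bf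 h}^\pm_n(z)=\begin{pmatrix}1\\ \frac{z^{\mp1}-1}{m+\lambda}\end{pmatrix}+\sum_{k=\mp1}^{\pm\infty}\begin{pmatrix}a^\pm_{n,k}\\ \frac{b^\pm_{n,k}}{\lambda+m}\end{pmatrix}z^{\pm k},$$ i.e. $a^\pm_{n,k}$, and $b^\pm_{n,k}$ after multiplying the second row by $m+\lambda$, are the Fourier coefficients on $|z|=1$. Let $W({\bf w}^1,{\bf w}^2)=u^1_nv^2_{n+1}-u^2_nv^1_{n+1}$ (taken at $n=0$), $W=W({\bf w}^+(z),{\bf w}^-(z))$, and $$\tilde T(z)=\frac{z-z^{-1}}{(m+\lambda)W},\qquad \tilde R^\pm(z)=\pm\frac{W({\bf w}^\mp(z),{\bf w}^\pm(z^{-1}))}{W},$$ where $\tilde T$ is extended to $z=0$ by continuity. Let $z_1,\dots,z_N$ be the points of $0<|z|<1$ for which $\lambda_l=\lambda(z_l)$ is an eigenvalue of $\mathcal D$ in $\ell^2\oplus\ell^2$, and put $$\mathcal F^\pm_n=\frac1{2\pi\mathrm i}\int_{|z|=1}\tilde R^\pm(z)z^{\pm n}\frac{dz}{z}+\sum_{l=1}^N\gamma^\pm_lz_l^{\pm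 n},\qquad \gamma^\pm_l=\frac{2\lambda_l}{(m+\lambda_l)\sum_{j\in\mathbb Z}\big(u^\pm_j(z_l)^2+v^\pm_j(z_l)^2\big)}.$$ **Proposition.** All these objects are well defined: the Jost solutions exist and are unique for $0<|z|\le1$, the expansions above converge to ${\bf h}^\pm_n$ for $0<|z|\le 1$, there are finitely many $z_l$, $\tilde R^\pm$ is integrable on the circle, and $\tilde T$ is analytic at $0$. Moreover, for all $n\in\mathbb Z$, with convergent series: (i) $$\delta_{j,0}+a^+_{n,j}+\mathcal F^+_{2n+j}+\sum_{p=0}^\infty\mathcal F^+_{2n+p+j}a^+_{n,p}=\frac{\tilde T(0)(1+a^-_{n,0})}{1-q_n}\delta_{j,0},\qquad j\ge0,$$ $$\delta_{j,-1}-\delta_{j,0}+b^+_{n,j}+\mathcal F^+_{2n+j-1}-\mathcal F^+_{2n+j}+\sum_{p=-1}^\infty\mathcal F^+_{2n+p+j}b^+_{n,p}$$ $$=(1-q_n)\Big[\tilde T(0)(b^-_{n,0}-1)\delta_{j,0}+\big(\tilde T'(0)(b^-_{n,0}-1)+\tilde T(0)(b^-_{n,-1}+1)\big)\delta_{j,-1}\Big],\qquad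 j\ge-1.$$ (ii) For $j\le0$, $$\delta_{j,0}+a^-_{n,j}+\mathcal F^-_{2n+j}+\sum_{p=0}^{-\infty}\mathcal F^-_{2n+p+j}a^-_{n,p}=(1-q_n)\tilde T(0)(1+a^+_{n,0})\delta_{j,0},$$ $$\delta_{j,-1}-\delta_{j,0}+b^-_{n,j}+\mathcal F^-_{2n+j-1}-\mathcal F^-_{2n+j}+\sum_{p=0}^{-\infty}\mathcal F^-_{2n+p+j}b^-_{n,p}$$ $$=\frac{\big(\tilde T(0)(b^+_{n,0}-1)+\tilde T'(0)(1+b^+_{n,-1})\big)\delta_{j,0}+\tilde T(0)(1+b^+_{n,-1})\delta_{j,-1}}{1-q_n}.$$ (iii) There are sequences $M^\pm_n$ with $M^\pm_n=O(1)$ as $n\to\pm\infty$ such that for all $n\in\mathbb Z$ $$|\mathcal F^\pm_n|\le M^\pm_n\sum_{p=[n/2]}^{\pm\infty}\big(|q_p|+|\tilde q_p|\big),$$ where $[\cdot]$ is the integer part (floor). -/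

import Mathlib

open Filter Topology Asymptotics

namespace DiscreteDirac

noncomputable section

/-- The discrete Dirac operator `D = D₀ + Q` on two-component sequences `w n = (u n, v n)`:
`(D w) n = (m u_n + (v_{n+1} - v_n) + q_n v_n, (u_{n-1} - u_n) - m v_n + q_n u_n)`. -/
def diracOp (m : ℝ) (q : ℤ → ℝ) (w : ℤ → ℂ × ℂ) : ℤ → ℂ × ℂ := fun n =>
  ((m : ℂ) * (w n).1 + ((w (n + 1)).2 - (w n).2) + (q n : ℂ) * (w n).2,
    ((w (n - 1)).1 - (w n).1) - (m : ℂ) * (w n).2 + (q n : ℂ) * (w n).1)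

/-- The spectral parameter as a function of `z = e^{iθ}`: the square root of
`m² + 2 - z - z⁻¹` with nonnegative real part. -/
def lam (m : ℝ) (z : ℂ) : ℂ := ((m : ℂ) ^ 2 + 2 - z - z⁻¹) ^ (1 / 2 : ℂ)

/-- `w` is the Jost solution of `D w = λ(z) w` at `+∞`:
`z^{-n} w_n → (1, (z⁻¹ - 1) / (m + λ))` as `n → +∞`. -/
def IsJostPlus (m : ℝ) (q : ℤ → ℝ) (z : ℂ) (w : ℤ → ℂ × ℂ) : Prop :=
  diracOp m q w = lam m z • w ∧
    Tendsto (fun n : ℤ => z ^ (-n) • w n) atTop (𝓝 (1, (z⁻¹ - 1) / (m + lam m z)))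

/-- `w` is the Jost solution of `D w = λ(z) w` at `-∞`:
`z^n w_n → (1, (z - 1) / (m + λ))` as `n → -∞`. -/
def IsJostMinus (m : ℝ) (q : ℤ → ℝ) (z : ℂ) (w : ℤ → ℂ × ℂ) : Prop :=
  diracOp m q w = lam m z • w ∧
    Tendsto (fun n : ℤ => z ^ n • w n) atBot (𝓝 (1, (z - 1) / (m + lam m z)))

open Classical in
/-- The Jost solution `w⁺(z)` (the zero sequence where none exists). -/
def jostPlus (m : ℝ) (q : ℤ → ℝ) (z : ℂ) : ℤ → ℂ × ℂ :=
  if h : ∃ w, IsJostPlus m q z w then h.choose else 0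

open Classical in
/-- The Jost solution `w⁻(z)` (the zero sequence where none exists). -/
def jostMinus (m : ℝ) (q : ℤ → ℝ) (z : ℂ) : ℤ → ℂ × ℂ :=
  if h : ∃ w, IsJostMinus m q z w then h.choose else 0

/-- `h⁺_n(z) = z^{-n} w⁺_n(z)`. -/
def hPlus (m : ℝ) (q : ℤ → ℝ) (n : ℤ) (z : ℂ) : ℂ × ℂ := z ^ (-n) • jostPlus m q z n

/-- `h⁻_n(z) = z^n w⁻_n(z)`. -/
def hMinus (m : ℝ) (q : ℤ → ℝ) (n : ℤ) (z : ℂ) : ℂ × ℂ := z ^ n • jostMinus m q z n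

/-- `(2πi)⁻¹ ∮_{|z|=1} f(z) z^k dz/z`. -/
def circleMoment (f : ℂ → ℂ) (k : ℤ) : ℂ :=
  (2 * (Real.pi : ℂ) * Complex.I)⁻¹ * ∮ z in C(0, 1), f z * z ^ k / z

/-- `a⁺_{n,k}`: the coefficient of `z^k` in the first component of `A⁺_n h⁺_n - (1, α₋)`. -/
def aPlus (m : ℝ) (q : ℤ → ℝ) (n k : ℤ) : ℂ :=
  circleMoment (fun z => (hPlus m q n z).1 - 1) (-k)

/-- `b⁺_{n,k}`: the coefficient of `z^k` in `m + λ` times the second component of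
`A⁺_n h⁺_n - (1, α₋)`. -/
def bPlus (m : ℝ) (q : ℤ → ℝ) (n k : ℤ) : ℂ :=
  circleMoment
    (fun z => (m + lam m z) * ((1 - (q n : ℂ)) * (hPlus m q n z).2) - (z⁻¹ - 1)) (-k)

/-- `a⁻_{n,k}`: the coefficient of `z^{-k}` in the first component of `A⁻_n h⁻_n - (1, α₊)`. -/
def aMinus (m : ℝ) (q : ℤ → ℝ) (n k : ℤ) : ℂ :=
  circleMoment (fun z => (1 - (q n : ℂ)) * (hMinus m q n z).1 - 1) k

/-- `b⁻_{n,k}`: the coefficient of `z^{-k}` in `m + λ` times the second component of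
`A⁻_n h⁻_n - (1, α₊)`. -/
def bMinus (m : ℝ) (q : ℤ → ℝ) (n k : ℤ) : ℂ :=
  circleMoment (fun z => (m + lam m z) * (hMinus m q n z).2 - (z - 1)) k

/-- The Wronskian `u¹_n v²_{n+1} - u²_n v¹_{n+1}` at `n = 0`; for two solutions of `D w = λ w`
with the same `λ` it does not depend on `n`. -/
def wronskian (w₁ w₂ : ℤ → ℂ × ℂ) : ℂ := (w₁ 0).1 * (w₂ 1).2 - (w₂ 0).1 * (w₁ 1).2

/-- `W = W(w⁺, w⁻)`. -/
def jostW (m : ℝ) (q : ℤ → ℝ) (z : ℂ) : ℂ := wronskian (jostPlus m q z) (jostMinus m q z)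

/-- The transmission coefficient `T = 2i sin θ / ((m + λ) W)`, where `2i sin θ = z - z⁻¹`. -/
def transRaw (m : ℝ) (q : ℤ → ℝ) (z : ℂ) : ℂ := (z - z⁻¹) / ((m + lam m z) * jostW m q z)

/-- The transmission coefficient with the value at `z = 0` filled in by continuity. -/
def transm (m : ℝ) (q : ℤ → ℝ) : ℂ → ℂ :=
  Function.update (transRaw m q) 0 (limUnder (𝓝[≠] 0) (transRaw m q))

/-- The reflection coefficient `R⁺(θ) = W(w⁻(θ), w⁺(-θ)) / W(θ)`; `-θ` corresponds to `z⁻¹`. -/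
def reflPlus (m : ℝ) (q : ℤ → ℝ) (z : ℂ) : ℂ :=
  wronskian (jostMinus m q z) (jostPlus m q z⁻¹) / jostW m q z

/-- The reflection coefficient `R⁻(θ) = -W(w⁺(θ), w⁻(-θ)) / W(θ)`. -/
def reflMinus (m : ℝ) (q : ℤ → ℝ) (z : ℂ) : ℂ :=
  -(wronskian (jostPlus m q z) (jostMinus m q z⁻¹) / jostW m q z)

/-- `l` is an eigenvalue of `D` in `ℓ² ⊕ ℓ²`. -/
def IsEigenvalue (m : ℝ) (q : ℤ → ℝ) (l : ℂ) : Prop :=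
  ∃ w : ℤ → ℂ × ℂ, w ≠ 0 ∧ Summable (fun n => ‖(w n).1‖ ^ 2) ∧
    Summable (fun n => ‖(w n).2‖ ^ 2) ∧ diracOp m q w = l • w

/-- The points `z_l` of the punctured open unit disc for which `λ_l = λ(z_l)` is an eigenvalue.
Every eigenvalue `λ_l ≥ 0` off the continuous spectrum is `λ(z_l)` for exactly one such point. -/
def eigenPoints (m : ℝ) (q : ℤ → ℝ) : Set ℂ :=
  {z | 0 < ‖z‖ ∧ ‖z‖ < 1 ∧ IsEigenvalue m q (lam m z)}

/-- `γ = 2λ / ((m + λ) ∑_j w_j · w_j)` with the bilinear product `w · w = u² + v²`. -/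
def gammaOf (m : ℝ) (z : ℂ) (w : ℤ → ℂ × ℂ) : ℂ :=
  2 * lam m z / ((m + lam m z) * ∑' j : ℤ, ((w j).1 ^ 2 + (w j).2 ^ 2))

/-- `𝓕⁺_n = F⁺_n + ∑_l γ⁺_l z_l^n`, with `F⁺_n = (2πi)⁻¹ ∮ R⁺(z) z^n dz/z`. -/
def glmPlus (m : ℝ) (q : ℤ → ℝ) (n : ℤ) : ℂ :=
  circleMoment (reflPlus m q) n +
    ∑ᶠ z ∈ eigenPoints m q, gammaOf m z (jostPlus m q z) * z ^ n

/-- `𝓕⁻_n = F⁻_n + ∑_l γ⁻_l z_l^{-n}`, with `F⁻_n = (2πi)⁻¹ ∮ R⁻(z) z^{-n} dz/z`. -/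
def glmMinus (m : ℝ) (q : ℤ → ℝ) (n : ℤ) : ℂ :=
  circleMoment (reflMinus m q) (-n) +
    ∑ᶠ z ∈ eigenPoints m q, gammaOf m z (jostMinus m q z) * z ^ (-n)

/-- The Kronecker symbol. -/
def kron (i j : ℤ) : ℂ := if i = j then 1 else 0

/-- `|q_p| + |q̃_p|`, where `q̃_p = q_p / (1 - q_p)`. -/
def qWeight (q : ℤ → ℝ) (p : ℤ) : ℝ := |q p| + |q p / (1 - q p)|

end

end DiscreteDirac

open DiscreteDirac

/-! Multiplying the second component by m + λ turns Dw = λw into a first-order system (`IsRedSol`)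
that contains λ only through μ = λ² - m² = 2 - z - 1/z. The branch of the square root disappears and
everything becomes analytic in z.

The Jost solution at +∞ is u_n = z^n f_n(z), v_n = z^n (1/z - 1) g_n(z) / (1 - q_n), where f_n and
g_n are power series with absolutely summable coefficients. The potential at site n + 1 + d adds to
them polynomials of degree at most 2d + 2, whose coefficients are bounded by a constant times |q| +
|q̃| at that site (`coeffBdd_jostIncr`). The first moment of q controls both this constant and the
sum of all coefficients. The reflection n → -n gives the Jost solution at -∞.

On the unit circle w⁻(z), w⁺(z) and w⁺(1/z) solve the same system, hence T w⁻(z) = w⁺(1/z) + R⁺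
w⁺(z) (`scattering_plus`). The Fourier coefficients of the right side have the shape ψ_j + ∑
F_{2n+p+j} ψ_p, up to sign and shift. Those of the left side are computed by residues in the disc:
the poles of T are the z_l and supply the norming constants, while for j = 0 and j = -1 the point z
= 0 supplies T(0) and T'(0) (`marchenko_of_scattering`). Because of the factor 1/z - 1, the
equations for b are differences of two consecutive equations for g.

The residue calculus needs T = (1 + z)/V to have finitely many poles, all simple, and to be bounded
near the circle although V may vanish at ±1. The tool is the discrete Green identity `redW_sub`. It
makes bound states real and orthogonal and evaluates the residues. Zeros of V could accumulate only
at -1, but two bound states near -1 would have a positive inner product (`finite_jostZeros`). Summed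
over half-lines it bounds the Wronskian below by c |Im z| (`exists_lower_bound_jostWt`), so T is
bounded where |Im z| is comparable with 1 - |z|; the maximum principle covers the rest
(`exists_bound_jostT`).

For (iii), at j ≥ 1 the equation for f reads F_{2n+j} + ∑ F_{2n+j+p} (ψ_p - δ_{p,0}) = -ψ_j. Far out
the ℓ¹ norm of ψ - δ is at most 1/2 and the sum is absorbed (`norm_le_two_mul_of_tsum`), while ψ_j
sees the potential only from site n + 1 + ⌊j/2⌋ on. Elsewhere it suffices that F vanishes whenever
the tail of the potential does. -/

namespace DiscreteDirac

/-! ### Polynomial contribution of a single site to the Jost solution. -/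

section PolynomialIncrements

open Polynomial

/-- One backward step of the reduced Dirac system on polynomial pairs `(f, ε)`. -/
noncomputable def jostStep (a b : ℝ) (x : ℝ[X] × ℝ[X]) : ℝ[X] × ℝ[X] :=
  (x.1 + (1 - X) * x.2 + (C b * x.1 - C (a + b) * (X * x.1)) + C b * ((1 - X) * x.2),
    X ^ 2 * (x.2 + (C b * x.2 + C (a + b) * x.1)))

/-- The contribution of the potential at site `n + 1 + d` to the Jost solution at site `n`. -/
noncomputable def jostIncr (q : ℤ → ℝ) : ℕ → ℤ → ℝ[X] × ℝ[X]
  | 0, n => (C (q (n + 1) / (1 - q (n + 1))) -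
        C (q (n + 1) + q (n + 1) / (1 - q (n + 1))) * X,
      C (q (n + 1) + q (n + 1) / (1 - q (n + 1))) * X ^ 2)
  | d + 1, n => jostStep (q (n + 1)) (q (n + 1) / (1 - q (n + 1))) (jostIncr q d (n + 1))

/-- Every coefficient of `p` is bounded by `B`. -/
def CoeffBdd (B : ℝ) (p : ℝ[X]) : Prop := ∀ j, |p.coeff j| ≤ B

namespace CoeffBdd

variable {A B : ℝ} {p r : ℝ[X]}

lemma mono (h : CoeffBdd A p) (hAB : A ≤ B) : CoeffBdd B p := fun j => (h j).trans hAB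

lemma nonneg (h : CoeffBdd A p) : 0 ≤ A := (abs_nonneg _).trans (h 0)

lemma add (hp : CoeffBdd A p) (hr : CoeffBdd B r) : CoeffBdd (A + B) (p + r) := fun j => by
  rw [coeff_add]
  exact (abs_add_le _ _).trans (add_le_add (hp j) (hr j))

lemma sub (hp : CoeffBdd A p) (hr : CoeffBdd B r) : CoeffBdd (A + B) (p - r) := fun j => by
  rw [coeff_sub]
  exact (abs_sub _ _).trans (add_le_add (hp j) (hr j))

lemma C_mul (c : ℝ) (hp : CoeffBdd A p) : CoeffBdd (|c| * A) (C c * p) := fun j => by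
  rw [coeff_C_mul, abs_mul]
  exact mul_le_mul_of_nonneg_left (hp j) (abs_nonneg c)

lemma X_pow_mul (k : ℕ) (hp : CoeffBdd A p) : CoeffBdd A (X ^ k * p) := fun j => by
  rw [coeff_X_pow_mul']
  split_ifs
  · exact hp _
  · simpa using hp.nonneg

lemma X_mul (hp : CoeffBdd A p) : CoeffBdd A (X * p) := by
  simpa using hp.X_pow_mul 1

lemma one_sub_X_mul (hp : CoeffBdd A p) : CoeffBdd (A + A) ((1 - X) * p) := by
  rw [sub_mul, one_mul]
  exact hp.sub hp.X_mul

end CoeffBdd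

/-- `1 + X² + ⋯ + X^{2(i-1)}`. -/
noncomputable def evenGeom (i : ℕ) : ℝ[X] := ∑ l ∈ Finset.range i, X ^ (2 * l)

lemma evenGeom_succ (i : ℕ) : evenGeom (i + 1) = 1 + X ^ 2 * evenGeom i := by
  simp only [evenGeom, Finset.sum_range_succ', Finset.mul_sum]
  refine (add_comm _ _).trans (congrArg₂ _ (by simp) (Finset.sum_congr rfl fun l _ => ?_))
  rw [← pow_add]; congr 1; ring

lemma CoeffBdd.evenGeom_mul {A : ℝ} {p : ℝ[X]} (i : ℕ) (hp : CoeffBdd A p) :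
    CoeffBdd (i * A) (evenGeom i * p) := by
  induction i with
  | zero => intro j; simp [evenGeom]
  | succ i ih =>
    rw [evenGeom, Finset.sum_range_succ, ← evenGeom, add_mul]
    refine (ih.add (hp.X_pow_mul (2 * i))).mono (le_of_eq ?_)
    push_cast; ring

/-- The product is the alternating sum 1 - X + X² - ⋯, so free propagation over any number of sites
leaves the coefficient bound unchanged. -/
lemma coeffBdd_evenGeom_mul_one_sub_X (i : ℕ) : CoeffBdd 1 (evenGeom i * (1 - X)) := by
  induction i with
  | zero => intro j; simp [evenGeom]
  | succ i ih =>
    have h : evenGeom (i + 1) * (1 - X) = 1 - X + X ^ 2 * (evenGeom i * (1 - X)) := by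
      rw [evenGeom_succ]; ring
    intro j
    rw [h]
    match j with
    | 0 => simp
    | 1 => simp [coeff_X_pow_mul', coeff_one]
    | j + 2 =>
      have : (X ^ 2 * (evenGeom i * (1 - X)) : ℝ[X]).coeff (j + 2)
          = (evenGeom i * (1 - X)).coeff j := coeff_X_pow_mul _ _ _
      rw [coeff_add, this, coeff_sub, coeff_one, coeff_X]
      simpa using ih j

lemma coeffBdd_jostIncr_zero (q : ℤ → ℝ) (n : ℤ) (i : ℕ) :
    CoeffBdd (3 * qWeight q (n + 1))
      ((jostIncr q 0 n).1 + evenGeom i * ((1 - X) * (jostIncr q 0 n).2)) := by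
  simp only [jostIncr, qWeight]
  set a := q (n + 1)
  set b := a / (1 - a)
  have h1 : CoeffBdd (|b| * 1) (C b * 1) := CoeffBdd.C_mul b fun j => by
    rw [coeff_one]; split_ifs <;> simp
  have h2 : CoeffBdd (|a + b| * 1) (C (a + b) * X) := CoeffBdd.C_mul _ fun j => by
    rw [coeff_X]; split_ifs <;> simp
  have h3 := ((coeffBdd_evenGeom_mul_one_sub_X i).X_pow_mul 2).C_mul (a + b)
  have h := (h1.sub h2).add h3
  have e : C b - C (a + b) * X + evenGeom i * ((1 - X) * (C (a + b) * X ^ 2))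
      = C b * 1 - C (a + b) * X + C (a + b) * (X ^ 2 * (evenGeom i * (1 - X))) := by ring
  rw [e]
  refine h.mono ?_
  have := abs_add_le a b
  have := abs_nonneg a
  linarith

lemma qWeight_nonneg (q : ℤ → ℝ) (n : ℤ) : 0 ≤ qWeight q n := by
  unfold qWeight; positivity

/-- A free step sends (f, ε) to (f + (1 - X) ε, X² ε), so f + `evenGeom i` (1 - X) ε is the first
component after i more free steps. Bounding it for all i at once closes the induction: the free part
of a step reproduces the same quantity with i + 1, and every correction carries a factor of the
potential. Estimating (1 - X) ε crudely at each step would lose a fixed amount per site even without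
potential. -/
lemma coeffBdd_jostIncr_aux (q : ℤ → ℝ) (d : ℕ) : ∀ n : ℤ,
    (∀ i : ℕ, CoeffBdd (3 * qWeight q (n + 1 + d) *
        ∏ l ∈ Finset.range d, (1 + 4 * ((l : ℝ) + 1 + i) * qWeight q (n + 1 + l)))
      ((jostIncr q d n).1 + evenGeom i * ((1 - X) * (jostIncr q d n).2))) ∧
    CoeffBdd (3 * qWeight q (n + 1 + d) *
        ∏ l ∈ Finset.range d, (1 + 4 * ((l : ℝ) + 1) * qWeight q (n + 1 + l)))
      (jostIncr q d n).2 := by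
  induction d with
  | zero =>
    intro n
    refine ⟨fun i => by simpa using coeffBdd_jostIncr_zero q n i, ?_⟩
    simp only [jostIncr, Finset.range_zero, Finset.prod_empty, mul_one, Nat.cast_zero, add_zero,
      qWeight]
    set a := q (n + 1)
    set b := a / (1 - a)
    have h2 : CoeffBdd (|a + b| * 1) (C (a + b) * X ^ 2) := CoeffBdd.C_mul _ fun j => by
      rw [coeff_X_pow]; split_ifs <;> simp
    refine h2.mono ?_
    have := abs_add_le a b
    have := abs_nonneg a
    have := abs_nonneg b
    linarith
  | succ d ih =>
    intro n
    obtain ⟨ih1, ih2⟩ := ih (n + 1)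
    have hidx : n + 1 + 1 + (d : ℤ) = n + 1 + ((d + 1 : ℕ) : ℤ) := by push_cast; ring
    have hidx' : ∀ l : ℕ, n + 1 + 1 + (l : ℤ) = n + 1 + ((l + 1 : ℕ) : ℤ) := fun l => by
      push_cast; ring
    rw [hidx] at ih1 ih2
    simp only [hidx'] at ih1 ih2
    set D := 3 * qWeight q (n + 1 + ((d + 1 : ℕ) : ℤ)) with hD
    have hD0 : 0 ≤ D := mul_nonneg (by norm_num) (qWeight_nonneg _ _)
    set w := qWeight q (n + 1) with hw
    have hw0 : 0 ≤ w := qWeight_nonneg _ _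
    set x := jostIncr q d (n + 1) with hx
    set a := q (n + 1)
    set b := a / (1 - a) with hb
    have hstep : jostIncr q (d + 1) n = jostStep a b x := rfl
    have hab : w = |a| + |b| := rfl
    have hbw : |b| ≤ w := by rw [hab]; linarith [abs_nonneg a]
    have habw : |a + b| ≤ w := by rw [hab]; exact abs_add_le _ _
    have hpos : ∀ (i l : ℕ), 0 ≤ 1 + 4 * ((l : ℝ) + 1 + i) * qWeight q (n + 1 + ((l + 1 : ℕ) : ℤ)) :=
      fun i l => by have := qWeight_nonneg q (n + 1 + ((l + 1 : ℕ) : ℤ)); positivity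
    set P : ℕ → ℝ := fun i => ∏ l ∈ Finset.range d,
      (1 + 4 * (((l + 1 : ℕ) : ℝ) + 1 + i) * qWeight q (n + 1 + ((l + 1 : ℕ) : ℤ))) with hP
    have hPle : ∀ i j : ℕ, j ≤ i + 1 → ∏ l ∈ Finset.range d,
        (1 + 4 * ((l : ℝ) + 1 + j) * qWeight q (n + 1 + ((l + 1 : ℕ) : ℤ))) ≤ P i := by
      intro i j hj
      refine Finset.prod_le_prod (fun l _ => hpos j l) fun l _ => ?_
      have := qWeight_nonneg q (n + 1 + ((l + 1 : ℕ) : ℤ))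
      have hj' : (j : ℝ) ≤ i + 1 := by exact_mod_cast hj
      push_cast
      gcongr 1 + 4 * ?_ * _
      linarith
    have hf : ∀ i, CoeffBdd (D * P i) x.1 := fun i => by
      have := ih1 0
      simp only [evenGeom, Finset.range_zero, Finset.sum_empty, zero_mul, add_zero] at this
      refine this.mono (mul_le_mul_of_nonneg_left ?_ hD0)
      simpa using hPle i 0 (by omega)
    have he : ∀ i, CoeffBdd (D * P i) x.2 := fun i => by
      refine ih2.mono (mul_le_mul_of_nonneg_left ?_ hD0)
      simpa using hPle i 0 (by omega)
    have hT : ∀ i, CoeffBdd (D * P i) (x.1 + evenGeom (i + 1) * ((1 - X) * x.2)) := fun i =>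
      (ih1 (i + 1)).mono (mul_le_mul_of_nonneg_left (hPle i (i + 1) le_rfl) hD0)
    have hprod : ∀ i : ℕ, ∏ l ∈ Finset.range (d + 1),
        (1 + 4 * ((l : ℝ) + 1 + i) * qWeight q (n + 1 + l)) = P i * (1 + 4 * (1 + i) * w) := by
      intro i
      rw [Finset.prod_range_succ']
      simp [hP, hw]
    rw [hstep]
    have hPD : ∀ i, 0 ≤ D * P i := fun i => (hf i).nonneg
    constructor
    · intro i
      rw [hprod]
      have e : (jostStep a b x).1 + evenGeom i * ((1 - X) * (jostStep a b x).2)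
          = (x.1 + evenGeom (i + 1) * ((1 - X) * x.2))
            + (C b * x.1 - C (a + b) * (X * x.1)) + C b * ((1 - X) * x.2)
            + X ^ 2 * (evenGeom i * ((1 - X) * (C b * x.2 + C (a + b) * x.1))) := by
        rw [evenGeom_succ]; simp only [jostStep]; ring
      rw [e]
      -- In units of `D * P i` the terms add up to 1 + (|b| + |a + b|) + 2|b| + 2i(|b| + |a + b|),
      -- which is at most 1 + 4(1 + i)w.
      refine ((((hT i).add (((hf i).C_mul b).sub ((hf i).X_mul.C_mul (a + b)))).add
        ((he i).one_sub_X_mul.C_mul b)).add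
        (((((he i).C_mul b).add ((hf i).C_mul (a + b))).one_sub_X_mul.evenGeom_mul
          i).X_pow_mul 2)).mono ?_
      have h1 := mul_le_mul_of_nonneg_right hbw (hPD i)
      have h2 := mul_le_mul_of_nonneg_right habw (hPD i)
      have hi : (0 : ℝ) ≤ i := Nat.cast_nonneg i
      nlinarith [mul_le_mul_of_nonneg_left h1 hi, mul_le_mul_of_nonneg_left h2 hi]
    · have := hprod 0
      simp only [Nat.cast_zero, add_zero] at this
      rw [this]
      refine (((he 0).add (((he 0).C_mul b).add ((hf 0).C_mul (a + b)))).X_pow_mul 2).mono ?_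
      have h1 := mul_le_mul_of_nonneg_right hbw (hPD 0)
      have h2 := mul_le_mul_of_nonneg_right habw (hPD 0)
      nlinarith [mul_nonneg hw0 (hPD 0)]

/-- Each step raises degrees by at most two. This linear growth lets the first moment dominate the
sum of all coefficients, and it is the source of the halved index in the decay estimate. -/
lemma natDegree_jostIncr (q : ℤ → ℝ) (d : ℕ) : ∀ n : ℤ,
    (jostIncr q d n).1.natDegree ≤ 2 * d + 1 ∧ (jostIncr q d n).2.natDegree ≤ 2 * d + 2 := by
  induction d with
  | zero =>
    intro n
    simp only [jostIncr]
    constructor <;> compute_degree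
  | succ d ih =>
    intro n
    obtain ⟨h1, h2⟩ := ih (n + 1)
    simp only [jostIncr, jostStep]
    set x := jostIncr q d (n + 1)
    have hX : (1 - X : ℝ[X]).natDegree ≤ 1 := by compute_degree
    have h3 : ((1 - X) * x.2).natDegree ≤ 2 * (d + 1) + 1 :=
      natDegree_mul_le.trans (by omega)
    have h4 : (X * x.1).natDegree ≤ 2 * (d + 1) + 1 :=
      natDegree_mul_le.trans (by rw [natDegree_X]; omega)
    have h5 : x.1.natDegree ≤ 2 * (d + 1) + 1 := by omega
    constructor
    · exact natDegree_add_le_of_degree_le (natDegree_add_le_of_degree_le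
        (natDegree_add_le_of_degree_le h5 h3)
        ((natDegree_sub_le_of_le ((natDegree_C_mul_le _ _).trans h5)
          ((natDegree_C_mul_le _ _).trans h4)).trans (by simp)))
        ((natDegree_C_mul_le _ _).trans h3)
    · refine natDegree_mul_le.trans ?_
      have : (x.2 + (C (q (n + 1) / (1 - q (n + 1))) * x.2
          + C (q (n + 1) + q (n + 1) / (1 - q (n + 1))) * x.1)).natDegree ≤ 2 * d + 2 :=
        natDegree_add_le_of_degree_le h2 (natDegree_add_le_of_degree_le
          ((natDegree_C_mul_le _ _).trans h2) ((natDegree_C_mul_le _ _).trans (by omega)))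
      rw [natDegree_X_pow]
      omega

/-- Constant in the coefficient bounds of the Jost solution at site `n`. -/
noncomputable def jostConst (q : ℤ → ℝ) (n : ℤ) : ℝ :=
  6 * Real.exp (4 * ∑' l : ℕ, ((l : ℝ) + 1) * qWeight q (n + 1 + l))

/-- The growth factors 1 + 4(l + 1)w multiply to at most the exponential of four times the first
moment, uniformly in the number of sites crossed. -/
lemma coeffBdd_jostIncr {q : ℤ → ℝ} {n : ℤ}
    (hs : Summable fun l : ℕ => ((l : ℝ) + 1) * qWeight q (n + 1 + l)) (d : ℕ) :
    CoeffBdd (jostConst q n * qWeight q (n + 1 + d)) (jostIncr q d n).1 ∧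
    CoeffBdd (jostConst q n * qWeight q (n + 1 + d))
      ((jostIncr q d n).1 + (jostIncr q d n).2) := by
  obtain ⟨h1, h2⟩ := coeffBdd_jostIncr_aux q d n
  have h0 := h1 0
  simp only [evenGeom, Finset.range_zero, Finset.sum_empty, zero_mul, add_zero, Nat.cast_zero]
    at h0
  have hP : ∏ l ∈ Finset.range d, (1 + 4 * ((l : ℝ) + 1) * qWeight q (n + 1 + l))
      ≤ Real.exp (4 * ∑' l : ℕ, ((l : ℝ) + 1) * qWeight q (n + 1 + l)) := by
    calc _ ≤ ∏ l ∈ Finset.range d, Real.exp (4 * ((l : ℝ) + 1) * qWeight q (n + 1 + l)) := by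
          refine Finset.prod_le_prod (fun l _ => ?_) fun l _ => ?_
          · have := qWeight_nonneg q (n + 1 + l); positivity
          · rw [add_comm]; exact Real.add_one_le_exp _
      _ = Real.exp (4 * ∑ l ∈ Finset.range d, ((l : ℝ) + 1) * qWeight q (n + 1 + l)) := by
          rw [← Real.exp_sum, Finset.mul_sum]; simp only [mul_assoc]
      _ ≤ _ := by
          gcongr
          exact hs.sum_le_tsum _ fun l _ => by
            have := qWeight_nonneg q (n + 1 + l); positivity
  have hw := qWeight_nonneg q (n + 1 + d)
  have hE := Real.exp_pos (4 * ∑' l : ℕ, ((l : ℝ) + 1) * qWeight q (n + 1 + l))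
  have key := mul_le_mul_of_nonneg_left hP (mul_nonneg (by norm_num : (0:ℝ) ≤ 3) hw)
  constructor
  · refine h0.mono (key.trans ?_)
    unfold jostConst
    nlinarith [mul_nonneg hw hE.le]
  -- The bounds with constant 3 for each component add up to the 6 in `jostConst`.
  · refine (h0.add h2).mono ((add_le_add key key).trans (le_of_eq ?_))
    unfold jostConst
    ring

end PolynomialIncrements

/-- `φ` is the sum of the power series with absolutely summable coefficients `c`
on the closed unit disc. -/
structure IsWiener (c : ℕ → ℂ) (φ : ℂ → ℂ) : Prop where
  summable : Summable fun k => ‖c k‖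
  hasSum : ∀ z, ‖z‖ ≤ 1 → HasSum (fun k => c k * z ^ k) (φ z)

/-! ### Summation of a family of polynomials into one power series. -/

section PolynomialSeries

open Polynomial

variable {p : ℕ → ℝ[X]} {w : ℕ → ℝ} {K : ℝ}

lemma sum_abs_coeff_le {r : ℝ[X]} {B : ℝ} {N : ℕ} (h : CoeffBdd B r) (hN : r.natDegree ≤ N) :
    HasSum (fun j => |r.coeff j|) (∑ j ∈ Finset.range (N + 1), |r.coeff j|) ∧
      ∑ j ∈ Finset.range (N + 1), |r.coeff j| ≤ (N + 1) * B := by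
  constructor
  · refine hasSum_sum_of_ne_finset_zero fun j hj => ?_
    rw [coeff_eq_zero_of_natDegree_lt, abs_zero]
    simp only [Finset.mem_range, not_lt] at hj
    omega
  · refine (Finset.sum_le_card_nsmul _ _ B fun j _ => h j).trans ?_
    simp

lemma summable_coeff_prod (hw : Summable fun d : ℕ => ((d : ℝ) + 1) * w d)
    (hp : ∀ d, CoeffBdd (K * w d) (p d)) (hdeg : ∀ d, (p d).natDegree ≤ 2 * d + 2) :
    Summable fun x : ℕ × ℕ => |(p x.1).coeff x.2| := by
  rw [summable_prod_of_nonneg fun x => abs_nonneg _]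
  refine ⟨fun d => (sum_abs_coeff_le (hp d) (hdeg d)).1.summable, ?_⟩
  -- The d-th polynomial has at most 2d + 3 ≤ 3(d + 1) coefficients, whence the factor 3.
  refine Summable.of_nonneg_of_le (fun d => tsum_nonneg fun j => abs_nonneg _) (fun d => ?_)
    (hw.mul_left (3 * K))
  obtain ⟨h1, h2⟩ := sum_abs_coeff_le (hp d) (hdeg d)
  rw [h1.tsum_eq]
  refine h2.trans ?_
  push_cast
  have := (hp d).nonneg
  nlinarith [mul_nonneg (Nat.cast_nonneg (α := ℝ) d) this]

/-- The total coefficient of `X ^ j` in the family `p`. -/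
noncomputable def totalCoeff (p : ℕ → ℝ[X]) (j : ℕ) : ℝ := ∑' d, (p d).coeff j

lemma summable_coeff (hw : Summable fun d : ℕ => ((d : ℝ) + 1) * w d)
    (hp : ∀ d, CoeffBdd (K * w d) (p d)) (hdeg : ∀ d, (p d).natDegree ≤ 2 * d + 2) (j : ℕ) :
    Summable fun d => |(p d).coeff j| :=
  (summable_coeff_prod hw hp hdeg).comp_injective (i := fun d : ℕ => (d, j))
    fun _ _ h => (Prod.ext_iff.1 h).1

lemma abs_totalCoeff_le_tsum (hw : Summable fun d : ℕ => ((d : ℝ) + 1) * w d)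
    (hp : ∀ d, CoeffBdd (K * w d) (p d)) (hdeg : ∀ d, (p d).natDegree ≤ 2 * d + 2) (j : ℕ) :
    |totalCoeff p j| ≤ ∑' d, |(p d).coeff j| := by
  have := norm_tsum_le_tsum_norm (f := fun d => (p d).coeff j)
    (by simpa using summable_coeff hw hp hdeg j)
  simpa [totalCoeff] using this

lemma summable_totalCoeff (hw : Summable fun d : ℕ => ((d : ℝ) + 1) * w d)
    (hp : ∀ d, CoeffBdd (K * w d) (p d)) (hdeg : ∀ d, (p d).natDegree ≤ 2 * d + 2) :
    Summable (fun j => |totalCoeff p j|) ∧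
      ∑' j, |totalCoeff p j| ≤ 3 * K * ∑' d : ℕ, ((d : ℝ) + 1) * w d := by
  have hs := summable_coeff_prod hw hp hdeg
  have hs' : Summable fun x : ℕ × ℕ => |(p x.2).coeff x.1| :=
    (Equiv.prodComm ℕ ℕ).summable_iff.2 hs
  have h1 : Summable fun j => ∑' d, |(p d).coeff j| :=
    ((summable_prod_of_nonneg fun x => abs_nonneg _).1 hs').2
  have hle := abs_totalCoeff_le_tsum hw hp hdeg
  have h2 := Summable.of_nonneg_of_le (fun j => abs_nonneg (totalCoeff p j)) hle h1
  refine ⟨h2, (h2.tsum_le_tsum hle h1).trans ?_⟩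
  have h3 : ∑' j, ∑' d, |(p d).coeff j| = ∑' d, ∑' j, |(p d).coeff j| :=
    (Summable.tsum_comm (f := fun d j => |(p d).coeff j|) hs)
  rw [h3, ← tsum_mul_left]
  refine Summable.tsum_le_tsum (fun d => ?_)
    ((summable_prod_of_nonneg fun x => abs_nonneg _).1 hs).2 (hw.mul_left _)
  obtain ⟨h1, h2⟩ := sum_abs_coeff_le (hp d) (hdeg d)
  rw [h1.tsum_eq]
  refine h2.trans ?_
  push_cast
  have := (hp d).nonneg
  nlinarith [mul_nonneg (Nat.cast_nonneg (α := ℝ) d) this]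

lemma summable_of_summable_weighted (hw0 : ∀ d, 0 ≤ w d)
    (hw : Summable fun d : ℕ => ((d : ℝ) + 1) * w d) : Summable w :=
  Summable.of_nonneg_of_le hw0 (fun d => by
    nlinarith [mul_nonneg (Nat.cast_nonneg (α := ℝ) d) (hw0 d)]) hw

/-- A polynomial of degree at most 2d + 1 reaches the power j only when d ≥ j / 2, so all earlier
indices drop out. The sharper degree bound, available for f but not for f + ε, gives exactly this
cut-off. -/
lemma abs_totalCoeff_le (hw0 : ∀ d, 0 ≤ w d) (hw : Summable fun d : ℕ => ((d : ℝ) + 1) * w d)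
    (hp : ∀ d, CoeffBdd (K * w d) (p d)) (hdeg : ∀ d, (p d).natDegree ≤ 2 * d + 1) (j : ℕ) :
    |totalCoeff p j| ≤ K * ∑' d, w (d + j / 2) := by
  have hdeg' : ∀ d, (p d).natDegree ≤ 2 * d + 2 := fun d => (hdeg d).trans (by omega)
  have hs := summable_coeff hw hp hdeg' j
  refine (abs_totalCoeff_le_tsum hw hp hdeg' j).trans ?_
  rw [← hs.sum_add_tsum_nat_add (j / 2), Finset.sum_eq_zero, zero_add, ← tsum_mul_left]
  · exact Summable.tsum_le_tsum (fun d => hp _ j) ((summable_nat_add_iff (j / 2)).2 hs)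
      (((summable_nat_add_iff (j / 2)).2 (summable_of_summable_weighted hw0 hw)).mul_left K)
  · intro d hd
    rw [Finset.mem_range] at hd
    rw [coeff_eq_zero_of_natDegree_lt, abs_zero]
    have := hdeg d
    omega

/-- The double family of coefficients is absolutely summable, so it may be summed by polynomials or
by powers of z. -/
lemma hasSum_aeval (hw : Summable fun d : ℕ => ((d : ℝ) + 1) * w d)
    (hp : ∀ d, CoeffBdd (K * w d) (p d)) (hdeg : ∀ d, (p d).natDegree ≤ 2 * d + 2) {z : ℂ}
    (hz : ‖z‖ ≤ 1) :
    (Summable fun d => aeval z (p d)) ∧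
      HasSum (fun j => (totalCoeff p j : ℂ) * z ^ j) (∑' d, aeval z (p d)) := by
  have hs := summable_coeff_prod hw hp hdeg
  have hF : Summable fun x : ℕ × ℕ => ((p x.1).coeff x.2 : ℂ) * z ^ x.2 := by
    refine Summable.of_norm_bounded hs fun x => ?_
    rw [norm_mul, norm_pow, Complex.norm_real, Real.norm_eq_abs]
    exact mul_le_of_le_one_right (abs_nonneg _) (pow_le_one₀ (norm_nonneg _) hz)
  have hrow : ∀ d, HasSum (fun j => ((p d).coeff j : ℂ) * z ^ j) (aeval z (p d)) := by
    intro d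
    rw [aeval_eq_sum_range' (n := 2 * d + 3) (Nat.lt_succ_of_le (hdeg d))]
    simp only [Complex.real_smul]
    refine hasSum_sum_of_ne_finset_zero fun j hj => ?_
    rw [coeff_eq_zero_of_natDegree_lt, Complex.ofReal_zero, zero_mul]
    simp only [Finset.mem_range, not_lt] at hj
    have := hdeg d
    omega
  have hd := hF.hasSum.prod_fiberwise hrow
  refine ⟨hd.summable, ?_⟩
  have hcol : ∀ j, HasSum (fun d => ((p d).coeff j : ℂ) * z ^ j) ((totalCoeff p j : ℂ) * z ^ j) := by
    intro j
    refine HasSum.mul_right _ ?_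
    have := (summable_coeff hw hp hdeg j)
    exact Complex.hasSum_ofReal.2 this.of_abs.hasSum
  have hF' : HasSum (fun x : ℕ × ℕ => ((p x.2).coeff x.1 : ℂ) * z ^ x.1)
      (∑' x : ℕ × ℕ, ((p x.1).coeff x.2 : ℂ) * z ^ x.2) :=
    (Equiv.prodComm ℕ ℕ).hasSum_iff.2 hF.hasSum
  have := hF'.prod_fiberwise hcol
  rwa [hd.tsum_eq]

end PolynomialSeries

/-! ### Weighted tails of the potential. -/

section Potential

variable {q : ℤ → ℝ}

/-- Since q tends to 0, |1 - q| ≥ 1/2 off a finite set; there |q̃| ≤ 2|q| and the weight is at most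
3|q|. -/
lemma summable_qWeight
    (hq : Summable fun n : ℤ => (1 + |(n : ℝ)|) * |q n|) :
    Summable fun n : ℤ => (1 + |(n : ℝ)|) * qWeight q n := by
  have hlim := hq.tendsto_cofinite_zero
  have hev : ∀ᶠ n : ℤ in cofinite, |q n| < 1 / 2 := by
    filter_upwards [hlim.eventually (gt_mem_nhds (by norm_num : (0 : ℝ) < 1 / 2))] with n hn
    nlinarith [mul_nonneg (abs_nonneg (n : ℝ)) (abs_nonneg (q n))]
  refine Summable.of_norm_bounded_eventually (hq.mul_left 3) ?_
  filter_upwards [hev] with n hn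
  have h0 : 0 ≤ 1 + |(n : ℝ)| := by positivity
  rw [Real.norm_eq_abs, abs_of_nonneg (mul_nonneg h0 (qWeight_nonneg q n))]
  have h1 : 1 / 2 ≤ |1 - q n| := by
    have := neg_abs_le (q n)
    have := le_abs_self (q n)
    exact le_trans (by linarith) (le_abs_self _)
  have h2 : |q n / (1 - q n)| ≤ 2 * |q n| := by
    rw [abs_div, div_le_iff₀ (by linarith)]
    nlinarith [abs_nonneg (q n)]
  unfold qWeight
  nlinarith [abs_nonneg (q n)]

/-- The weighted tails of the potential. -/
lemma summable_tail (hq : Summable fun n : ℤ => (1 + |(n : ℝ)|) * |q n|)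
    (n : ℤ) : Summable fun l : ℕ => ((l : ℝ) + 1) * qWeight q (n + l) := by
  have h := (summable_qWeight hq).comp_injective (i := fun l : ℕ => n + (l : ℤ))
    fun _ _ h => by simpa using h
  refine Summable.of_nonneg_of_le (fun l => ?_) (fun l => ?_) (h.mul_left (1 + |(n : ℝ)|))
  · have := qWeight_nonneg q (n + l); positivity
  · simp only [Function.comp_apply]
    rw [← mul_assoc]
    refine mul_le_mul_of_nonneg_right ?_ (qWeight_nonneg _ _)
    push_cast
    have h1 : (l : ℝ) ≤ |(n : ℝ)| + |(n : ℝ) + l| := by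
      have h2 := neg_abs_le (n : ℝ)
      have h3 := le_abs_self ((n : ℝ) + l)
      have h4 := le_abs_self (n : ℝ)
      linarith [neg_le_abs (n : ℝ)]
    nlinarith [abs_nonneg (n : ℝ), abs_nonneg ((n : ℝ) + l),
      mul_nonneg (abs_nonneg (n : ℝ)) (abs_nonneg ((n : ℝ) + l))]

/-- The weighted tails tend to zero at `+∞`. -/
lemma tendsto_tail (hq : Summable fun n : ℤ => (1 + |(n : ℝ)|) * |q n|) :
    Tendsto (fun n : ℤ => ∑' l : ℕ, ((l : ℝ) + 1) * qWeight q (n + 1 + l)) atTop (𝓝 0) := by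
  rw [← Nat.map_cast_int_atTop, tendsto_map'_iff]
  have h : Summable fun l : ℕ => ((l : ℝ) + 1) * qWeight q l := by
    simpa using summable_tail hq 0
  set v : ℕ → ℝ := fun l => ((l : ℝ) + 1) * qWeight q l with hv
  have h3 : Tendsto (fun n => ∑' l, v (l + (n + 1))) atTop (𝓝 0) :=
    (tendsto_sum_nat_add v).comp (tendsto_add_atTop_nat 1)
  have hle : ∀ n l : ℕ, ((l : ℝ) + 1) * qWeight q (((n : ℕ) : ℤ) + 1 + l) ≤ v (l + (n + 1)) := by
    intro n l
    have : (((l + (n + 1) : ℕ)) : ℤ) = n + 1 + l := by push_cast; ring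
    simp only [hv, this]
    refine mul_le_mul_of_nonneg_right ?_ (qWeight_nonneg _ _)
    push_cast
    have : (0 : ℝ) ≤ n := Nat.cast_nonneg n
    linarith
  refine squeeze_zero (fun n => tsum_nonneg fun l => ?_) (fun n => ?_) h3
  · have := qWeight_nonneg q (((n : ℕ) : ℤ) + 1 + l)
    positivity
  · exact (summable_tail hq _).tsum_le_tsum (hle n) ((summable_nat_add_iff (n + 1)).2 h)

end Potential

/-! ### The Jost power series f and g. -/

section JostSeries

open Polynomial

/-- `f_n(z)`: the first component of `z^{-n} w⁺_n`. -/
noncomputable def jostF (q : ℤ → ℝ) (n : ℤ) (z : ℂ) : ℂ :=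
  1 + ∑' d, aeval z (jostIncr q d n).1

/-- `g_n(z)`: the second component of `z^{-n} w⁺_n` up to an elementary factor. -/
noncomputable def jostG (q : ℤ → ℝ) (n : ℤ) (z : ℂ) : ℂ :=
  1 + ∑' d, aeval z ((jostIncr q d n).1 + (jostIncr q d n).2)

/-- The power series coefficients of `jostF`. -/
noncomputable def jostFCoeff (q : ℤ → ℝ) (n : ℤ) (j : ℕ) : ℂ :=
  (if j = 0 then 1 else 0) + totalCoeff (fun d => (jostIncr q d n).1) j

/-- The power series coefficients of `jostG`. -/
noncomputable def jostGCoeff (q : ℤ → ℝ) (n : ℤ) (j : ℕ) : ℂ :=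
  (if j = 0 then 1 else 0) +
    totalCoeff (fun d => (jostIncr q d n).1 + (jostIncr q d n).2) j

variable {q : ℤ → ℝ}

lemma natDegree_jostIncr_add (q : ℤ → ℝ) (n : ℤ) (d : ℕ) :
    ((jostIncr q d n).1 + (jostIncr q d n).2).natDegree ≤ 2 * d + 2 :=
  natDegree_add_le_of_degree_le ((natDegree_jostIncr q d n).1.trans (by omega))
    (natDegree_jostIncr q d n).2

lemma isWiener_one_add {p : ℕ → ℝ[X]} {w : ℕ → ℝ} {K : ℝ}
    (hw : Summable fun d : ℕ => ((d : ℝ) + 1) * w d)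
    (hp : ∀ d, CoeffBdd (K * w d) (p d)) (hdeg : ∀ d, (p d).natDegree ≤ 2 * d + 2) :
    IsWiener (fun j => (if j = 0 then 1 else 0) + (totalCoeff p j : ℂ))
      (fun z => 1 + ∑' d, aeval z (p d)) where
  summable := by
    refine Summable.of_nonneg_of_le (fun _ => norm_nonneg _) (fun j => norm_add_le _ _)
      (Summable.add (summable_of_ne_finset_zero (s := {0}) fun j hj => ?_) ?_)
    · simp only [Finset.mem_singleton] at hj
      simp [hj]
    · simpa using (summable_totalCoeff hw hp hdeg).1
  hasSum z hz := by
    simp only [add_mul]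
    refine HasSum.add ?_ (hasSum_aeval hw hp hdeg hz).2
    have h1 := hasSum_single (f := fun j : ℕ => (if j = 0 then (1 : ℂ) else 0) * z ^ j) 0
      fun j hj => by simp [hj]
    simpa using h1

lemma isWiener_jostF (hq : Summable fun n : ℤ => (1 + |(n : ℝ)|) * |q n|) (n : ℤ) :
    IsWiener (jostFCoeff q n) (jostF q n) :=
  isWiener_one_add (summable_tail hq (n + 1))
    (fun d => (coeffBdd_jostIncr (summable_tail hq (n + 1)) d).1)
    fun d => (natDegree_jostIncr q d n).1.trans (by omega)

lemma isWiener_jostG (hq : Summable fun n : ℤ => (1 + |(n : ℝ)|) * |q n|) (n : ℤ) :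
    IsWiener (jostGCoeff q n) (jostG q n) :=
  isWiener_one_add (summable_tail hq (n + 1))
    (fun d => (coeffBdd_jostIncr (summable_tail hq (n + 1)) d).2)
    fun d => natDegree_jostIncr_add q n d

lemma norm_jostFCoeff_le (hq : Summable fun n : ℤ => (1 + |(n : ℝ)|) * |q n|) (n : ℤ) {j : ℕ}
    (hj : j ≠ 0) :
    ‖jostFCoeff q n j‖ ≤ jostConst q n * ∑' l : ℕ, qWeight q (n + 1 + (j / 2 : ℕ) + l) := by
  have := abs_totalCoeff_le (fun d => qWeight_nonneg q (n + 1 + d)) (summable_tail hq (n + 1))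
    (fun d => (coeffBdd_jostIncr (summable_tail hq (n + 1)) d).1)
    (fun d => (natDegree_jostIncr q d n).1) j
  simp only [jostFCoeff, if_neg hj, zero_add, Complex.norm_real, Real.norm_eq_abs]
  refine this.trans (le_of_eq ?_)
  congr 1
  refine tsum_congr fun l => ?_
  congr 1; push_cast; ring

lemma tendsto_jostConst (hq : Summable fun n : ℤ => (1 + |(n : ℝ)|) * |q n|) :
    Tendsto (fun n : ℤ => 3 * jostConst q n * ∑' l : ℕ, ((l : ℝ) + 1) * qWeight q (n + 1 + l))
      atTop (𝓝 0) := by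
  have h := tendsto_tail hq
  have h2 : Tendsto (fun n : ℤ => jostConst q n) atTop (𝓝 (6 * Real.exp (4 * 0))) :=
    ((Real.continuous_exp.tendsto _).comp (h.const_mul 4)).const_mul 6
  simpa using (h2.const_mul 3).mul h

/-- The total size of the perturbation of the coefficients `f_n`. -/
lemma tsum_norm_jostFCoeff_sub_le (hq : Summable fun n : ℤ => (1 + |(n : ℝ)|) * |q n|) (n : ℤ) :
    (Summable fun j => ‖jostFCoeff q n j - if j = 0 then 1 else 0‖) ∧
    ∑' j, ‖jostFCoeff q n j - if j = 0 then 1 else 0‖ ≤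
      3 * jostConst q n * ∑' l : ℕ, ((l : ℝ) + 1) * qWeight q (n + 1 + l) := by
  have h := (summable_totalCoeff (summable_tail hq (n + 1))
    (fun d => (coeffBdd_jostIncr (summable_tail hq (n + 1)) d).1)
    (fun d => (natDegree_jostIncr q d n).1.trans (by omega)))
  simpa [jostFCoeff] using h

lemma norm_sub_one_le_of_totalCoeff {p : ℕ → ℝ[X]} {w : ℕ → ℝ} {K : ℝ}
    (hw : Summable fun d : ℕ => ((d : ℝ) + 1) * w d)
    (hp : ∀ d, CoeffBdd (K * w d) (p d)) (hdeg : ∀ d, (p d).natDegree ≤ 2 * d + 2) {z : ℂ}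
    (hz : ‖z‖ ≤ 1) :
    ‖(1 + ∑' d, aeval z (p d)) - 1‖ ≤ 3 * K * ∑' d : ℕ, ((d : ℝ) + 1) * w d := by
  have h := summable_totalCoeff hw hp hdeg
  rw [add_sub_cancel_left, ← (hasSum_aeval hw hp hdeg hz).2.tsum_eq]
  have hb : ∀ j, ‖(totalCoeff p j : ℂ) * z ^ j‖ ≤ |totalCoeff p j| := fun j => by
    rw [norm_mul, norm_pow, Complex.norm_real, Real.norm_eq_abs]
    exact mul_le_of_le_one_right (abs_nonneg _) (pow_le_one₀ (norm_nonneg _) hz)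
  exact (tsum_of_norm_bounded h.1.hasSum hb).trans h.2

/-- `f_n` and `g_n` tend to `1` at `+∞`, uniformly on the closed disc. -/
lemma eventually_norm_jostF_sub_one (hq : Summable fun n : ℤ => (1 + |(n : ℝ)|) * |q n|)
    {ε : ℝ} (hε : 0 < ε) :
    ∀ᶠ n : ℤ in atTop, ∀ z : ℂ, ‖z‖ ≤ 1 → ‖jostF q n z - 1‖ ≤ ε ∧ ‖jostG q n z - 1‖ ≤ ε := by
  filter_upwards [(tendsto_jostConst hq).eventually (gt_mem_nhds hε)] with n hn z hz
  exact ⟨(norm_sub_one_le_of_totalCoeff (summable_tail hq (n + 1))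
    (fun d => (coeffBdd_jostIncr (summable_tail hq (n + 1)) d).1)
    (fun d => (natDegree_jostIncr q d n).1.trans (by omega)) hz).trans hn.le,
    (norm_sub_one_le_of_totalCoeff (summable_tail hq (n + 1))
    (fun d => (coeffBdd_jostIncr (summable_tail hq (n + 1)) d).2)
    (fun d => natDegree_jostIncr_add q n d) hz).trans hn.le⟩

/-- With q̃ = 1/(1 - q) - 1, the map `jostStep` is the recurrence written for (f, g - f). The
increment d + 1 at n is the step applied to the increment d at n + 1, and the increment 0 is the
change the step makes to the free solution (1, 0); summing over d gives the recurrence. -/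
lemma jost_recurrence_aux (hq1 : ∀ n, q n ≠ 1)
    (hq : Summable fun n : ℤ => (1 + |(n : ℝ)|) * |q n|) (n : ℤ) {z : ℂ} (hz : ‖z‖ ≤ 1) :
    jostF q n z = z * (1 - q (n + 1)) * jostF q (n + 1) z
        + (1 - z) * jostG q (n + 1) z / (1 - q (n + 1)) ∧
    jostG q n z = z * jostG q (n + 1) z / (1 - q (n + 1)) + (1 - z) * jostF q n z := by
  have hF : ∀ n, Summable fun d => aeval z (jostIncr q d n).1 := fun n =>
    (hasSum_aeval (summable_tail hq (n + 1))
      (fun d => (coeffBdd_jostIncr (summable_tail hq (n + 1)) d).1)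
      (fun d => (natDegree_jostIncr q d n).1.trans (by omega)) hz).1
  have hG : ∀ n, Summable fun d => aeval z ((jostIncr q d n).1 + (jostIncr q d n).2) := fun n =>
    (hasSum_aeval (summable_tail hq (n + 1))
      (fun d => (coeffBdd_jostIncr (summable_tail hq (n + 1)) d).2)
      (fun d => natDegree_jostIncr_add q n d) hz).1
  have hne : (1 - q (n + 1) : ℂ) ≠ 0 := by
    rw [sub_ne_zero]; exact_mod_cast (hq1 (n + 1)).symm
  have e1 : jostF q n z = z * (1 - q (n + 1)) * jostF q (n + 1) z
        + (1 - z) * jostG q (n + 1) z / (1 - q (n + 1)) := by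
    have hstep : ∀ d, aeval z (jostIncr q (d + 1) n).1
        = z * (1 - q (n + 1)) * aeval z (jostIncr q d (n + 1)).1
          + (1 - z) / (1 - q (n + 1))
            * aeval z ((jostIncr q d (n + 1)).1 + (jostIncr q d (n + 1)).2) := by
      intro d
      simp only [jostIncr, jostStep, map_add, map_sub, map_mul, aeval_C, aeval_X, map_one,
        Complex.coe_algebraMap, Complex.ofReal_add, Complex.ofReal_div, Complex.ofReal_sub,
        Complex.ofReal_one]
      field_simp
      ring
    unfold jostF jostG
    rw [(hF n).tsum_eq_zero_add]
    simp only [hstep]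
    rw [((hF (n + 1)).mul_left _).tsum_add ((hG (n + 1)).mul_left _), tsum_mul_left,
      tsum_mul_left]
    simp only [jostIncr, map_sub, map_mul, aeval_C, aeval_X,
        Complex.coe_algebraMap, Complex.ofReal_add, Complex.ofReal_div, Complex.ofReal_sub,
        Complex.ofReal_one]
    field_simp
    ring
  refine ⟨e1, ?_⟩
  have hstep : ∀ d, aeval z ((jostIncr q (d + 1) n).1 + (jostIncr q (d + 1) n).2)
      = z / (1 - q (n + 1)) * aeval z ((jostIncr q d (n + 1)).1 + (jostIncr q d (n + 1)).2)
        + (1 - z) * aeval z (jostIncr q (d + 1) n).1 := by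
    intro d
    simp only [jostIncr, jostStep, map_add, map_sub, map_mul, map_pow, aeval_C, aeval_X, map_one,
      Complex.coe_algebraMap, Complex.ofReal_add, Complex.ofReal_div, Complex.ofReal_sub,
      Complex.ofReal_one]
    field_simp
    ring
  unfold jostF jostG
  rw [(hG n).tsum_eq_zero_add, (hF n).tsum_eq_zero_add]
  simp only [hstep]
  rw [((hG (n + 1)).mul_left _).tsum_add (((summable_nat_add_iff 1).2 (hF n)).mul_left _),
    tsum_mul_left, tsum_mul_left]
  simp only [jostIncr, map_add, map_sub, map_mul, map_pow, aeval_C, aeval_X,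
      Complex.coe_algebraMap, Complex.ofReal_add, Complex.ofReal_div, Complex.ofReal_sub,
      Complex.ofReal_one]
  field_simp
  ring

/-- The increments have real coefficients because q is real. On the unit circle this turns z → 1/z
into complex conjugation of the Jost solutions. -/
lemma jostF_conj (q : ℤ → ℝ) (n : ℤ) (z : ℂ) :
    jostF q n (starRingEnd ℂ z) = starRingEnd ℂ (jostF q n z) := by
  simp only [jostF, map_add, map_one, Complex.conj_tsum, aeval_conj]

lemma jostG_conj (q : ℤ → ℝ) (n : ℤ) (z : ℂ) :
    jostG q n (starRingEnd ℂ z) = starRingEnd ℂ (jostG q n z) := by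
  simp only [jostG, map_one, Complex.conj_tsum, aeval_conj, map_add (starRingEnd ℂ)]

end JostSeries

/-! ### Power series with absolutely summable coefficients. -/

section Wiener

variable {c : ℕ → ℂ} {φ : ℂ → ℂ}

lemma IsWiener.norm_le (h : IsWiener c φ) {z : ℂ} (hz : ‖z‖ ≤ 1) : ‖φ z‖ ≤ ∑' k, ‖c k‖ := by
  refine (h.hasSum z hz).norm_le_of_bounded h.summable.hasSum fun k => ?_
  rw [norm_mul, norm_pow]
  exact mul_le_of_le_one_right (norm_nonneg _) (pow_le_one₀ (norm_nonneg _) hz)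

lemma IsWiener.continuousOn (h : IsWiener c φ) : ContinuousOn φ (Metric.closedBall 0 1) := by
  have h1 : ContinuousOn (fun z => ∑' k, c k * z ^ k) (Metric.closedBall 0 1) := by
    refine continuousOn_tsum (fun k => by fun_prop) h.summable fun k z hz => ?_
    rw [mem_closedBall_zero_iff] at hz
    rw [norm_mul, norm_pow]
    exact mul_le_of_le_one_right (norm_nonneg _) (pow_le_one₀ (norm_nonneg _) hz)
  exact h1.congr fun z hz => ((h.hasSum z (mem_closedBall_zero_iff.1 hz)).tsum_eq).symm

lemma IsWiener.hasFPowerSeriesOnBall (h : IsWiener c φ) :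
    HasFPowerSeriesOnBall φ (FormalMultilinearSeries.ofScalars ℂ c) 0 1 where
  r_le := by
    refine FormalMultilinearSeries.le_radius_of_summable_norm _ (r := 1) ?_
    simpa [FormalMultilinearSeries.ofScalars_norm] using h.summable
  r_pos := by norm_num
  hasSum {y} hy := by
    have hy' : ‖y‖ < 1 := by
      simpa [Metric.mem_eball, edist_zero_right, ← ofReal_norm] using hy
    simpa [FormalMultilinearSeries.ofScalars_apply_eq, mul_comm] using h.hasSum y hy'.le

lemma IsWiener.differentiableOn (h : IsWiener c φ) : DifferentiableOn ℂ φ (Metric.ball 0 1) := by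
  refine h.hasFPowerSeriesOnBall.differentiableOn.mono fun z hz => ?_
  simpa [Metric.mem_eball, edist_zero_right, ← ofReal_norm] using hz

lemma IsWiener.eval_zero (h : IsWiener c φ) : φ 0 = c 0 := by
  have := (h.hasSum 0 (by simp)).tsum_eq
  rw [← this, tsum_eq_single 0]
  · simp
  · intro k hk; simp [hk]

lemma IsWiener.deriv_zero (h : IsWiener c φ) : HasDerivAt φ (c 1) 0 := by
  have := h.hasFPowerSeriesOnBall.hasFPowerSeriesAt.hasDerivAt
  simpa using this

end Wiener

/-! ### The branch of λ, and the reduced system without λ. -/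

section Lam

lemma lam_sq (m : ℝ) (z : ℂ) : lam m z ^ 2 = (m : ℂ) ^ 2 + 2 - z - z⁻¹ := by
  have := Complex.cpow_nat_inv_pow ((m : ℂ) ^ 2 + 2 - z - z⁻¹) (n := 2) two_ne_zero
  simpa [lam] using this

lemma lam_re_nonneg (m : ℝ) (z : ℂ) : 0 ≤ (lam m z).re := by
  unfold lam
  set x := (m : ℂ) ^ 2 + 2 - z - z⁻¹
  by_cases hx : x = 0
  · simp [hx]
  · rw [Complex.cpow_def_of_ne_zero hx, Complex.exp_re]
    refine mul_nonneg (Real.exp_pos _).le (Real.cos_nonneg_of_mem_Icc ?_)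
    have h1 := Complex.neg_pi_lt_arg x
    have h2 := Complex.arg_le_pi x
    have : (Complex.log x * (1 / 2)).im = x.arg / 2 := by
      simp [Complex.mul_im, Complex.log_im]; ring
    rw [this]
    constructor <;> linarith

lemma add_lam_ne_zero {m : ℝ} (hm : 0 < m) (z : ℂ) : (m : ℂ) + lam m z ≠ 0 := by
  intro h
  have := congrArg Complex.re h
  simp only [Complex.add_re, Complex.ofReal_re, Complex.zero_re] at this
  linarith [lam_re_nonneg m z]

lemma lam_inv (m : ℝ) (z : ℂ) : lam m z⁻¹ = lam m z := by
  unfold lam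
  rw [inv_inv]
  congr 1
  ring

end Lam

/-- The reduced spectral parameter `λ² - m²`. -/
noncomputable def redMu (z : ℂ) : ℂ := 2 - z - z⁻¹

lemma redMu_inv (z : ℂ) : redMu z⁻¹ = redMu z := by
  unfold redMu
  rw [inv_inv]
  ring

/-- Solutions of the Dirac equation with second component rescaled by `m + λ`. -/
structure IsRedSol (q : ℤ → ℝ) (μ : ℂ) (u v : ℤ → ℂ) : Prop where
  snd_succ : ∀ n, v (n + 1) = (1 - q n) * v n + μ * u n
  fst_pred : ∀ n, u (n - 1) = (1 - q n) * u n + v n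

/-- Rescaling v by m + λ absorbs λ into the second equation, and multiplying the first by m + λ
leaves only (λ - m)(λ + m). The factor is invertible because Re λ ≥ 0 < m. -/
lemma diracOp_eq_iff {m : ℝ} (hm : 0 < m) (q : ℤ → ℝ) (z : ℂ) (w : ℤ → ℂ × ℂ) :
    diracOp m q w = lam m z • w ↔
      IsRedSol q (redMu z) (fun n => (w n).1) (fun n => (m + lam m z) * (w n).2) := by
  have hne := add_lam_ne_zero hm z
  have hsq : redMu z = lam m z ^ 2 - (m : ℂ) ^ 2 := by rw [lam_sq, redMu]; ring
  rw [funext_iff]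
  constructor
  · intro h
    refine ⟨fun n => ?_, fun n => ?_⟩
    · have := (Prod.ext_iff.1 (h n)).1
      simp only [diracOp, Pi.smul_apply, Prod.smul_fst, smul_eq_mul] at this
      rw [hsq]
      linear_combination (m + lam m z) * this
    · have := (Prod.ext_iff.1 (h n)).2
      simp only [diracOp, Pi.smul_apply, Prod.smul_snd, smul_eq_mul] at this
      linear_combination this
  · rintro ⟨h1, h2⟩ n
    have h1 := h1 n
    have h2 := h2 n
    rw [hsq] at h1
    refine Prod.ext ?_ ?_
    · simp only [diracOp, Pi.smul_apply, Prod.smul_fst, smul_eq_mul]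
      refine mul_left_cancel₀ hne ?_
      linear_combination h1
    · simp only [diracOp, Pi.smul_apply, Prod.smul_snd, smul_eq_mul]
      linear_combination h2

/-- The reduced Wronskian. -/
def redW (u v u' v' : ℤ → ℂ) (n : ℤ) : ℂ := u n * v' (n + 1) - u' n * v (n + 1)

/-! ### Wronskians and uniqueness for the reduced system. -/

section RedSol

variable {q : ℤ → ℝ} {μ μ' : ℂ} {u v u' v' : ℤ → ℂ}

lemma one_sub_ne_zero_of_ne (hq1 : ∀ n, q n ≠ 1) (n : ℤ) : (1 - q n : ℂ) ≠ 0 := by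
  rw [sub_ne_zero]; exact_mod_cast (hq1 n).symm

/-- Discrete Green identity. Constancy of the Wronskian, orthogonality of bound states, the lower
bound for the Wronskian and the residues of T all come from it. -/
lemma redW_sub (h : IsRedSol q μ u v) (h' : IsRedSol q μ' u' v') (n : ℤ) :
    redW u v u' v' n - redW u v u' v' (n - 1) = (μ' - μ) * (u n * u' n) := by
  simp only [redW, sub_add_cancel, h.snd_succ n, h'.snd_succ n, h.fst_pred n, h'.fst_pred n]
  ring

lemma redW_const (h : IsRedSol q μ u v) (h' : IsRedSol q μ u' v') (n k : ℤ) :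
    redW u v u' v' n = redW u v u' v' k := by
  have hstep : ∀ n, redW u v u' v' (n + 1) = redW u v u' v' n := fun n => by
    have := redW_sub h h' (n + 1)
    rw [sub_self, zero_mul, add_sub_cancel_right] at this
    exact sub_eq_zero.1 this
  have : ∀ n, redW u v u' v' n = redW u v u' v' 0 := fun n => by
    induction n with
    | zero => rfl
    | succ n ih => rw [hstep, ih]
    | pred n ih => rw [← ih, ← hstep, sub_add_cancel]
  rw [this, this k]

lemma IsRedSol.lin_comb (h : IsRedSol q μ u v) (h' : IsRedSol q μ u' v') (c : ℂ) :
    IsRedSol q μ (fun n => u' n - c * u n) (fun n => v' n - c * v n) where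
  snd_succ n := by rw [h.snd_succ, h'.snd_succ]; ring
  fst_pred n := by rw [h.fst_pred, h'.fst_pred]; ring

/-- Since 1 - q never vanishes, the pair (u_k, v_{k+1}) determines the solution in both directions.
-/
lemma IsRedSol.eq_zero (hq1 : ∀ n, q n ≠ 1) (h : IsRedSol q μ u v) (k : ℤ)
    (hu : u k = 0) (hv : v (k + 1) = 0) : ∀ n, u n = 0 ∧ v n = 0 := by
  have hup : ∀ n, u n = 0 → v (n + 1) = 0 → u (n + 1) = 0 ∧ v (n + 1 + 1) = 0 := by
    intro n h1 h2
    have h3 := h.fst_pred (n + 1)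
    rw [add_sub_cancel_right, h1, h2, add_zero, eq_comm,
      mul_eq_zero_iff_left (one_sub_ne_zero_of_ne hq1 _)] at h3
    exact ⟨h3, by rw [h.snd_succ, h2, h3, mul_zero, mul_zero, add_zero]⟩
  have hdown : ∀ n, u n = 0 → v (n + 1) = 0 → u (n - 1) = 0 ∧ v n = 0 := by
    intro n h1 h2
    have h3 := h.snd_succ n
    rw [h1, h2, mul_zero, add_zero, eq_comm,
      mul_eq_zero_iff_left (one_sub_ne_zero_of_ne hq1 _)] at h3
    exact ⟨by rw [h.fst_pred, h1, h3, mul_zero, add_zero], h3⟩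
  have key : ∀ j : ℤ, u (k + j) = 0 ∧ v (k + j + 1) = 0 := by
    intro j
    induction j with
    | zero => simp [hu, hv]
    | succ j ih => simpa [add_assoc] using hup _ ih.1 ih.2
    | pred j ih =>
      have := hdown _ ih.1 ih.2
      rw [show k + (-(j : ℤ) - 1) = k + -(j : ℤ) - 1 by ring, sub_add_cancel]
      exact this
  intro n
  have := key (n - k)
  rw [add_sub_cancel] at this
  exact ⟨this.1, (hdown n this.1 this.2).2⟩

/-- Subtracting the multiple that matches u at k leaves a solution whose remaining datum v_{k+1} is
a multiple of the Wronskian. -/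
lemma IsRedSol.eq_mul (hq1 : ∀ n, q n ≠ 1) (h : IsRedSol q μ u v) (h' : IsRedSol q μ u' v')
    {k : ℤ} (hk : u k ≠ 0) (hW : redW u v u' v' k = 0) :
    ∀ n, u' n = u' k / u k * u n ∧ v' n = u' k / u k * v n := by
  have := (h.lin_comb h' (u' k / u k)).eq_zero hq1 k (by field_simp; ring) (by
    unfold redW at hW
    field_simp
    linear_combination hW)
  exact fun n => ⟨sub_eq_zero.1 (this n).1, sub_eq_zero.1 (this n).2⟩

/-- The Wronskian with the normalised solution is constant, yet multiplied by ρ_n ρ_{n+1}, of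
modulus at least 1, it tends to 0; so it vanishes. The two solutions are then proportional, and the
limits force the factor to be 0. No decay of the solutions themselves is used, so |z| = 1 is
covered. -/
lemma redSol_eq_zero_of_tendsto {l : Filter ℤ} [l.NeBot] (hq1 : ∀ n, q n ≠ 1)
    (hl : Tendsto (fun n : ℤ => n + 1) l l)
    {ρ : ℤ → ℂ} (hρ : ∀ᶠ n in l, 1 ≤ ‖ρ n * ρ (n + 1)‖) {β : ℂ}
    (h : IsRedSol q μ u v) (h' : IsRedSol q μ u' v')
    (h1 : Tendsto (fun n => ρ n * u n) l (𝓝 1)) (h2 : Tendsto (fun n => ρ n * v n) l (𝓝 β))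
    (h3 : Tendsto (fun n => ρ n * u' n) l (𝓝 0)) (h4 : Tendsto (fun n => ρ n * v' n) l (𝓝 0)) :
    ∀ n, u' n = 0 ∧ v' n = 0 := by
  have hT : Tendsto (fun n => ρ n * ρ (n + 1) * redW u v u' v' n) l (𝓝 0) := by
    have := (h1.mul (h4.comp hl)).sub (h3.mul (h2.comp hl))
    simp only [mul_zero, zero_mul, sub_zero] at this
    refine this.congr fun n => ?_
    simp only [redW, Function.comp_apply]; ring
  have hW : ∀ n, redW u v u' v' n = 0 := by
    intro n
    have hle : ∀ᶠ k in l, ‖redW u v u' v' n‖ ≤ ‖ρ k * ρ (k + 1) * redW u v u' v' k‖ := by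
      filter_upwards [hρ] with k hk
      rw [norm_mul, redW_const h h' k n]
      exact le_mul_of_one_le_left (norm_nonneg _) hk
    have := ge_of_tendsto hT.norm hle
    simpa using this
  obtain ⟨k, hk⟩ := (h1.eventually_ne one_ne_zero).exists
  have hk' : u k ≠ 0 := right_ne_zero_of_mul hk
  have hprop := h.eq_mul hq1 h' hk' (hW k)
  have h5 := h1.const_mul (u' k / u k)
  have h6 : Tendsto (fun n => ρ n * u' n) l (𝓝 (u' k / u k * 1)) :=
    h5.congr fun n => by rw [(hprop n).1]; ring
  have hc := tendsto_nhds_unique h6 h3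
  rw [mul_one] at hc
  exact fun n => ⟨by rw [(hprop n).1, hc, zero_mul], by rw [(hprop n).2, hc, zero_mul]⟩

end RedSol

/-! ### Existence and uniqueness of the Jost solutions. -/

section Solutions

/-- `f` for the reflected potential. -/
noncomputable def jostFm (q : ℤ → ℝ) (n : ℤ) (z : ℂ) : ℂ := jostF (fun k => q (-k)) (-n) z

/-- `g` for the reflected potential. -/
noncomputable def jostGm (q : ℤ → ℝ) (n : ℤ) (z : ℂ) : ℂ := jostG (fun k => q (-k)) (-n) z

/-- First component of the Jost solution at `+∞`. -/
noncomputable def uP (q : ℤ → ℝ) (z : ℂ) (n : ℤ) : ℂ := z ^ n * jostF q n z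

/-- Rescaled second component of the Jost solution at `+∞`. -/
noncomputable def vP (q : ℤ → ℝ) (z : ℂ) (n : ℤ) : ℂ :=
  z ^ n * ((z⁻¹ - 1) * jostG q n z / (1 - q n))

/-- First component of the Jost solution at `-∞`. -/
noncomputable def uM (q : ℤ → ℝ) (z : ℂ) (n : ℤ) : ℂ := z ^ (-n) * (jostGm q n z / (1 - q n))

/-- Rescaled second component of the Jost solution at `-∞`. -/
noncomputable def vM (q : ℤ → ℝ) (z : ℂ) (n : ℤ) : ℂ := z ^ (-n) * ((z - 1) * jostFm q n z)

variable {q : ℤ → ℝ}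

lemma summable_reflect (hq : Summable fun n : ℤ => (1 + |(n : ℝ)|) * |q n|) :
    Summable fun n : ℤ => (1 + |(n : ℝ)|) * |q (-n)| := by
  have := (Equiv.neg ℤ).summable_iff.2 hq
  simpa [Function.comp_def] using this

lemma jostF_pred (hq1 : ∀ n, q n ≠ 1) (hq : Summable fun n : ℤ => (1 + |(n : ℝ)|) * |q n|)
    (n : ℤ) {z : ℂ} (hz : ‖z‖ ≤ 1) :
    jostF q (n - 1) z = z * (1 - q n) * jostF q n z + (1 - z) * jostG q n z / (1 - q n) := by
  simpa using (jost_recurrence_aux hq1 hq (n - 1) hz).1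

lemma jostG_eq (hq1 : ∀ n, q n ≠ 1) (hq : Summable fun n : ℤ => (1 + |(n : ℝ)|) * |q n|)
    (n : ℤ) {z : ℂ} (hz : ‖z‖ ≤ 1) :
    jostG q n z = z * jostG q (n + 1) z / (1 - q (n + 1)) + (1 - z) * jostF q n z :=
  (jost_recurrence_aux hq1 hq n hz).2

lemma jostFm_succ (hq1 : ∀ n, q n ≠ 1) (hq : Summable fun n : ℤ => (1 + |(n : ℝ)|) * |q n|)
    (n : ℤ) {z : ℂ} (hz : ‖z‖ ≤ 1) :
    jostFm q (n + 1) z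
      = z * (1 - q n) * jostFm q n z + (1 - z) * jostGm q n z / (1 - q n) := by
  have := jostF_pred (q := fun k => q (-k)) (fun n => hq1 _) (summable_reflect hq) (-n) hz
  rw [neg_neg] at this
  rw [jostFm, jostFm, jostGm, ← this]
  congr 1; ring

lemma jostGm_eq (hq1 : ∀ n, q n ≠ 1) (hq : Summable fun n : ℤ => (1 + |(n : ℝ)|) * |q n|)
    (n : ℤ) {z : ℂ} (hz : ‖z‖ ≤ 1) :
    jostGm q n z
      = z * jostGm q (n - 1) z / (1 - q (n - 1)) + (1 - z) * jostFm q n z := by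
  have := jostG_eq (q := fun k => q (-k)) (fun n => hq1 _) (summable_reflect hq) (-n) hz
  rw [show -(-n + 1) = n - 1 by ring] at this
  rw [jostGm, jostGm, jostFm, this, show -(n - 1) = -n + 1 by ring]

lemma isRedSol_plus (hq1 : ∀ n, q n ≠ 1) (hq : Summable fun n : ℤ => (1 + |(n : ℝ)|) * |q n|)
    {z : ℂ} (hz0 : z ≠ 0) (hz : ‖z‖ ≤ 1) : IsRedSol q (redMu z) (uP q z) (vP q z) where
  snd_succ n := by
    have h1 := one_sub_ne_zero_of_ne hq1 n
    have h2 := one_sub_ne_zero_of_ne hq1 (n + 1)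
    have h := jostG_eq hq1 hq n hz
    simp only [uP, vP, redMu]
    rw [h, zpow_add_one₀ hz0]
    field_simp
    ring
  fst_pred n := by
    have h1 := one_sub_ne_zero_of_ne hq1 n
    have h := jostF_pred hq1 hq n hz
    simp only [uP, vP]
    rw [h, zpow_sub_one₀ hz0]
    field_simp

/-- The reflection n → -n exchanges the roles of the two components, which is why `jostGm` enters
the first component and `jostFm` the second. -/
lemma isRedSol_minus (hq1 : ∀ n, q n ≠ 1) (hq : Summable fun n : ℤ => (1 + |(n : ℝ)|) * |q n|)
    {z : ℂ} (hz0 : z ≠ 0) (hz : ‖z‖ ≤ 1) : IsRedSol q (redMu z) (uM q z) (vM q z) where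
  snd_succ n := by
    have h1 := one_sub_ne_zero_of_ne hq1 n
    have h := jostFm_succ hq1 hq n hz
    simp only [uM, vM, redMu]
    rw [h, neg_add, zpow_add₀ hz0, zpow_neg_one]
    field_simp
    ring
  fst_pred n := by
    have h1 := one_sub_ne_zero_of_ne hq1 n
    have h2 := one_sub_ne_zero_of_ne hq1 (n - 1)
    have h := jostGm_eq hq1 hq n hz
    simp only [uM, vM]
    rw [h, neg_sub, sub_eq_add_neg, add_comm, zpow_add₀ hz0, zpow_one]
    field_simp
    ring

lemma tendsto_q (hq : Summable fun n : ℤ => (1 + |(n : ℝ)|) * |q n|) :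
    Tendsto q cofinite (𝓝 0) := by
  have : Summable fun n => |q n| := Summable.of_nonneg_of_le (fun n => abs_nonneg _)
    (fun n => by nlinarith [mul_nonneg (abs_nonneg (n : ℝ)) (abs_nonneg (q n))]) hq
  exact this.of_abs.tendsto_cofinite_zero

lemma tendsto_one_sub_q (hq : Summable fun n : ℤ => (1 + |(n : ℝ)|) * |q n|) :
    Tendsto (fun n => (1 - q n : ℂ)) cofinite (𝓝 1) := by
  have := ((Complex.continuous_ofReal.tendsto 0).comp (tendsto_q hq)).const_sub 1
  simpa using this

lemma atTop_le_cofinite_int : (atTop : Filter ℤ) ≤ cofinite := by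
  rw [Int.cofinite_eq]; exact le_sup_right

lemma atBot_le_cofinite_int : (atBot : Filter ℤ) ≤ cofinite := by
  rw [Int.cofinite_eq]; exact le_sup_left

lemma tendsto_jostF (hq : Summable fun n : ℤ => (1 + |(n : ℝ)|) * |q n|) {z : ℂ}
    (hz : ‖z‖ ≤ 1) : Tendsto (fun n => jostF q n z) atTop (𝓝 1) ∧
      Tendsto (fun n => jostG q n z) atTop (𝓝 1) := by
  constructor <;> refine Metric.tendsto_nhds.2 fun ε hε => ?_ <;>
    filter_upwards [eventually_norm_jostF_sub_one hq (half_pos hε)] with n hn <;>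
    rw [dist_eq_norm]
  · linarith [(hn z hz).1]
  · linarith [(hn z hz).2]

lemma tendsto_jostFm (hq : Summable fun n : ℤ => (1 + |(n : ℝ)|) * |q n|) {z : ℂ}
    (hz : ‖z‖ ≤ 1) : Tendsto (fun n => jostFm q n z) atBot (𝓝 1) ∧
      Tendsto (fun n => jostGm q n z) atBot (𝓝 1) :=
  ⟨(tendsto_jostF (summable_reflect hq) hz).1.comp tendsto_neg_atBot_atTop,
    (tendsto_jostF (summable_reflect hq) hz).2.comp tendsto_neg_atBot_atTop⟩

variable {m : ℝ}

lemma isJostPlus_sol (hm : 0 < m) (hq1 : ∀ n, q n ≠ 1)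
    (hq : Summable fun n : ℤ => (1 + |(n : ℝ)|) * |q n|) {z : ℂ} (hz0 : z ≠ 0) (hz : ‖z‖ ≤ 1) :
    IsJostPlus m q z fun n => (uP q z n, vP q z n / (m + lam m z)) := by
  have hne := add_lam_ne_zero hm z
  refine ⟨(diracOp_eq_iff hm q z _).2 ?_, ?_⟩
  · simpa only [mul_div_cancel₀ _ hne] using isRedSol_plus hq1 hq hz0 hz
  · obtain ⟨h1, h2⟩ := tendsto_jostF hq hz
    have h3 := (h2.const_mul (z⁻¹ - 1)).div
      ((tendsto_one_sub_q hq).mono_left atTop_le_cofinite_int) one_ne_zero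
    have h4 := h3.div_const (m + lam m z)
    simp only [mul_one, div_one] at h4
    refine (h1.prodMk_nhds h4).congr fun n => ?_
    have hzn : z ^ n ≠ 0 := zpow_ne_zero n hz0
    simp only [uP, vP, Prod.smul_mk, smul_eq_mul, zpow_neg]
    ext <;> simp <;> field_simp

lemma isJostMinus_sol (hm : 0 < m) (hq1 : ∀ n, q n ≠ 1)
    (hq : Summable fun n : ℤ => (1 + |(n : ℝ)|) * |q n|) {z : ℂ} (hz0 : z ≠ 0) (hz : ‖z‖ ≤ 1) :
    IsJostMinus m q z fun n => (uM q z n, vM q z n / (m + lam m z)) := by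
  have hne := add_lam_ne_zero hm z
  refine ⟨(diracOp_eq_iff hm q z _).2 ?_, ?_⟩
  · simpa only [mul_div_cancel₀ _ hne] using isRedSol_minus hq1 hq hz0 hz
  · obtain ⟨h1, h2⟩ := tendsto_jostFm hq hz
    have h3 := h2.div
      ((tendsto_one_sub_q hq).mono_left atBot_le_cofinite_int) one_ne_zero
    have h4 := (h1.const_mul (z - 1)).div_const (m + lam m z)
    simp only [mul_one, div_one] at h3 h4
    refine (h3.prodMk_nhds h4).congr fun n => ?_
    have hzn : z ^ n ≠ 0 := zpow_ne_zero n hz0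
    simp only [uM, vM, Prod.smul_mk, smul_eq_mul, zpow_neg]
    ext <;> simp <;> field_simp

lemma isJost_unique_aux {l : Filter ℤ} [l.NeBot] (hm : 0 < m) (hq1 : ∀ n, q n ≠ 1)
    (hl : Tendsto (fun n : ℤ => n + 1) l l) {z : ℂ}
    {ρ : ℤ → ℂ} (hρ : ∀ᶠ n in l, 1 ≤ ‖ρ n * ρ (n + 1)‖) {β : ℂ} {w w' : ℤ → ℂ × ℂ}
    (h : diracOp m q w = lam m z • w) (h' : diracOp m q w' = lam m z • w')
    (h1 : Tendsto (fun n => ρ n • w n) l (𝓝 (1, β)))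
    (h2 : Tendsto (fun n => ρ n • w' n) l (𝓝 (1, β))) : w' = w := by
  have hne := add_lam_ne_zero hm z
  rw [diracOp_eq_iff hm] at h h'
  have hd := h.lin_comb h' 1
  have h11 : Tendsto (fun n => ρ n * (w n).1) l (𝓝 1) := (continuous_fst.tendsto _).comp h1
  have h12 : Tendsto (fun n => ρ n * (w n).2) l (𝓝 β) := (continuous_snd.tendsto _).comp h1
  have h21 : Tendsto (fun n => ρ n * (w' n).1) l (𝓝 1) := (continuous_fst.tendsto _).comp h2
  have h22 : Tendsto (fun n => ρ n * (w' n).2) l (𝓝 β) := (continuous_snd.tendsto _).comp h2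
  have key := redSol_eq_zero_of_tendsto hq1 hl hρ (β := (m + lam m z) * β) h hd h11
    ((h12.const_mul (m + lam m z)).congr fun n => by ring)
    (by simpa using (h21.sub h11).congr fun n => by ring)
    (by
      have := (h22.sub h12).const_mul (m + lam m z)
      rw [sub_self, mul_zero] at this
      exact this.congr fun n => by ring)
  funext n
  refine Prod.ext ?_ ?_
  · have := (key n).1
    rw [one_mul] at this
    exact sub_eq_zero.1 this
  · have := (key n).2
    rw [one_mul] at this
    exact mul_left_cancel₀ hne (sub_eq_zero.1 this)

lemma isJostPlus_unique (hm : 0 < m) (hq1 : ∀ n, q n ≠ 1) {z : ℂ} (hz0 : z ≠ 0) (hz : ‖z‖ ≤ 1)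
    {w w' : ℤ → ℂ × ℂ} (h : IsJostPlus m q z w) (h' : IsJostPlus m q z w') : w' = w := by
  refine isJost_unique_aux hm hq1 (tendsto_atTop_add_const_right _ 1 tendsto_id)
    (ρ := fun n => z ^ (-n)) ?_ h.1 h'.1 h.2 h'.2
  -- The product of consecutive scalings has modulus |z| to the power -(2n + 1), at least 1 once n ≥
  -- 0.
  filter_upwards [eventually_ge_atTop 0] with n hn
  rw [← zpow_add₀ hz0, norm_zpow]
  obtain ⟨k, hk⟩ := Int.eq_ofNat_of_zero_le (show 0 ≤ n + (n + 1) by omega)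
  rw [← neg_add, hk, zpow_neg, zpow_natCast]
  exact one_le_inv₀ (pow_pos (norm_pos_iff.2 hz0) _) |>.2 (pow_le_one₀ (norm_nonneg _) hz)

lemma isJostMinus_unique (hm : 0 < m) (hq1 : ∀ n, q n ≠ 1) {z : ℂ} (hz0 : z ≠ 0)
    (hz : ‖z‖ ≤ 1) {w w' : ℤ → ℂ × ℂ} (h : IsJostMinus m q z w) (h' : IsJostMinus m q z w') :
    w' = w := by
  refine isJost_unique_aux hm hq1 (tendsto_atBot_add_const_right _ 1 tendsto_id)
    (ρ := fun n => z ^ n) ?_ h.1 h'.1 h.2 h'.2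
  filter_upwards [eventually_le_atBot (-1)] with n hn
  rw [← zpow_add₀ hz0, norm_zpow]
  obtain ⟨k, hk⟩ := Int.eq_ofNat_of_zero_le (show 0 ≤ -(n + (n + 1)) by omega)
  rw [← neg_neg (n + (n + 1)), hk, zpow_neg, zpow_natCast]
  exact one_le_inv₀ (pow_pos (norm_pos_iff.2 hz0) _) |>.2 (pow_le_one₀ (norm_nonneg _) hz)

lemma jostPlus_eq (hm : 0 < m) (hq1 : ∀ n, q n ≠ 1)
    (hq : Summable fun n : ℤ => (1 + |(n : ℝ)|) * |q n|) {z : ℂ} (hz0 : z ≠ 0) (hz : ‖z‖ ≤ 1) :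
    jostPlus m q z = fun n => (uP q z n, vP q z n / (m + lam m z)) := by
  have hs := isJostPlus_sol hm hq1 hq hz0 hz
  have hex : ∃ w, IsJostPlus m q z w := ⟨_, hs⟩
  rw [jostPlus, dif_pos hex]
  exact isJostPlus_unique hm hq1 hz0 hz hs hex.choose_spec

lemma jostMinus_eq (hm : 0 < m) (hq1 : ∀ n, q n ≠ 1)
    (hq : Summable fun n : ℤ => (1 + |(n : ℝ)|) * |q n|) {z : ℂ} (hz0 : z ≠ 0) (hz : ‖z‖ ≤ 1) :
    jostMinus m q z = fun n => (uM q z n, vM q z n / (m + lam m z)) := by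
  have hs := isJostMinus_sol hm hq1 hq hz0 hz
  have hex : ∃ w, IsJostMinus m q z w := ⟨_, hs⟩
  rw [jostMinus, dif_pos hex]
  exact isJostMinus_unique hm hq1 hz0 hz hs hex.choose_spec

end Solutions

lemma hasSum_of_eq {f g : ℕ → ℂ} {a b : ℂ} (h : HasSum f a) (hf : ∀ k, g k = f k)
    (hb : b = a) : HasSum g b := by
  rw [hb, show g = f from funext hf]
  exact h

/-! ### Fourier coefficients on the unit circle. -/

section Moments

open MeasureTheory intervalIntegral

variable {f g : ℂ → ℂ} {c : ℕ → ℂ} {φ : ℂ → ℂ}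

lemma circleMap_zero_one_ne_zero (θ : ℝ) : circleMap 0 1 θ ≠ 0 :=
  circleMap_ne_center one_ne_zero

lemma norm_circleMap_one (θ : ℝ) : ‖circleMap 0 1 θ‖ = 1 := by simp

lemma circleMoment_eq (f : ℂ → ℂ) (k : ℤ) :
    circleMoment f k = (2 * (Real.pi : ℂ))⁻¹ *
      ∫ θ in (0 : ℝ)..2 * Real.pi, f (circleMap 0 1 θ) * circleMap 0 1 θ ^ k := by
  unfold circleMoment
  rw [circleIntegral, mul_inv, mul_assoc, ← intervalIntegral.integral_const_mul]
  congr 1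
  refine intervalIntegral.integral_congr fun θ _ => ?_
  have := circleMap_zero_one_ne_zero θ
  simp only [deriv_circleMap, smul_eq_mul]
  field_simp [Complex.I_ne_zero]

/-- The countable exceptional set absorbs ±1, where the scattering relations may fail. -/
lemma circleMoment_congr {s : Set ℂ} (hs : s.Countable)
    (h : ∀ z, ‖z‖ = 1 → z ∉ s → f z = g z) (k : ℤ) :
    circleMoment f k = circleMoment g k := by
  rw [circleMoment_eq, circleMoment_eq]
  congr 1
  refine intervalIntegral.integral_congr_ae ?_
  have : (circleMap 0 1 ⁻¹' s).Countable := hs.preimage_circleMap 0 one_ne_zero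
  filter_upwards [this.ae_notMem volume] with θ hθ _
  rw [h _ (norm_circleMap_one θ) hθ]

lemma circleMoment_congr' (h : ∀ z, ‖z‖ = 1 → f z = g z) (k : ℤ) :
    circleMoment f k = circleMoment g k :=
  circleMoment_congr Set.countable_empty (fun z hz _ => h z hz) k

lemma CircleIntegrable.mul_zpow (hf : CircleIntegrable f 0 1) (k : ℤ) :
    IntervalIntegrable (fun θ => f (circleMap 0 1 θ) * circleMap 0 1 θ ^ k) volume 0
      (2 * Real.pi) :=
  IntervalIntegrable.mul_continuousOn hf <| Continuous.continuousOn <|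
    (continuous_circleMap 0 1).zpow₀ k fun θ => Or.inl (circleMap_zero_one_ne_zero θ)

lemma circleMoment_add (hf : CircleIntegrable f 0 1) (hg : CircleIntegrable g 0 1) (k : ℤ) :
    circleMoment (fun z => f z + g z) k = circleMoment f k + circleMoment g k := by
  simp only [circleMoment_eq, add_mul]
  rw [intervalIntegral.integral_add (CircleIntegrable.mul_zpow hf k)
    (CircleIntegrable.mul_zpow hg k), mul_add]

lemma circleMoment_sub (hf : CircleIntegrable f 0 1) (hg : CircleIntegrable g 0 1) (k : ℤ) :
    circleMoment (fun z => f z - g z) k = circleMoment f k - circleMoment g k := by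
  simp only [circleMoment_eq, sub_mul]
  rw [intervalIntegral.integral_sub (CircleIntegrable.mul_zpow hf k)
    (CircleIntegrable.mul_zpow hg k), mul_sub]

lemma circleMoment_const_mul (a : ℂ) (f : ℂ → ℂ) (k : ℤ) :
    circleMoment (fun z => a * f z) k = a * circleMoment f k := by
  simp only [circleMoment_eq, mul_assoc a]
  rw [intervalIntegral.integral_const_mul]
  ring

lemma circleMoment_zpow_mul (f : ℂ → ℂ) (l k : ℤ) :
    circleMoment (fun z => z ^ l * f z) k = circleMoment f (l + k) := by
  simp only [circleMoment_eq]
  congr 1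
  refine intervalIntegral.integral_congr fun θ _ => ?_
  rw [zpow_add₀ (circleMap_zero_one_ne_zero θ)]
  ring

lemma circleMoment_one (k : ℤ) : circleMoment (fun _ => 1) k = if k = 0 then 1 else 0 := by
  unfold circleMoment
  have h : ∮ z in C(0, 1), (1 : ℂ) * z ^ k / z = ∮ z in C(0, 1), (z - 0) ^ (k - 1) := by
    refine circleIntegral.integral_congr zero_le_one fun z hz => ?_
    have hz0 : z ≠ 0 := by
      rintro rfl
      simp at hz
    simp only [sub_zero, zpow_sub_one₀ hz0]
    ring
  rw [h]
  split_ifs with hk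
  · subst hk
    have := circleIntegral.integral_sub_center_inv (0 : ℂ) (R := 1) one_ne_zero
    simp only [zero_sub, zpow_neg_one, this]
    field_simp [Complex.I_ne_zero, Real.pi_ne_zero]
  · rw [circleIntegral.integral_sub_zpow_of_ne (by omega), mul_zero]

lemma circleMoment_comp_inv (f : ℂ → ℂ) (k : ℤ) :
    circleMoment (fun z => f z⁻¹) k = circleMoment f (-k) := by
  simp only [circleMoment_eq]
  congr 1
  set G : ℝ → ℂ := fun θ => f (circleMap 0 1 θ) * circleMap 0 1 θ ^ (-k) with hG
  have hper : Function.Periodic G (2 * Real.pi) := fun θ => by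
    simp only [hG, periodic_circleMap 0 1 θ]
  have h1 : ∀ θ : ℝ, f (circleMap 0 1 θ)⁻¹ * circleMap 0 1 θ ^ k = G (-θ) := fun θ => by
    have : circleMap 0 1 (-θ) = (circleMap 0 1 θ)⁻¹ := by
      simp [circleMap, Complex.exp_neg]
    simp only [hG, this, inv_zpow, zpow_neg, inv_inv]
  simp only [h1]
  rw [intervalIntegral.integral_comp_neg, neg_zero]
  have := hper.intervalIntegral_add_eq (-(2 * Real.pi)) 0
  simpa using this

lemma norm_circleMoment_le {B : ℝ} (hB : ∀ z, ‖z‖ = 1 → ‖f z‖ ≤ B) (k : ℤ) :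
    ‖circleMoment f k‖ ≤ B := by
  rw [circleMoment_eq, norm_mul]
  have h := intervalIntegral.norm_integral_le_of_norm_le_const (a := 0) (b := 2 * Real.pi)
    (C := B) (f := fun θ => f (circleMap 0 1 θ) * circleMap 0 1 θ ^ k) (fun θ _ => by
      rw [norm_mul, norm_zpow, norm_circleMap_one, one_zpow, mul_one]
      exact hB _ (norm_circleMap_one θ))
  have hpi := Real.two_pi_pos
  rw [sub_zero, abs_of_pos hpi] at h
  have h2 : ‖(2 * (Real.pi : ℂ))⁻¹‖ = (2 * Real.pi)⁻¹ := by
    rw [norm_inv, norm_mul, Complex.norm_real, Real.norm_of_nonneg Real.pi_pos.le]; simp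
  rw [h2, inv_mul_le_iff₀ hpi, mul_comm _ B]
  exact h

lemma IsWiener.circleIntegrable (h : IsWiener c φ) : CircleIntegrable φ 0 1 :=
  (h.continuousOn.mono Metric.sphere_subset_closedBall).circleIntegrable zero_le_one

/-- Moments of the product of a bounded function with an absolutely convergent series. -/
lemma IsWiener.hasSum_circleMoment (h : IsWiener c φ) {R : ℂ → ℂ} {B : ℝ}
    (hR : CircleIntegrable R 0 1) (hB : ∀ z, ‖z‖ = 1 → ‖R z‖ ≤ B) (N : ℤ) :
    HasSum (fun p : ℕ => circleMoment R (N + p) * c p) (circleMoment (fun z => R z * φ z) N) := by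
  have hs := intervalIntegral.hasSum_integral_of_dominated_convergence (μ := volume)
    (a := 0) (b := 2 * Real.pi)
    (F := fun (p : ℕ) θ => (R (circleMap 0 1 θ) * circleMap 0 1 θ ^ (N + p)) * c p)
    (f := fun θ => R (circleMap 0 1 θ) * φ (circleMap 0 1 θ) * circleMap 0 1 θ ^ N)
    (fun p _ => B * ‖c p‖) (fun p => ?_) (fun p => ?_) ?_ ?_ ?_
  · simp only [intervalIntegral.integral_mul_const] at hs
    simp only [circleMoment_eq]
    exact hasSum_of_eq (hs.mul_left _) (fun p => by ring) rfl
  · exact ((CircleIntegrable.mul_zpow hR _).mul_const _).def'.aestronglyMeasurable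
  · refine Filter.Eventually.of_forall fun θ _ => ?_
    rw [norm_mul, norm_mul, norm_zpow, norm_circleMap_one, one_zpow, mul_one]
    exact mul_le_mul_of_nonneg_right (hB _ (norm_circleMap_one θ)) (norm_nonneg _)
  · exact Filter.Eventually.of_forall fun θ _ => h.summable.mul_left B
  · exact intervalIntegrable_const
  · refine Filter.Eventually.of_forall fun θ _ => ?_
    have := ((h.hasSum _ (norm_circleMap_one θ).le).mul_left
      (R (circleMap 0 1 θ) * circleMap 0 1 θ ^ N))
    refine hasSum_of_eq this (fun p => ?_) (by ring)
    rw [zpow_add₀ (circleMap_zero_one_ne_zero θ), zpow_natCast]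
    ring

/-- Extension of a coefficient sequence by zero to negative indices. -/
def intCoeff (c : ℕ → ℂ) (k : ℤ) : ℂ := if 0 ≤ k then c k.toNat else 0

@[simp] lemma intCoeff_natCast (c : ℕ → ℂ) (k : ℕ) : intCoeff c k = c k := by simp [intCoeff]

lemma intCoeff_of_neg (c : ℕ → ℂ) {k : ℤ} (hk : k < 0) : intCoeff c k = 0 :=
  if_neg (by omega)

lemma IsWiener.circleMoment_eq (h : IsWiener c φ) (k : ℤ) :
    circleMoment φ (-k) = intCoeff c k := by
  have hs := h.hasSum_circleMoment (R := fun _ => 1) (B := 1)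
    (circleIntegrable_const _ _ _) (fun z _ => by simp) (-k)
  simp only [one_mul, circleMoment_one] at hs
  refine hs.unique ?_
  rcases lt_or_ge k 0 with hk | hk
  · rw [intCoeff_of_neg c hk]
    convert hasSum_zero using 2 with p
    rw [if_neg (by omega), zero_mul]
  · obtain ⟨k, rfl⟩ := Int.eq_ofNat_of_zero_le hk
    rw [intCoeff_natCast]
    have := hasSum_single (f := fun p : ℕ => (if -(k : ℤ) + p = 0 then (1 : ℂ) else 0) * c p) k
      fun p hp => by rw [if_neg (by omega), zero_mul]
    simpa using this

lemma IsWiener.circleMoment_comp_inv (h : IsWiener c φ) (k : ℤ) :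
    circleMoment (fun z => φ z⁻¹) k = intCoeff c k := by
  rw [DiscreteDirac.circleMoment_comp_inv, h.circleMoment_eq]

lemma IsWiener.sub_one (h : IsWiener c φ) :
    IsWiener (fun k => c k - if k = 0 then 1 else 0) (fun z => φ z - 1) where
  summable := by
    refine Summable.of_nonneg_of_le (fun _ => norm_nonneg _) (fun j => norm_sub_le _ _)
      (h.summable.add (summable_of_ne_finset_zero (s := {0}) fun j hj => ?_))
    simp only [Finset.mem_singleton] at hj
    simp [hj]
  hasSum z hz := by
    have h1 := hasSum_single (f := fun j : ℕ => (if j = 0 then (1 : ℂ) else 0) * z ^ j) 0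
      fun j hj => by simp [hj]
    simpa [sub_mul] using (h.hasSum z hz).sub h1

lemma intCoeff_sub_one (c : ℕ → ℂ) (k : ℤ) :
    intCoeff (fun k => c k - if k = 0 then 1 else 0) k = intCoeff c k - kron k 0 := by
  unfold intCoeff kron
  rcases lt_trichotomy k 0 with h | h | h
  · rw [if_neg (by omega), if_neg (by omega), if_neg (by omega), sub_zero]
  · subst h; simp
  · have h' : k.toNat ≠ 0 := by omega
    simp [h.le, h', h.ne']

/-- The second components of the Jost solutions carry a factor 1/z - 1 or z - 1, which turns
coefficients into differences of neighbours. -/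
lemma IsWiener.circleMoment_zpow_sub_one_mul (h : IsWiener c φ) (l k : ℤ) :
    circleMoment (fun z => (z ^ l - 1) * φ z) (-k) = intCoeff c (k - l) - intCoeff c k := by
  have h1 : CircleIntegrable (fun z => z ^ l * φ z) 0 1 := by
    refine ContinuousOn.circleIntegrable zero_le_one (ContinuousOn.mul ?_
      (h.continuousOn.mono Metric.sphere_subset_closedBall))
    refine ContinuousOn.zpow₀ continuousOn_id l fun z hz => Or.inl ?_
    rintro rfl
    simp at hz
  simp only [sub_mul, one_mul]
  rw [circleMoment_sub h1 h.circleIntegrable, circleMoment_zpow_mul,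
    show l + -k = -(k - l) by ring, h.circleMoment_eq, h.circleMoment_eq]

end Moments

/-! ### The Jost coefficients in terms of the power series. -/

section Coefficients

variable {m : ℝ} {q : ℤ → ℝ}

/-- Coefficients of `jostF` for the reflected potential. -/
noncomputable def jostFmCoeff (q : ℤ → ℝ) (n : ℤ) : ℕ → ℂ := jostFCoeff (fun k => q (-k)) (-n)

/-- Coefficients of `jostG` for the reflected potential. -/
noncomputable def jostGmCoeff (q : ℤ → ℝ) (n : ℤ) : ℕ → ℂ := jostGCoeff (fun k => q (-k)) (-n)

lemma isWiener_jostFm (hq : Summable fun n : ℤ => (1 + |(n : ℝ)|) * |q n|) (n : ℤ) :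
    IsWiener (jostFmCoeff q n) (jostFm q n) := isWiener_jostF (summable_reflect hq) (-n)

lemma isWiener_jostGm (hq : Summable fun n : ℤ => (1 + |(n : ℝ)|) * |q n|) (n : ℤ) :
    IsWiener (jostGmCoeff q n) (jostGm q n) := isWiener_jostG (summable_reflect hq) (-n)

lemma hPlus_eq (hm : 0 < m) (hq1 : ∀ n, q n ≠ 1)
    (hq : Summable fun n : ℤ => (1 + |(n : ℝ)|) * |q n|) (n : ℤ) {z : ℂ} (hz0 : z ≠ 0)
    (hz : ‖z‖ ≤ 1) :
    hPlus m q n z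
      = (jostF q n z, (z⁻¹ - 1) * jostG q n z / (1 - q n) / (m + lam m z)) := by
  have hzn : z ^ n ≠ 0 := zpow_ne_zero n hz0
  rw [hPlus, jostPlus_eq hm hq1 hq hz0 hz]
  simp only [uP, vP, Prod.smul_mk, smul_eq_mul, zpow_neg]
  ext
  · simp only; field_simp
  · simp only; field_simp

lemma hMinus_eq (hm : 0 < m) (hq1 : ∀ n, q n ≠ 1)
    (hq : Summable fun n : ℤ => (1 + |(n : ℝ)|) * |q n|) (n : ℤ) {z : ℂ} (hz0 : z ≠ 0)
    (hz : ‖z‖ ≤ 1) :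
    hMinus m q n z = (jostGm q n z / (1 - q n), (z - 1) * jostFm q n z / (m + lam m z)) := by
  have hzn : z ^ n ≠ 0 := zpow_ne_zero n hz0
  rw [hMinus, jostMinus_eq hm hq1 hq hz0 hz]
  simp only [uM, vM, Prod.smul_mk, smul_eq_mul, zpow_neg]
  ext
  · simp only; field_simp
  · simp only; field_simp

lemma ne_zero_of_norm_eq_one {z : ℂ} (hz : ‖z‖ = 1) : z ≠ 0 := by
  rintro rfl
  simp at hz

lemma aPlus_eq (hm : 0 < m) (hq1 : ∀ n, q n ≠ 1)
    (hq : Summable fun n : ℤ => (1 + |(n : ℝ)|) * |q n|) (n k : ℤ) :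
    aPlus m q n k = intCoeff (jostFCoeff q n) k - kron k 0 := by
  rw [← intCoeff_sub_one, ← (isWiener_jostF hq n).sub_one.circleMoment_eq, aPlus]
  refine circleMoment_congr' (fun z hz => ?_) _
  rw [hPlus_eq hm hq1 hq n (ne_zero_of_norm_eq_one hz) hz.le]

lemma aMinus_eq (hm : 0 < m) (hq1 : ∀ n, q n ≠ 1)
    (hq : Summable fun n : ℤ => (1 + |(n : ℝ)|) * |q n|) (n k : ℤ) :
    aMinus m q n (-k) = intCoeff (jostGmCoeff q n) k - kron k 0 := by
  rw [← intCoeff_sub_one, ← (isWiener_jostGm hq n).sub_one.circleMoment_eq, aMinus]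
  refine circleMoment_congr' (fun z hz => ?_) _
  have := one_sub_ne_zero_of_ne hq1 n
  rw [hMinus_eq hm hq1 hq n (ne_zero_of_norm_eq_one hz) hz.le, mul_div_cancel₀ _ this]

/-- The factors 1 - q_n and m + λ cancel, leaving (1/z - 1)(g - 1) on the circle. -/
lemma bPlus_eq (hm : 0 < m) (hq1 : ∀ n, q n ≠ 1)
    (hq : Summable fun n : ℤ => (1 + |(n : ℝ)|) * |q n|) (n k : ℤ) :
    bPlus m q n k = (intCoeff (jostGCoeff q n) (k + 1) - kron (k + 1) 0)
      - (intCoeff (jostGCoeff q n) k - kron k 0) := by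
  rw [← intCoeff_sub_one, ← intCoeff_sub_one, show k + 1 = k - (-1) by ring,
    ← (isWiener_jostG hq n).sub_one.circleMoment_zpow_sub_one_mul, bPlus]
  refine circleMoment_congr' (fun z hz => ?_) _
  have h1 := one_sub_ne_zero_of_ne hq1 n
  have h2 := add_lam_ne_zero hm z
  rw [hPlus_eq hm hq1 hq n (ne_zero_of_norm_eq_one hz) hz.le, zpow_neg_one]
  field_simp

lemma bMinus_eq (hm : 0 < m) (hq1 : ∀ n, q n ≠ 1)
    (hq : Summable fun n : ℤ => (1 + |(n : ℝ)|) * |q n|) (n k : ℤ) :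
    bMinus m q n (-k) = (intCoeff (jostFmCoeff q n) (k - 1) - kron (k - 1) 0)
      - (intCoeff (jostFmCoeff q n) k - kron k 0) := by
  rw [← intCoeff_sub_one, ← intCoeff_sub_one,
    ← (isWiener_jostFm hq n).sub_one.circleMoment_zpow_sub_one_mul, bMinus]
  refine circleMoment_congr' (fun z hz => ?_) _
  have h2 := add_lam_ne_zero hm z
  rw [hMinus_eq hm hq1 hq n (ne_zero_of_norm_eq_one hz) hz.le, zpow_one]
  field_simp

lemma hasSum_shift {f : ℤ → ℂ} {S : ℂ} (h0 : f (-1) = 0) (h : HasSum (fun k : ℕ => f k) S) :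
    HasSum (fun k : ℕ => f ((k : ℤ) - 1)) S := by
  rw [← hasSum_nat_add_iff' 1]
  simpa [h0] using h

lemma IsWiener.hasSum_intCoeff {c : ℕ → ℂ} {φ : ℂ → ℂ} (h : IsWiener c φ) {z : ℂ}
    (hz : ‖z‖ ≤ 1) :
    HasSum (fun k : ℕ => (intCoeff c k - kron k 0) * z ^ (k : ℤ)) (φ z - 1) := by
  refine hasSum_of_eq (h.sub_one.hasSum z hz) (fun k => ?_) rfl
  rw [← intCoeff_sub_one, intCoeff_natCast, zpow_natCast]

lemma intCoeff_sub_kron_of_neg (c : ℕ → ℂ) {k : ℤ} (hk : k < 0) :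
    intCoeff c k - kron k 0 = 0 := by
  rw [intCoeff_of_neg c hk, kron, if_neg hk.ne, sub_zero]

/-- The coefficients are defined by integrals over |z| = 1 but are those of power series converging
on the closed disc, so the expansions persist for smaller |z|. All four sums start one index early
where necessary, the extra terms being zero. -/
lemma jost_expansions (hm : 0 < m) (hq1 : ∀ n, q n ≠ 1)
    (hq : Summable fun n : ℤ => (1 + |(n : ℝ)|) * |q n|) (n : ℤ) (z : ℂ) (hz0 : 0 < ‖z‖)
    (hz : ‖z‖ ≤ 1) :
    HasSum (fun k : ℕ => aPlus m q n ((k : ℤ) - 1) * z ^ ((k : ℤ) - 1))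
      ((hPlus m q n z).1 - 1) ∧
    HasSum (fun k : ℕ => bPlus m q n ((k : ℤ) - 1) / (lam m z + m) * z ^ ((k : ℤ) - 1))
      ((1 - (q n : ℂ)) * (hPlus m q n z).2 - (z⁻¹ - 1) / (m + lam m z)) ∧
    HasSum (fun k : ℕ => aMinus m q n (1 - (k : ℤ)) * z ^ (-(1 - (k : ℤ))))
      ((1 - (q n : ℂ)) * (hMinus m q n z).1 - 1) ∧
    HasSum (fun k : ℕ => bMinus m q n (1 - (k : ℤ)) / (lam m z + m) * z ^ (-(1 - (k : ℤ))))
      ((hMinus m q n z).2 - (z - 1) / (m + lam m z)) := by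
  have hz0' : z ≠ 0 := norm_pos_iff.1 hz0
  have h1 := one_sub_ne_zero_of_ne hq1 n
  have h2 := add_lam_ne_zero hm z
  have h2' : lam m z + (m : ℂ) ≠ 0 := by rwa [add_comm]
  have hsh : ∀ {c : ℕ → ℂ} {φ : ℂ → ℂ}, IsWiener c φ →
      HasSum (fun k : ℕ => (intCoeff c ((k : ℤ) - 1) - kron ((k : ℤ) - 1) 0) * z ^ ((k : ℤ) - 1))
        (φ z - 1) := fun h => hasSum_shift
      (f := fun k => (intCoeff _ k - kron k 0) * z ^ k)
      (by rw [intCoeff_sub_kron_of_neg _ (by norm_num), zero_mul]) (h.hasSum_intCoeff hz)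
  rw [hPlus_eq hm hq1 hq n hz0' hz, hMinus_eq hm hq1 hq n hz0' hz]
  refine ⟨?_, ?_, ?_, ?_⟩
  · simpa only [aPlus_eq hm hq1 hq] using hsh (isWiener_jostF hq n)
  · have h3 := (((isWiener_jostG hq n).hasSum_intCoeff hz).mul_left z⁻¹).sub
      (hsh (isWiener_jostG hq n))
    refine hasSum_of_eq (h3.div_const (lam m z + m)) (fun k => ?_) ?_
    · rw [bPlus_eq hm hq1 hq, sub_add_cancel, zpow_sub_one₀ hz0']
      ring
    · field_simp
      ring
  · refine hasSum_of_eq (hsh (isWiener_jostGm hq n)) (fun k => ?_) ?_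
    · rw [show 1 - (k : ℤ) = -((k : ℤ) - 1) by ring, aMinus_eq hm hq1 hq, neg_neg]
    · simp only; field_simp
  · have h3 : HasSum (fun k : ℕ => (intCoeff (jostFmCoeff q n) ((k : ℤ) - 1 - 1)
        - kron ((k : ℤ) - 1 - 1) 0) * z ^ ((k : ℤ) - 1)) (z * (jostFm q n z - 1)) := by
      refine hasSum_shift (f := fun k => (intCoeff (jostFmCoeff q n) (k - 1)
        - kron (k - 1) 0) * z ^ k) ?_ ?_
      · rw [intCoeff_sub_kron_of_neg _ (by norm_num), zero_mul]
      · refine hasSum_of_eq ((hsh (isWiener_jostFm hq n)).mul_left z) (fun k => ?_) rfl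
        rw [zpow_sub_one₀ hz0']
        field_simp
    refine hasSum_of_eq ((h3.sub (hsh (isWiener_jostFm hq n))).div_const (lam m z + m))
      (fun k => ?_) ?_
    · rw [show 1 - (k : ℤ) = -((k : ℤ) - 1) by ring, bMinus_eq hm hq1 hq, neg_neg]
      ring
    · simp only
      field_simp
      ring

end Coefficients

/-! ### The Wronskian and the transmission coefficient in the disc. -/

section Wronskian

variable {m : ℝ} {q : ℤ → ℝ}

/-- The reduced Wronskian of the two Jost solutions. -/
noncomputable def jostWt (q : ℤ → ℝ) (z : ℂ) : ℂ :=
  redW (uP q z) (vP q z) (uM q z) (vM q z) 0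

/-- The analytic factor of the reduced Wronskian. -/
noncomputable def jostV (q : ℤ → ℝ) (z : ℂ) : ℂ :=
  jostF q 0 z * jostFm q 1 z + z * (jostGm q 0 z / (1 - q 0)) * (jostG q 1 z / (1 - q 1))

/-- The transmission coefficient as a meromorphic function on the unit disc. -/
noncomputable def jostT (q : ℤ → ℝ) (z : ℂ) : ℂ := (1 + z) / jostV q z

/-- The factor 1 - 1/z also divides z - 1/z, so T = (1 + z)/V with V analytic in the whole disc,
including z = 0. -/
lemma jostWt_eq (q : ℤ → ℝ) {z : ℂ} (hz0 : z ≠ 0) : jostWt q z = (1 - z⁻¹) * jostV q z := by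
  simp only [jostWt, redW, uP, vP, uM, vM, jostV, zero_add, neg_zero, zpow_zero, zpow_one,
    zpow_neg_one]
  field_simp
  ring

lemma wronskian_div (u v u' v' : ℤ → ℂ) (c : ℂ) :
    wronskian (fun n => (u n, v n / c)) (fun n => (u' n, v' n / c)) = redW u v u' v' 0 / c := by
  simp only [wronskian, redW, zero_add]
  ring

lemma jostW_eq (hm : 0 < m) (hq1 : ∀ n, q n ≠ 1)
    (hq : Summable fun n : ℤ => (1 + |(n : ℝ)|) * |q n|) {z : ℂ} (hz0 : z ≠ 0) (hz : ‖z‖ ≤ 1) :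
    jostW m q z = jostWt q z / (m + lam m z) := by
  rw [jostW, jostPlus_eq hm hq1 hq hz0 hz, jostMinus_eq hm hq1 hq hz0 hz, wronskian_div, jostWt]

lemma transRaw_eq (hm : 0 < m) (hq1 : ∀ n, q n ≠ 1)
    (hq : Summable fun n : ℤ => (1 + |(n : ℝ)|) * |q n|) {z : ℂ} (hz0 : z ≠ 0) (hz : ‖z‖ ≤ 1) :
    transRaw m q z = (z - z⁻¹) / jostWt q z := by
  rw [transRaw, jostW_eq hm hq1 hq hz0 hz, mul_div_cancel₀ _ (add_lam_ne_zero hm z)]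

lemma jostT_eq (q : ℤ → ℝ) {z : ℂ} (hz0 : z ≠ 0) (hz1 : z ≠ 1) :
    jostT q z = (z - z⁻¹) / jostWt q z := by
  have h1 : (1 - z⁻¹) ≠ 0 := by
    intro h
    exact hz1 (inv_eq_one.1 (sub_eq_zero.1 h).symm)
  rw [jostWt_eq q hz0, jostT, show z - z⁻¹ = (1 - z⁻¹) * (1 + z) by field_simp; ring,
    mul_div_mul_left _ _ h1]

lemma jostV_continuousOn (hq : Summable fun n : ℤ => (1 + |(n : ℝ)|) * |q n|) :
    ContinuousOn (jostV q) (Metric.closedBall 0 1) :=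
  ((isWiener_jostF hq 0).continuousOn.mul (isWiener_jostFm hq 1).continuousOn).add
    ((continuousOn_id.mul ((isWiener_jostGm hq 0).continuousOn.div_const _)).mul
      ((isWiener_jostG hq 1).continuousOn.div_const _))

lemma jostV_differentiableOn (hq : Summable fun n : ℤ => (1 + |(n : ℝ)|) * |q n|) :
    DifferentiableOn ℂ (jostV q) (Metric.ball 0 1) :=
  ((isWiener_jostF hq 0).differentiableOn.mul (isWiener_jostFm hq 1).differentiableOn).add
    ((differentiableOn_id.mul ((isWiener_jostGm hq 0).differentiableOn.div_const _)).mul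
      ((isWiener_jostG hq 1).differentiableOn.div_const _))

/-- At z = 0 the recurrences collapse to f_{n-1} = f_n / (1 - q_n), and f_n tends to 1, so
nonvanishing propagates down from large n. -/
lemma jostF_zero_ne_zero (hq1 : ∀ n, q n ≠ 1)
    (hq : Summable fun n : ℤ => (1 + |(n : ℝ)|) * |q n|) (n : ℤ) : jostF q n 0 ≠ 0 := by
  have hrec : ∀ n, jostF q (n - 1) 0 = jostF q n 0 / (1 - q n) := fun n => by
    have h1 := jostF_pred hq1 hq n (z := 0) (by simp)
    have h2 := jostG_eq hq1 hq n (z := 0) (by simp)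
    simp only [zero_mul, zero_div, zero_add, sub_zero, one_mul] at h1 h2
    rw [h1, h2]
  obtain ⟨N, hN⟩ := eventually_atTop.1
    ((tendsto_jostF hq (z := 0) (by simp)).1.eventually_ne one_ne_zero)
  by_cases hn : N ≤ n
  · exact hN n hn
  · refine Int.leInductionDown (motive := fun n _ => jostF q n 0 ≠ 0) (hN N le_rfl) ?_ n
      (not_le.1 hn).le
    intro k _ hk
    rw [hrec]
    exact div_ne_zero hk (one_sub_ne_zero_of_ne hq1 k)

lemma jostV_zero_ne_zero (hq1 : ∀ n, q n ≠ 1)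
    (hq : Summable fun n : ℤ => (1 + |(n : ℝ)|) * |q n|) : jostV q 0 ≠ 0 := by
  simp only [jostV, zero_mul, add_zero]
  exact mul_ne_zero (jostF_zero_ne_zero hq1 hq 0)
    (jostF_zero_ne_zero (q := fun k => q (-k)) (fun n => hq1 _) (summable_reflect hq) _)

lemma jostT_analyticAt (hq1 : ∀ n, q n ≠ 1)
    (hq : Summable fun n : ℤ => (1 + |(n : ℝ)|) * |q n|) : AnalyticAt ℂ (jostT q) 0 := by
  have hV : AnalyticAt ℂ (jostV q) 0 :=
    (jostV_differentiableOn hq).analyticAt (Metric.ball_mem_nhds 0 one_pos)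
  exact (by fun_prop : AnalyticAt ℂ (fun z : ℂ => 1 + z) 0).div hV (jostV_zero_ne_zero hq1 hq)

lemma transm_eq (hm : 0 < m) (hq1 : ∀ n, q n ≠ 1)
    (hq : Summable fun n : ℤ => (1 + |(n : ℝ)|) * |q n|) {z : ℂ} (hz : ‖z‖ < 1) :
    transm m q z = jostT q z := by
  have hz1 : ∀ z : ℂ, ‖z‖ < 1 → z ≠ 1 := by rintro z hz rfl; simp at hz
  by_cases hz0 : z = 0
  · subst hz0
    rw [transm, Function.update_self]
    refine Tendsto.limUnder_eq ?_
    refine ((jostT_analyticAt hq1 hq).continuousAt.tendsto.mono_left nhdsWithin_le_nhds).congr' ?_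
    have hb : Metric.ball (0 : ℂ) 1 ∈ 𝓝[≠] (0 : ℂ) :=
      mem_nhdsWithin_of_mem_nhds (Metric.ball_mem_nhds 0 one_pos)
    filter_upwards [hb, self_mem_nhdsWithin] with w hw hw0
    rw [mem_ball_zero_iff] at hw
    rw [transRaw_eq hm hq1 hq hw0 hw.le, jostT_eq q hw0 (hz1 w hw)]
  · rw [transm, Function.update_of_ne hz0, transRaw_eq hm hq1 hq hz0 hz.le,
      jostT_eq q hz0 (hz1 z hz)]

lemma transm_eventuallyEq (hm : 0 < m) (hq1 : ∀ n, q n ≠ 1)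
    (hq : Summable fun n : ℤ => (1 + |(n : ℝ)|) * |q n|) : transm m q =ᶠ[𝓝 0] jostT q := by
  filter_upwards [Metric.ball_mem_nhds (0 : ℂ) one_pos] with z hz
  exact transm_eq hm hq1 hq (mem_ball_zero_iff.1 hz)

end Wronskian

/-! ### Scattering relations on the unit circle. -/

section UnitCircle

variable {m : ℝ} {q : ℤ → ℝ}

lemma redW_swap (u v u' v' : ℤ → ℂ) (n : ℤ) : redW u' v' u v n = -redW u v u' v' n := by
  simp only [redW]; ring

/-- Both solutions belong to the same μ, so the Wronskian is constant and equals its limit at +∞. -/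
lemma redW_plus_inv (hq1 : ∀ n, q n ≠ 1) (hq : Summable fun n : ℤ => (1 + |(n : ℝ)|) * |q n|)
    {z : ℂ} (hz : ‖z‖ = 1) (n : ℤ) :
    redW (uP q z) (vP q z) (uP q z⁻¹) (vP q z⁻¹) n = z - z⁻¹ := by
  have hz0 := ne_zero_of_norm_eq_one hz
  have hz' : ‖z⁻¹‖ ≤ 1 := by simp [hz]
  have h := isRedSol_plus hq1 hq hz0 hz.le
  have h' := isRedSol_plus hq1 hq (inv_ne_zero hz0) hz'
  rw [redMu_inv] at h'
  have hshift : Tendsto (fun n : ℤ => n + 1) atTop atTop :=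
    tendsto_atTop_add_const_right _ 1 tendsto_id
  obtain ⟨a1, a2⟩ := tendsto_jostF hq hz.le
  obtain ⟨b1, b2⟩ := tendsto_jostF hq hz'
  have hq' := (tendsto_one_sub_q hq).mono_left atTop_le_cofinite_int
  have c2 := (a2.div hq' one_ne_zero).comp hshift
  have d2 := (b2.div hq' one_ne_zero).comp hshift
  have hlim := ((a1.mul d2).const_mul (z⁻¹ * (z - 1))).sub
    ((b1.mul c2).const_mul (z * (z⁻¹ - 1)))
  have hconst : Tendsto (fun _ : ℤ => redW (uP q z) (vP q z) (uP q z⁻¹) (vP q z⁻¹) n) atTop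
      (𝓝 (redW (uP q z) (vP q z) (uP q z⁻¹) (vP q z⁻¹) n)) := tendsto_const_nhds
  refine (tendsto_nhds_unique (hconst.congr fun k => ?_) hlim).trans ?_
  · rw [redW_const h h' n k]
    simp only [redW, uP, vP, Function.comp_apply, Pi.div_apply, inv_inv, inv_zpow',
      neg_add, zpow_add₀ hz0, zpow_neg, zpow_one]
    have := zpow_ne_zero k hz0
    field_simp
  · field_simp
    ring

lemma redW_minus_inv (hq1 : ∀ n, q n ≠ 1) (hq : Summable fun n : ℤ => (1 + |(n : ℝ)|) * |q n|)
    {z : ℂ} (hz : ‖z‖ = 1) (n : ℤ) :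
    redW (uM q z) (vM q z) (uM q z⁻¹) (vM q z⁻¹) n = -(z - z⁻¹) := by
  have hz0 := ne_zero_of_norm_eq_one hz
  have hz' : ‖z⁻¹‖ ≤ 1 := by simp [hz]
  have h := isRedSol_minus hq1 hq hz0 hz.le
  have h' := isRedSol_minus hq1 hq (inv_ne_zero hz0) hz'
  rw [redMu_inv] at h'
  have hshift : Tendsto (fun n : ℤ => n + 1) atBot atBot :=
    tendsto_atBot_add_const_right _ 1 tendsto_id
  obtain ⟨a1, a2⟩ := tendsto_jostFm hq hz.le
  obtain ⟨b1, b2⟩ := tendsto_jostFm hq hz'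
  have hq' := (tendsto_one_sub_q hq).mono_left atBot_le_cofinite_int
  have c2 := a2.div hq' one_ne_zero
  have d2 := b2.div hq' one_ne_zero
  have hlim := ((c2.mul (b1.comp hshift)).const_mul (z * (z⁻¹ - 1))).sub
    ((d2.mul (a1.comp hshift)).const_mul (z⁻¹ * (z - 1)))
  have hconst : Tendsto (fun _ : ℤ => redW (uM q z) (vM q z) (uM q z⁻¹) (vM q z⁻¹) n) atBot
      (𝓝 (redW (uM q z) (vM q z) (uM q z⁻¹) (vM q z⁻¹) n)) := tendsto_const_nhds
  refine (tendsto_nhds_unique (hconst.congr fun k => ?_) hlim).trans ?_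
  · rw [redW_const h h' n k]
    simp only [redW, uM, vM, Function.comp_apply, Pi.div_apply, inv_zpow',
      neg_add, zpow_add₀ hz0, zpow_neg, zpow_one, inv_inv]
    have := zpow_ne_zero k hz0
    field_simp
  · field_simp
    ring

lemma uP_conj (q : ℤ → ℝ) (z : ℂ) (n : ℤ) :
    uP q (starRingEnd ℂ z) n = starRingEnd ℂ (uP q z n) := by
  simp [uP, jostF_conj]

lemma vP_conj (q : ℤ → ℝ) (z : ℂ) (n : ℤ) :
    vP q (starRingEnd ℂ z) n = starRingEnd ℂ (vP q z n) := by
  simp [vP, jostG_conj]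

lemma uM_conj (q : ℤ → ℝ) (z : ℂ) (n : ℤ) :
    uM q (starRingEnd ℂ z) n = starRingEnd ℂ (uM q z n) := by
  simp [uM, jostGm, jostG_conj]

lemma vM_conj (q : ℤ → ℝ) (z : ℂ) (n : ℤ) :
    vM q (starRingEnd ℂ z) n = starRingEnd ℂ (vM q z n) := by
  simp [vM, jostFm, jostF_conj]

/-- The Wronskian in the numerator of the reflection coefficients. -/
noncomputable def reflW (q : ℤ → ℝ) (z : ℂ) : ℂ :=
  redW (uP q z) (vP q z) (uM q z⁻¹) (vM q z⁻¹) 0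

/-- This is the Plücker relation among the Wronskians of w⁺(z), w⁺(1/z), w⁻(z), w⁻(1/z), with
inversion read as conjugation. It yields both |R| ≤ 1 and the absence of zeros of the Wronskian away
from ±1. -/
lemma norm_sq_jostWt (hq1 : ∀ n, q n ≠ 1) (hq : Summable fun n : ℤ => (1 + |(n : ℝ)|) * |q n|)
    {z : ℂ} (hz : ‖z‖ = 1) :
    ‖jostWt q z‖ ^ 2 = ‖reflW q z‖ ^ 2 + ‖z - z⁻¹‖ ^ 2 := by
  have hconj : z⁻¹ = starRingEnd ℂ z := Complex.inv_eq_conj hz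
  have h1 := redW_plus_inv hq1 hq hz 0
  have h2 := redW_minus_inv hq1 hq hz 0
  have hpl : jostWt q z * jostWt q z⁻¹
      - reflW q z * redW (uP q z⁻¹) (vP q z⁻¹) (uM q z) (vM q z) 0
      = redW (uP q z) (vP q z) (uP q z⁻¹) (vP q z⁻¹) 0
        * redW (uM q z) (vM q z) (uM q z⁻¹) (vM q z⁻¹) 0 := by
    simp only [jostWt, reflW, redW]; ring
  rw [h1, h2] at hpl
  have h3 : jostWt q z⁻¹ = starRingEnd ℂ (jostWt q z) := by
    rw [hconj]
    simp only [jostWt, redW, uP_conj, vP_conj, uM_conj, vM_conj, map_sub, map_mul]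
  have h4 : redW (uP q z⁻¹) (vP q z⁻¹) (uM q z) (vM q z) 0 = starRingEnd ℂ (reflW q z) := by
    simp only [reflW, hconj]
    simp only [redW, uP_conj, vP_conj, uM_conj, vM_conj, map_sub, map_mul, Complex.conj_conj]
  have h5 : -(z - z⁻¹) = starRingEnd ℂ (z - z⁻¹) := by
    rw [hconj, map_sub, Complex.conj_conj]; ring
  rw [h3, h4, h5] at hpl
  simp only [Complex.mul_conj, Complex.normSq_eq_norm_sq] at hpl
  have : ‖jostWt q z‖ ^ 2 - ‖reflW q z‖ ^ 2 = ‖z - z⁻¹‖ ^ 2 := by exact_mod_cast hpl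
  linarith

lemma reflW_inv_norm (q : ℤ → ℝ) {z : ℂ} (hz : ‖z‖ = 1) : ‖reflW q z⁻¹‖ = ‖reflW q z‖ := by
  have hconj : z⁻¹ = starRingEnd ℂ z := Complex.inv_eq_conj hz
  have : reflW q z⁻¹ = starRingEnd ℂ (reflW q z) := by
    rw [reflW, reflW, inv_inv, hconj]
    simp only [redW, uP_conj, vP_conj, uM_conj, vM_conj, map_sub, map_mul, Complex.conj_conj]
  rw [this, RCLike.norm_conj]

lemma reflPlus_eq (hm : 0 < m) (hq1 : ∀ n, q n ≠ 1)
    (hq : Summable fun n : ℤ => (1 + |(n : ℝ)|) * |q n|) {z : ℂ} (hz : ‖z‖ = 1) :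
    reflPlus m q z = -reflW q z⁻¹ / jostWt q z := by
  have hz0 := ne_zero_of_norm_eq_one hz
  have hz' : ‖z⁻¹‖ ≤ 1 := by simp [hz]
  rw [reflPlus, jostW_eq hm hq1 hq hz0 hz.le, jostMinus_eq hm hq1 hq hz0 hz.le,
    jostPlus_eq hm hq1 hq (inv_ne_zero hz0) hz', lam_inv, wronskian_div,
    div_div_div_cancel_right₀ (add_lam_ne_zero hm z), redW_swap, reflW, inv_inv]

lemma reflMinus_eq (hm : 0 < m) (hq1 : ∀ n, q n ≠ 1)
    (hq : Summable fun n : ℤ => (1 + |(n : ℝ)|) * |q n|) {z : ℂ} (hz : ‖z‖ = 1) :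
    reflMinus m q z = -reflW q z / jostWt q z := by
  have hz0 := ne_zero_of_norm_eq_one hz
  have hz' : ‖z⁻¹‖ ≤ 1 := by simp [hz]
  rw [reflMinus, jostW_eq hm hq1 hq hz0 hz.le, jostPlus_eq hm hq1 hq hz0 hz.le,
    jostMinus_eq hm hq1 hq (inv_ne_zero hz0) hz', lam_inv, wronskian_div,
    div_div_div_cancel_right₀ (add_lam_ne_zero hm z), reflW, neg_div]

lemma norm_reflW_le (hq1 : ∀ n, q n ≠ 1) (hq : Summable fun n : ℤ => (1 + |(n : ℝ)|) * |q n|)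
    {z : ℂ} (hz : ‖z‖ = 1) : ‖reflW q z‖ ≤ ‖jostWt q z‖ :=
  le_of_sq_le_sq (by rw [norm_sq_jostWt hq1 hq hz]; nlinarith [sq_nonneg ‖z - z⁻¹‖])
    (norm_nonneg _)

lemma norm_reflPlus_le (hm : 0 < m) (hq1 : ∀ n, q n ≠ 1)
    (hq : Summable fun n : ℤ => (1 + |(n : ℝ)|) * |q n|) (z : ℂ) (hz : ‖z‖ = 1) :
    ‖reflPlus m q z‖ ≤ 1 := by
  rw [reflPlus_eq hm hq1 hq hz, norm_div, norm_neg, reflW_inv_norm q hz]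
  exact div_le_one_of_le₀ (norm_reflW_le hq1 hq hz) (norm_nonneg _)

lemma norm_reflMinus_le (hm : 0 < m) (hq1 : ∀ n, q n ≠ 1)
    (hq : Summable fun n : ℤ => (1 + |(n : ℝ)|) * |q n|) (z : ℂ) (hz : ‖z‖ = 1) :
    ‖reflMinus m q z‖ ≤ 1 := by
  rw [reflMinus_eq hm hq1 hq hz, norm_div, norm_neg]
  exact div_le_one_of_le₀ (norm_reflW_le hq1 hq hz) (norm_nonneg _)

/-- The denominator may vanish at ±1, so integrability rests on measurability and boundedness
instead of continuity. -/
lemma circleIntegrable_div {f g h : ℂ → ℂ} (hf : ContinuousOn f (Metric.sphere 0 1))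
    (hg : ContinuousOn g (Metric.sphere 0 1)) (heq : ∀ z, ‖z‖ = 1 → h z = f z / g z) {B : ℝ}
    (hB : ∀ z, ‖z‖ = 1 → ‖h z‖ ≤ B) : CircleIntegrable h 0 1 := by
  have hmem : ∀ θ, circleMap 0 1 θ ∈ Metric.sphere (0 : ℂ) 1 := fun θ =>
    circleMap_mem_sphere 0 zero_le_one θ
  have hcf := hf.comp_continuous (continuous_circleMap 0 1) hmem
  have hcg := hg.comp_continuous (continuous_circleMap 0 1) hmem
  have hmeas : Measurable fun θ => h (circleMap 0 1 θ) := by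
    have : (fun θ => h (circleMap 0 1 θ))
        = fun θ => f (circleMap 0 1 θ) / g (circleMap 0 1 θ) :=
      funext fun θ => heq _ (norm_circleMap_one θ)
    rw [this]
    exact hcf.measurable.div hcg.measurable
  have hconst : IntervalIntegrable (fun _ => B) MeasureTheory.volume 0 (2 * Real.pi) :=
    intervalIntegrable_const
  refine hconst.mono_fun hmeas.aestronglyMeasurable (Filter.Eventually.of_forall fun θ => ?_)
  exact (hB _ (norm_circleMap_one θ)).trans (le_abs_self B)

lemma continuousOn_inv_sphere {φ : ℂ → ℂ} (h : ContinuousOn φ (Metric.sphere 0 1)) :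
    ContinuousOn (fun z => φ z⁻¹) (Metric.sphere 0 1) := by
  refine h.comp (continuousOn_id.inv₀ fun z hz => ?_) fun z hz => ?_
  · exact ne_zero_of_norm_eq_one (mem_sphere_zero_iff_norm.1 hz)
  · rw [mem_sphere_zero_iff_norm] at hz ⊢
    simp [hz]

lemma continuousOn_zpow_sphere (n : ℤ) :
    ContinuousOn (fun z : ℂ => z ^ n) (Metric.sphere 0 1) :=
  continuousOn_id.zpow₀ n fun _ hz =>
    Or.inl (ne_zero_of_norm_eq_one (mem_sphere_zero_iff_norm.1 hz))

lemma continuousOn_jost_sphere (hq : Summable fun n : ℤ => (1 + |(n : ℝ)|) * |q n|) (n : ℤ) :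
    ContinuousOn (fun z => uP q z n) (Metric.sphere 0 1) ∧
    ContinuousOn (fun z => vP q z n) (Metric.sphere 0 1) ∧
    ContinuousOn (fun z => uM q z n) (Metric.sphere 0 1) ∧
    ContinuousOn (fun z => vM q z n) (Metric.sphere 0 1) := by
  have hF := (isWiener_jostF hq n).continuousOn.mono Metric.sphere_subset_closedBall
  have hG := (isWiener_jostG hq n).continuousOn.mono Metric.sphere_subset_closedBall
  have hFm := (isWiener_jostFm hq n).continuousOn.mono Metric.sphere_subset_closedBall
  have hGm := (isWiener_jostGm hq n).continuousOn.mono Metric.sphere_subset_closedBall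
  refine ⟨(continuousOn_zpow_sphere n).mul hF, (continuousOn_zpow_sphere n).mul
    ((ContinuousOn.mul ?_ hG).div_const _), (continuousOn_zpow_sphere (-n)).mul (hGm.div_const _),
    (continuousOn_zpow_sphere (-n)).mul ((continuousOn_id.sub continuousOn_const).mul hFm)⟩
  have := (continuousOn_zpow_sphere (-1)).sub (continuousOn_const (c := (1 : ℂ)))
  simp only [zpow_neg_one] at this
  exact this

lemma continuousOn_jostWt_sphere (hq : Summable fun n : ℤ => (1 + |(n : ℝ)|) * |q n|) :
    ContinuousOn (jostWt q) (Metric.sphere 0 1) := by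
  obtain ⟨a1, -, a3, -⟩ := continuousOn_jost_sphere hq 0
  obtain ⟨-, b2, -, b4⟩ := continuousOn_jost_sphere hq 1
  exact (a1.mul b4).sub (a3.mul b2)

lemma continuousOn_reflW_sphere (hq : Summable fun n : ℤ => (1 + |(n : ℝ)|) * |q n|) :
    ContinuousOn (reflW q) (Metric.sphere 0 1) := by
  obtain ⟨a1, -, a3, -⟩ := continuousOn_jost_sphere hq 0
  obtain ⟨-, b2, -, b4⟩ := continuousOn_jost_sphere hq 1
  exact (a1.mul (continuousOn_inv_sphere b4)).sub ((continuousOn_inv_sphere a3).mul b2)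

lemma circleIntegrable_reflPlus (hm : 0 < m) (hq1 : ∀ n, q n ≠ 1)
    (hq : Summable fun n : ℤ => (1 + |(n : ℝ)|) * |q n|) :
    CircleIntegrable (reflPlus m q) 0 1 :=
  circleIntegrable_div (continuousOn_inv_sphere (continuousOn_reflW_sphere hq)).neg
    (continuousOn_jostWt_sphere hq) (fun _ hz => reflPlus_eq hm hq1 hq hz)
    (norm_reflPlus_le hm hq1 hq)

lemma circleIntegrable_reflMinus (hm : 0 < m) (hq1 : ∀ n, q n ≠ 1)
    (hq : Summable fun n : ℤ => (1 + |(n : ℝ)|) * |q n|) :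
    CircleIntegrable (reflMinus m q) 0 1 :=
  circleIntegrable_div (continuousOn_reflW_sphere hq).neg
    (continuousOn_jostWt_sphere hq) (fun _ hz => reflMinus_eq hm hq1 hq hz)
    (norm_reflMinus_le hm hq1 hq)

/-- Three solutions of a two-dimensional system are linearly dependent, with their mutual Wronskians
as coefficients. -/
lemma redSol_cramer {μ : ℂ} {u₁ v₁ u₂ v₂ u₃ v₃ : ℤ → ℂ} (h₁ : IsRedSol q μ u₁ v₁)
    (h₂ : IsRedSol q μ u₂ v₂) (h₃ : IsRedSol q μ u₃ v₃) (n : ℤ) :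
    u₁ n * redW u₂ v₂ u₃ v₃ 0 + u₂ n * redW u₃ v₃ u₁ v₁ 0 + u₃ n * redW u₁ v₁ u₂ v₂ 0 = 0 ∧
    v₁ n * redW u₂ v₂ u₃ v₃ 0 + v₂ n * redW u₃ v₃ u₁ v₁ 0 + v₃ n * redW u₁ v₁ u₂ v₂ 0 = 0 := by
  constructor
  · rw [redW_const h₂ h₃ 0 n, redW_const h₃ h₁ 0 n, redW_const h₁ h₂ 0 n]
    simp only [redW]; ring
  -- The Wronskian at n involves v at n + 1, so v_n calls for the Wronskians at n - 1.
  · rw [redW_const h₂ h₃ 0 (n - 1), redW_const h₃ h₁ 0 (n - 1), redW_const h₁ h₂ 0 (n - 1)]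
    simp only [redW, sub_add_cancel]; ring

lemma sub_inv_ne_zero {z : ℂ} (hz : ‖z‖ = 1) (h1 : z ≠ 1) (h2 : z ≠ -1) : z - z⁻¹ ≠ 0 := by
  have hz0 := ne_zero_of_norm_eq_one hz
  intro h
  have : (z - 1) * (z + 1) = 0 := by
    field_simp at h
    linear_combination h
  rcases mul_eq_zero.1 this with h | h
  · exact h1 (sub_eq_zero.1 h)
  · exact h2 (eq_neg_of_add_eq_zero_left h)

lemma jostWt_ne_zero_of_circle (hq1 : ∀ n, q n ≠ 1)
    (hq : Summable fun n : ℤ => (1 + |(n : ℝ)|) * |q n|) {z : ℂ} (hz : ‖z‖ = 1) (h1 : z ≠ 1)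
    (h2 : z ≠ -1) : jostWt q z ≠ 0 := by
  intro h
  have h3 := norm_sq_jostWt hq1 hq hz
  have h4 := norm_pos_iff.2 (sub_inv_ne_zero hz h1 h2)
  rw [h, norm_zero] at h3
  nlinarith [sq_nonneg ‖reflW q z‖]

/-- The scattering relations for `T w⁻`. -/
lemma scattering_plus (hm : 0 < m) (hq1 : ∀ n, q n ≠ 1)
    (hq : Summable fun n : ℤ => (1 + |(n : ℝ)|) * |q n|) {z : ℂ} (hz : ‖z‖ = 1) (h1 : z ≠ 1)
    (h2 : z ≠ -1) (n : ℤ) :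
    jostT q z * (jostGm q n z / (1 - q n))
      = jostF q n z⁻¹ + reflPlus m q z * (z ^ (2 * n) * jostF q n z) ∧
    jostT q z * ((1 - q n) * jostFm q n z)
      = jostG q n z⁻¹ - reflPlus m q z * (z ^ (2 * n - 1) * jostG q n z) := by
  have hz0 := ne_zero_of_norm_eq_one hz
  have hz' : ‖z⁻¹‖ ≤ 1 := by simp [hz]
  have hW := jostWt_ne_zero_of_circle hq1 hq hz h1 h2
  have hinv := isRedSol_plus hq1 hq (inv_ne_zero hz0) hz'
  rw [redMu_inv] at hinv
  have hc := redSol_cramer (isRedSol_minus hq1 hq hz0 hz.le) hinv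
    (isRedSol_plus hq1 hq hz0 hz.le) n
  rw [redW_swap (uP q z), redW_plus_inv hq1 hq hz, ← jostWt,
    redW_swap (uP q z⁻¹)] at hc
  have hrW : redW (uP q z⁻¹) (vP q z⁻¹) (uM q z) (vM q z) 0 = reflW q z⁻¹ := by
    rw [reflW, inv_inv]
  rw [hrW] at hc
  obtain ⟨e1, e2⟩ := hc
  have hzn := zpow_ne_zero n hz0
  have hqn := one_sub_ne_zero_of_ne hq1 n
  have hz1 : z - 1 ≠ 0 := sub_ne_zero.2 h1
  rw [jostT_eq q hz0 h1, reflPlus_eq hm hq1 hq hz]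
  have h2n : z ^ (2 * n) = z ^ n * z ^ n := by rw [two_mul, zpow_add₀ hz0]
  have h2n1 : z ^ (2 * n - 1) = z ^ n * z ^ n * z⁻¹ := by rw [zpow_sub_one₀ hz0, h2n]
  rw [h2n, h2n1]
  simp only [uM, uP, vM, vP, inv_zpow', zpow_neg, inv_inv] at e1 e2
  constructor
  · field_simp at e1 ⊢
    linear_combination -e1
  · generalize jostG q n z⁻¹ = G' at e2 ⊢
    generalize reflW q z⁻¹ = r at e2 ⊢
    field_simp at e2 ⊢
    refine mul_left_cancel₀ hz1 ?_
    linear_combination -e2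

/-- The scattering relations for `T w⁺`. -/
lemma scattering_minus (hm : 0 < m) (hq1 : ∀ n, q n ≠ 1)
    (hq : Summable fun n : ℤ => (1 + |(n : ℝ)|) * |q n|) {z : ℂ} (hz : ‖z‖ = 1) (h1 : z ≠ 1)
    (h2 : z ≠ -1) (n : ℤ) :
    jostT q z * ((1 - q n) * jostF q n z)
      = jostGm q n z⁻¹ + reflMinus m q z * (z ^ (-(2 * n)) * jostGm q n z) ∧
    jostT q z * (jostG q n z / (1 - q n))
      = jostFm q n z⁻¹ - reflMinus m q z * (z ^ (1 - 2 * n) * jostFm q n z) := by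
  have hz0 := ne_zero_of_norm_eq_one hz
  have hz' : ‖z⁻¹‖ ≤ 1 := by simp [hz]
  have hW := jostWt_ne_zero_of_circle hq1 hq hz h1 h2
  have hinv := isRedSol_minus hq1 hq (inv_ne_zero hz0) hz'
  rw [redMu_inv] at hinv
  have hc := redSol_cramer (isRedSol_plus hq1 hq hz0 hz.le) hinv
    (isRedSol_minus hq1 hq hz0 hz.le) n
  rw [redW_swap (uM q z), redW_minus_inv hq1 hq hz, redW_swap (uP q z), ← jostWt,
    ← reflW] at hc
  obtain ⟨e1, e2⟩ := hc
  have hzn := zpow_ne_zero n hz0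
  have hqn := one_sub_ne_zero_of_ne hq1 n
  have hz1 : z - 1 ≠ 0 := sub_ne_zero.2 h1
  rw [jostT_eq q hz0 h1, reflMinus_eq hm hq1 hq hz]
  have h2n : z ^ (-(2 * n)) = (z ^ n * z ^ n)⁻¹ := by rw [zpow_neg, two_mul, zpow_add₀ hz0]
  have h2n1 : z ^ (1 - 2 * n) = z * (z ^ n * z ^ n)⁻¹ := by
    rw [sub_eq_add_neg, zpow_one_add₀ hz0, h2n]
  rw [h2n, h2n1]
  simp only [uM, uP, vM, vP, inv_zpow', zpow_neg, inv_inv] at e1 e2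
  constructor
  · field_simp at e1 ⊢
    linear_combination e1
  · generalize jostFm q n z⁻¹ = G' at e2 ⊢
    field_simp at e2 ⊢
    refine mul_left_cancel₀ hz1 ?_
    linear_combination -e2

end UnitCircle

/-! ### The Green identity summed over half-lines. -/

section Telescoping

variable {q : ℤ → ℝ} {μ μ' : ℂ} {u v u' v' : ℤ → ℂ}

lemma tendsto_redW_zero {l : Filter ℤ} (hl : Tendsto (fun n : ℤ => n + 1) l l)
    (h1 : Tendsto u l (𝓝 0)) (h2 : Tendsto v l (𝓝 0)) (h3 : Tendsto u' l (𝓝 0))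
    (h4 : Tendsto v' l (𝓝 0)) : Tendsto (redW u v u' v') l (𝓝 0) := by
  have := (h1.mul (h4.comp hl)).sub (h3.mul (h2.comp hl))
  rw [mul_zero, sub_zero] at this
  exact this

lemma tendsto_succ_atTop : Tendsto (fun n : ℤ => n + 1) atTop atTop :=
  tendsto_atTop_add_const_right _ 1 tendsto_id

lemma tendsto_succ_atBot : Tendsto (fun n : ℤ => n + 1) atBot atBot :=
  tendsto_atBot_add_const_right _ 1 tendsto_id

lemma tendsto_neg_natCast_atBot : Tendsto (fun k : ℕ => -(k : ℤ)) atTop atBot :=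
  tendsto_neg_atTop_atBot.comp tendsto_natCast_atTop_atTop

lemma tsum_telescope_right {E f : ℤ → ℂ} (hE : ∀ n, E n - E (n - 1) = f n)
    (hs : Summable fun k : ℕ => f (k + 1)) (hlim : Tendsto E atTop (𝓝 0)) :
    ∑' k : ℕ, f (k + 1) = -E 0 := by
  refine tendsto_nhds_unique hs.hasSum.tendsto_sum_nat ?_
  have : ∀ N : ℕ, ∑ k ∈ Finset.range N, f ((k : ℤ) + 1) = E N - E 0 := fun N => by
    induction N with
    | zero => simp
    | succ N ih =>
      rw [Finset.sum_range_succ, ih, ← hE]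
      push_cast
      ring_nf
  simp only [this]
  simpa using (hlim.comp tendsto_natCast_atTop_atTop).sub_const (E 0)

lemma tsum_telescope_left {E f : ℤ → ℂ} (hE : ∀ n, E n - E (n - 1) = f n)
    (hs : Summable fun k : ℕ => f (-k)) (hlim : Tendsto E atBot (𝓝 0)) :
    ∑' k : ℕ, f (-k) = E 0 := by
  refine tendsto_nhds_unique hs.hasSum.tendsto_sum_nat ?_
  have : ∀ N : ℕ, ∑ k ∈ Finset.range N, f (-(k : ℤ)) = E 0 - E (-(N : ℤ)) := fun N => by
    induction N with
    | zero => simp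
    | succ N ih =>
      rw [Finset.sum_range_succ, ih, ← hE]
      push_cast
      ring_nf
  simp only [this]
  simpa using (hlim.comp tendsto_neg_natCast_atBot).const_sub (E 0)

lemma tsum_redW_right (h : IsRedSol q μ u v) (h' : IsRedSol q μ' u' v')
    (hs : Summable fun k : ℕ => u (k + 1) * u' (k + 1))
    (hlim : Tendsto (redW u v u' v') atTop (𝓝 0)) :
    (μ' - μ) * ∑' k : ℕ, u (k + 1) * u' (k + 1) = -redW u v u' v' 0 := by
  rw [← tsum_mul_left]
  exact tsum_telescope_right (f := fun n => (μ' - μ) * (u n * u' n)) (redW_sub h h')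
    (hs.mul_left _) hlim

lemma tsum_redW_left (h : IsRedSol q μ u v) (h' : IsRedSol q μ' u' v')
    (hs : Summable fun k : ℕ => u (-k) * u' (-k))
    (hlim : Tendsto (redW u v u' v') atBot (𝓝 0)) :
    (μ' - μ) * ∑' k : ℕ, u (-k) * u' (-k) = redW u v u' v' 0 := by
  rw [← tsum_mul_left]
  exact tsum_telescope_left (f := fun n => (μ' - μ) * (u n * u' n)) (redW_sub h h')
    (hs.mul_left _) hlim

end Telescoping

/-! ### Exponential decay inside the disc; eigenvalues as zeros of V. -/

section Decay

variable {m : ℝ} {q : ℤ → ℝ}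

lemma exists_bound_of_eventually {P : ℤ → ℂ → ℂ}
    (h1 : ∀ n, ∃ B : ℝ, ∀ z, ‖z‖ ≤ 1 → ‖P n z‖ ≤ B)
    (h2 : ∀ᶠ n : ℤ in atTop, ∀ z, ‖z‖ ≤ 1 → ‖P n z - 1‖ ≤ 1) :
    ∃ C : ℝ, 0 < C ∧ ∀ n : ℤ, 0 ≤ n → ∀ z, ‖z‖ ≤ 1 → ‖P n z‖ ≤ C := by
  choose B hB using h1
  obtain ⟨N, hN⟩ := eventually_atTop.1 h2
  have hB0 : ∀ n, 0 ≤ B n := fun n => (norm_nonneg _).trans (hB n 0 (by simp))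
  refine ⟨2 + ∑ n ∈ Finset.Ico 0 N, B n, by
    have := Finset.sum_nonneg fun n (_ : n ∈ Finset.Ico 0 N) => hB0 n
    linarith, fun n hn z hz => ?_⟩
  have hsum := Finset.sum_nonneg fun n (_ : n ∈ Finset.Ico 0 N) => hB0 n
  by_cases h : N ≤ n
  · have h3 := hN n h z hz
    have h4 : ‖P n z‖ ≤ ‖P n z - 1‖ + ‖(1 : ℂ)‖ := by
      simpa using norm_add_le (P n z - 1) 1
    rw [norm_one] at h4
    linarith
  · have h3 := Finset.single_le_sum (f := B) (fun n (_ : n ∈ Finset.Ico 0 N) => hB0 n)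
      (Finset.mem_Ico.2 ⟨hn, not_le.1 h⟩)
    linarith [hB n z hz]

lemma exists_bound_jost (hq : Summable fun n : ℤ => (1 + |(n : ℝ)|) * |q n|) :
    ∃ C : ℝ, 0 < C ∧ ∀ n : ℤ, 0 ≤ n → ∀ z, ‖z‖ ≤ 1 → ‖jostF q n z‖ ≤ C ∧ ‖jostG q n z‖ ≤ C := by
  have hev := eventually_norm_jostF_sub_one hq one_pos
  obtain ⟨C1, hC1, h1⟩ := exists_bound_of_eventually (P := jostF q)
    (fun n => ⟨_, fun z hz => (isWiener_jostF hq n).norm_le hz⟩)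
    (hev.mono fun n hn z hz => (hn z hz).1)
  obtain ⟨C2, hC2, h2⟩ := exists_bound_of_eventually (P := jostG q)
    (fun n => ⟨_, fun z hz => (isWiener_jostG hq n).norm_le hz⟩)
    (hev.mono fun n hn z hz => (hn z hz).2)
  exact ⟨max C1 C2, lt_max_of_lt_left hC1, fun n hn z hz =>
    ⟨(h1 n hn z hz).trans (le_max_left _ _), (h2 n hn z hz).trans (le_max_right _ _)⟩⟩

lemma exists_bound_inv_one_sub
    (hq : Summable fun n : ℤ => (1 + |(n : ℝ)|) * |q n|) :
    ∃ C : ℝ, 0 < C ∧ ∀ n, ‖(1 - q n : ℂ)⁻¹‖ ≤ C := by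
  have h := ((tendsto_one_sub_q hq).inv₀ one_ne_zero).norm
  have hev : ∀ᶠ n in cofinite, ‖(1 - q n : ℂ)⁻¹‖ < 2 :=
    h.eventually (gt_mem_nhds (by norm_num))
  have hfin : {n | ¬ ‖(1 - q n : ℂ)⁻¹‖ < 2}.Finite := hev
  obtain ⟨C, hC⟩ := (hfin.image fun n => ‖(1 - q n : ℂ)⁻¹‖).bddAbove
  refine ⟨max C 2, lt_max_of_lt_right two_pos, fun n => ?_⟩
  by_cases hn : ‖(1 - q n : ℂ)⁻¹‖ < 2
  · exact hn.le.trans (le_max_right _ _)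
  · exact (hC ⟨n, hn, rfl⟩).trans (le_max_left _ _)

/-- Exponential bounds for the Jost solutions, uniform in the punctured disc. -/
lemma exists_bound_sol
    (hq : Summable fun n : ℤ => (1 + |(n : ℝ)|) * |q n|) :
    ∃ C : ℝ, 0 < C ∧ ∀ z : ℂ, ‖z‖ ≤ 1 → ∀ k : ℕ,
      ‖uP q z k‖ ≤ C * ‖z‖ ^ k ∧ ‖uM q z (-k)‖ ≤ C * ‖z‖ ^ k ∧
      ‖vP q z k‖ ≤ (‖z‖⁻¹ + 1) * C * ‖z‖ ^ k ∧ ‖vM q z (-k)‖ ≤ (‖z‖ + 1) * C * ‖z‖ ^ k := by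
  obtain ⟨C1, hC1, h1⟩ := exists_bound_jost hq
  obtain ⟨C2, hC2, h2⟩ := exists_bound_jost (summable_reflect hq)
  obtain ⟨D, hD, hD'⟩ := exists_bound_inv_one_sub hq
  have hC : 0 < (C1 + C2) * (1 + D) := by positivity
  refine ⟨(C1 + C2) * (1 + D), hC, fun z hz k => ?_⟩
  have hzk : 0 ≤ ‖z‖ ^ k := by positivity
  obtain ⟨hF, hG⟩ := h1 k (Int.natCast_nonneg k) z hz
  obtain ⟨hFm, hGm⟩ := h2 k (Int.natCast_nonneg k) z hz
  have hFm' : ‖jostFm q (-k) z‖ ≤ C2 := by rw [jostFm, neg_neg]; exact hFm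
  have hGm' : ‖jostGm q (-k) z‖ ≤ C2 := by rw [jostGm, neg_neg]; exact hGm
  have e1 : C1 ≤ (C1 + C2) * (1 + D) := by nlinarith [mul_pos hC1 hD, mul_pos hC2 hD]
  have e2 : C2 ≤ (C1 + C2) * (1 + D) := by nlinarith [mul_pos hC1 hD, mul_pos hC2 hD]
  have e3 : C1 * D ≤ (C1 + C2) * (1 + D) := by nlinarith [mul_pos hC1 hD, mul_pos hC2 hD]
  have e4 : C2 * D ≤ (C1 + C2) * (1 + D) := by nlinarith [mul_pos hC1 hD, mul_pos hC2 hD]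
  have hGD : ‖jostG q k z / (1 - q k)‖ ≤ C1 * D := by
    rw [div_eq_mul_inv, norm_mul]
    exact mul_le_mul hG (hD' _) (norm_nonneg _) hC1.le
  have hGmD : ‖jostGm q (-k) z / (1 - q (-k))‖ ≤ C2 * D := by
    rw [div_eq_mul_inv, norm_mul]
    exact mul_le_mul hGm' (hD' _) (norm_nonneg _) hC2.le
  refine ⟨?_, ?_, ?_, ?_⟩
  · rw [uP, norm_mul, zpow_natCast, norm_pow, mul_comm]
    exact mul_le_mul_of_nonneg_right (hF.trans e1) hzk
  · rw [uM, norm_mul, neg_neg, zpow_natCast, norm_pow, mul_comm]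
    exact mul_le_mul_of_nonneg_right (hGmD.trans e4) hzk
  · rw [vP, norm_mul, zpow_natCast, norm_pow, mul_comm, mul_div_assoc, norm_mul]
    refine mul_le_mul_of_nonneg_right ?_ hzk
    refine mul_le_mul ?_ (hGD.trans e3) (norm_nonneg _) (by positivity)
    calc ‖z⁻¹ - 1‖ ≤ ‖z⁻¹‖ + ‖(1 : ℂ)‖ := norm_sub_le _ _
      _ = _ := by rw [norm_inv, norm_one]
  · rw [vM, norm_mul, neg_neg, zpow_natCast, norm_pow, mul_comm, norm_mul]
    refine mul_le_mul_of_nonneg_right ?_ hzk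
    refine mul_le_mul ?_ (hFm'.trans e2) (norm_nonneg _) (by positivity)
    calc ‖z - 1‖ ≤ ‖z‖ + ‖(1 : ℂ)‖ := norm_sub_le _ _
      _ = _ := by rw [norm_one]

lemma tendsto_zero_of_nat_bound {f : ℤ → ℂ} {C r : ℝ} (hr0 : 0 ≤ r) (hr : r < 1)
    (h : ∀ k : ℕ, ‖f k‖ ≤ C * r ^ k) : Tendsto f atTop (𝓝 0) := by
  rw [← Nat.map_cast_int_atTop, tendsto_map'_iff]
  refine squeeze_zero_norm h ?_
  simpa using (tendsto_pow_atTop_nhds_zero_of_lt_one hr0 hr).const_mul C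

lemma tendsto_zero_of_neg_nat_bound {f : ℤ → ℂ} {C r : ℝ} (hr0 : 0 ≤ r) (hr : r < 1)
    (h : ∀ k : ℕ, ‖f (-k)‖ ≤ C * r ^ k) : Tendsto f atBot (𝓝 0) := by
  have := (tendsto_zero_of_nat_bound (f := fun n => f (-n)) hr0 hr h).comp
    tendsto_neg_atBot_atTop
  simpa [Function.comp_def] using this

lemma tendsto_plus_zero
    (hq : Summable fun n : ℤ => (1 + |(n : ℝ)|) * |q n|) {z : ℂ} (hz : ‖z‖ < 1) :
    Tendsto (uP q z) atTop (𝓝 0) ∧ Tendsto (vP q z) atTop (𝓝 0) := by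
  obtain ⟨C, -, h⟩ := exists_bound_sol hq
  exact ⟨tendsto_zero_of_nat_bound (norm_nonneg z) hz fun k => (h z hz.le k).1,
    tendsto_zero_of_nat_bound (norm_nonneg z) hz fun k => (h z hz.le k).2.2.1⟩

lemma tendsto_minus_zero
    (hq : Summable fun n : ℤ => (1 + |(n : ℝ)|) * |q n|) {z : ℂ} (hz : ‖z‖ < 1) :
    Tendsto (uM q z) atBot (𝓝 0) ∧ Tendsto (vM q z) atBot (𝓝 0) := by
  obtain ⟨C, -, h⟩ := exists_bound_sol hq
  exact ⟨tendsto_zero_of_neg_nat_bound (norm_nonneg z) hz fun k => (h z hz.le k).2.1,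
    tendsto_zero_of_neg_nat_bound (norm_nonneg z) hz fun k => (h z hz.le k).2.2.2⟩

lemma summable_mul_of_bound {f g : ℕ → ℂ} {C D r s : ℝ} (hr0 : 0 ≤ r) (hr : r < 1)
    (hs0 : 0 ≤ s) (hs : s < 1) (hf : ∀ k, ‖f k‖ ≤ C * r ^ k) (hg : ∀ k, ‖g k‖ ≤ D * s ^ k) :
    Summable fun k => f k * g k := by
  refine Summable.of_norm_bounded (g := fun k => C * D * (r * s) ^ k)
    ((summable_geometric_of_lt_one (mul_nonneg hr0 hs0)
      (mul_lt_one_of_nonneg_of_lt_one_left hr0 hr hs.le)).mul_left _) fun k => ?_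
  rw [norm_mul, mul_pow]
  calc ‖f k‖ * ‖g k‖ ≤ (C * r ^ k) * (D * s ^ k) :=
        mul_le_mul (hf k) (hg k) (norm_nonneg _) ((norm_nonneg _).trans (hf k))
    _ = _ := by ring

lemma summable_uP_mul
    (hq : Summable fun n : ℤ => (1 + |(n : ℝ)|) * |q n|) {z w : ℂ} (hz : ‖z‖ < 1)
    (hw : ‖w‖ < 1) : Summable fun k : ℕ => uP q z k * uP q w k := by
  obtain ⟨C, -, h⟩ := exists_bound_sol hq
  exact summable_mul_of_bound (norm_nonneg z) hz (norm_nonneg w) hw (fun k => (h z hz.le k).1)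
    fun k => (h w hw.le k).1

lemma summable_uM_mul
    (hq : Summable fun n : ℤ => (1 + |(n : ℝ)|) * |q n|) {z w : ℂ} (hz : ‖z‖ < 1)
    (hw : ‖w‖ < 1) : Summable fun k : ℕ => uM q z (-k) * uM q w (-k) := by
  obtain ⟨C, -, h⟩ := exists_bound_sol hq
  exact summable_mul_of_bound (norm_nonneg z) hz (norm_nonneg w) hw (fun k => (h z hz.le k).2.1)
    fun k => (h w hw.le k).2.1

lemma tsum_uP_mul (hq1 : ∀ n, q n ≠ 1)
    (hq : Summable fun n : ℤ => (1 + |(n : ℝ)|) * |q n|) {z w : ℂ} (hz0 : z ≠ 0) (hz : ‖z‖ < 1)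
    (hw0 : w ≠ 0) (hw : ‖w‖ < 1) :
    (redMu w - redMu z) * ∑' k : ℕ, uP q z (k + 1) * uP q w (k + 1)
      = -redW (uP q z) (vP q z) (uP q w) (vP q w) 0 := by
  refine tsum_redW_right (isRedSol_plus hq1 hq hz0 hz.le) (isRedSol_plus hq1 hq hw0 hw.le) ?_
    (tendsto_redW_zero tendsto_succ_atTop (tendsto_plus_zero hq hz).1
      (tendsto_plus_zero hq hz).2 (tendsto_plus_zero hq hw).1
      (tendsto_plus_zero hq hw).2)
  simpa using (summable_nat_add_iff 1).2 (summable_uP_mul hq hz hw)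

lemma tsum_uM_mul (hq1 : ∀ n, q n ≠ 1)
    (hq : Summable fun n : ℤ => (1 + |(n : ℝ)|) * |q n|) {z w : ℂ} (hz0 : z ≠ 0) (hz : ‖z‖ < 1)
    (hw0 : w ≠ 0) (hw : ‖w‖ < 1) :
    (redMu w - redMu z) * ∑' k : ℕ, uM q z (-k) * uM q w (-k)
      = redW (uM q z) (vM q z) (uM q w) (vM q w) 0 :=
  tsum_redW_left (isRedSol_minus hq1 hq hz0 hz.le) (isRedSol_minus hq1 hq hw0 hw.le)
    (summable_uM_mul hq hz hw)
    (tendsto_redW_zero tendsto_succ_atBot (tendsto_minus_zero hq hz).1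
      (tendsto_minus_zero hq hz).2 (tendsto_minus_zero hq hw).1
      (tendsto_minus_zero hq hw).2)

lemma exists_uP_ne_zero (hq : Summable fun n : ℤ => (1 + |(n : ℝ)|) * |q n|) {z : ℂ}
    (hz0 : z ≠ 0) (hz : ‖z‖ ≤ 1) : ∀ᶠ n : ℤ in atTop, uP q z n ≠ 0 := by
  filter_upwards [(tendsto_jostF hq hz).1.eventually_ne one_ne_zero] with n hn
  exact mul_ne_zero (zpow_ne_zero n hz0) hn

lemma exists_uM_ne_zero (hq1 : ∀ n, q n ≠ 1)
    (hq : Summable fun n : ℤ => (1 + |(n : ℝ)|) * |q n|) {z : ℂ}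
    (hz0 : z ≠ 0) (hz : ‖z‖ ≤ 1) : ∀ᶠ n : ℤ in atBot, uM q z n ≠ 0 := by
  filter_upwards [(tendsto_jostFm hq hz).2.eventually_ne one_ne_zero] with n hn
  exact mul_ne_zero (zpow_ne_zero _ hz0) (div_ne_zero hn (one_sub_ne_zero_of_ne hq1 n))

/-- At a zero of the Wronskian the Jost solutions are proportional. -/
lemma exists_prop_of_jostWt_eq_zero (hq1 : ∀ n, q n ≠ 1)
    (hq : Summable fun n : ℤ => (1 + |(n : ℝ)|) * |q n|) {z : ℂ} (hz0 : z ≠ 0) (hz : ‖z‖ ≤ 1)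
    (hW : jostWt q z = 0) :
    ∃ c : ℂ, c ≠ 0 ∧ ∀ n, uM q z n = c * uP q z n ∧ vM q z n = c * vP q z n := by
  have hP := isRedSol_plus hq1 hq hz0 hz
  have hM := isRedSol_minus hq1 hq hz0 hz
  obtain ⟨k, hk⟩ := (exists_uP_ne_zero hq hz0 hz).exists
  have h := hP.eq_mul hq1 hM hk (by rw [redW_const hP hM k 0]; exact hW)
  refine ⟨_, fun hc => ?_, h⟩
  obtain ⟨j, hj⟩ := (exists_uM_ne_zero hq1 hq hz0 hz).exists
  rw [hc] at h
  exact hj (by rw [(h j).1, zero_mul])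

lemma summable_sq_of_prop
    (hq : Summable fun n : ℤ => (1 + |(n : ℝ)|) * |q n|) {z : ℂ} (hz : ‖z‖ < 1) {c : ℂ}
    (hc : c ≠ 0) (h : ∀ n, uM q z n = c * uP q z n ∧ vM q z n = c * vP q z n) :
    (Summable fun n : ℤ => ‖uP q z n‖ ^ 2) ∧ Summable fun n : ℤ => ‖vP q z n‖ ^ 2 := by
  obtain ⟨C, -, hb⟩ := exists_bound_sol hq
  have hu : ∀ n, uP q z n = c⁻¹ * uM q z n := fun n => by rw [(h n).1, inv_mul_cancel_left₀ hc]
  have hv : ∀ n, vP q z n = c⁻¹ * vM q z n := fun n => by rw [(h n).2, inv_mul_cancel_left₀ hc]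
  have key : ∀ (f : ℕ → ℂ) (D : ℝ), (∀ k, ‖f k‖ ≤ D * ‖z‖ ^ k) → Summable fun k => ‖f k‖ ^ 2 := by
    intro f D hf
    have := (summable_mul_of_bound (norm_nonneg z) hz (norm_nonneg z) hz hf hf).norm
    simpa only [norm_mul, ← sq, norm_pow] using this
  refine ⟨summable_int_iff_summable_nat_and_neg.2 ⟨key (fun k => uP q z k) C fun k =>
    (hb z hz.le k).1, key (fun k => uP q z (-k)) (‖c⁻¹‖ * C) fun k => ?_⟩,
    summable_int_iff_summable_nat_and_neg.2 ⟨key (fun k => vP q z k) _ fun k =>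
    (hb z hz.le k).2.2.1, key (fun k => vP q z (-k)) (‖c⁻¹‖ * ((‖z‖ + 1) * C)) fun k => ?_⟩⟩
  · rw [hu, norm_mul, mul_assoc]
    exact mul_le_mul_of_nonneg_left (hb z hz.le k).2.1 (norm_nonneg _)
  · rw [hv, norm_mul, mul_assoc]
    exact mul_le_mul_of_nonneg_left (hb z hz.le k).2.2.2 (norm_nonneg _)

lemma tendsto_cofinite_of_summable_sq {f : ℤ → ℂ} (h : Summable fun n => ‖f n‖ ^ 2) :
    Tendsto f cofinite (𝓝 0) := by
  rw [tendsto_zero_iff_norm_tendsto_zero]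
  have := (Real.continuous_sqrt.tendsto 0).comp h.tendsto_cofinite_zero
  simpa [Function.comp_def, Real.sqrt_sq] using this

lemma one_sub_inv_ne_zero {z : ℂ} (hz : ‖z‖ < 1) : 1 - z⁻¹ ≠ 0 := by
  intro h
  have : z = 1 := inv_eq_one.1 (sub_eq_zero.1 h).symm
  rw [this, norm_one] at hz
  exact lt_irrefl _ hz

/-- The eigenvalues correspond to the zeros of `jostV`. -/
lemma eigenPoints_eq (hm : 0 < m) (hq1 : ∀ n, q n ≠ 1)
    (hq : Summable fun n : ℤ => (1 + |(n : ℝ)|) * |q n|) :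
    eigenPoints m q = {z | z ≠ 0 ∧ ‖z‖ < 1 ∧ jostV q z = 0} := by
  ext z
  simp only [eigenPoints, Set.mem_ofPred_eq, norm_pos_iff]
  refine and_congr_right fun hz0 => and_congr_right fun hz => ?_
  have hne := add_lam_ne_zero hm z
  have hP := isRedSol_plus hq1 hq hz0 hz.le
  have hM := isRedSol_minus hq1 hq hz0 hz.le
  constructor
  · rintro ⟨w, hw, hs1, hs2, hD⟩
    rw [diracOp_eq_iff hm] at hD
    have t1 := tendsto_cofinite_of_summable_sq hs1
    have t2 := (tendsto_cofinite_of_summable_sq hs2).const_mul (m + lam m z)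
    rw [mul_zero] at t2
    have hnz : ∃ n, (w n).1 ≠ 0 ∨ (m + lam m z) * (w n).2 ≠ 0 := by
      by_contra! hcon
      exact hw (funext fun n => Prod.ext (hcon n).1
        ((mul_eq_zero_iff_left hne).1 (hcon n).2))
    -- An eigenvector tends to 0 at both ends, so its constant Wronskian with a Jost solution
    -- decaying at either end is 0 and the two are proportional.
    have key : ∀ (u v : ℤ → ℂ) (l : Filter ℤ), l.NeBot → l ≤ cofinite →
        Tendsto (fun n : ℤ => n + 1) l l →
        IsRedSol q (redMu z) u v → Tendsto u l (𝓝 0) → Tendsto v l (𝓝 0) → (∃ k, u k ≠ 0) →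
        ∃ c : ℂ, c ≠ 0 ∧ ∀ n, (w n).1 = c * u n ∧ (m + lam m z) * (w n).2 = c * v n := by
      intro u v l _ hl hl' hsol h1 h2 ⟨k, hk⟩
      have hlim := tendsto_redW_zero hl' h1 h2 (t1.mono_left hl) (t2.mono_left hl)
      have h0 : redW u v (fun n => (w n).1) (fun n => (m + lam m z) * (w n).2) k = 0 := by
        refine tendsto_nhds_unique (tendsto_const_nhds (f := l)) (hlim.congr fun n => ?_)
        exact redW_const hsol hD n k
      have h3 := hsol.eq_mul hq1 hD hk h0
      refine ⟨_, fun hc => ?_, h3⟩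
      obtain ⟨n, hn⟩ := hnz
      rw [hc] at h3
      rcases hn with hn | hn
      · exact hn (by rw [(h3 n).1, zero_mul])
      · exact hn (by rw [(h3 n).2, zero_mul])
    obtain ⟨c, hc, h1⟩ := key _ _ atTop inferInstance atTop_le_cofinite_int tendsto_succ_atTop hP
      (tendsto_plus_zero hq hz).1 (tendsto_plus_zero hq hz).2
      (exists_uP_ne_zero hq hz0 hz.le).exists
    obtain ⟨d, hd, h2⟩ := key _ _ atBot inferInstance atBot_le_cofinite_int tendsto_succ_atBot hM
      (tendsto_minus_zero hq hz).1 (tendsto_minus_zero hq hz).2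
      (exists_uM_ne_zero hq1 hq hz0 hz.le).exists
    -- The left side is the Wronskian of the eigenvector with itself.
    have hW : c * d * jostWt q z = 0 := by
      have e1 := (h1 0).1
      have e2 := (h1 (0 + 1)).2
      have e3 := (h2 0).1
      have e4 := (h2 (0 + 1)).2
      have e5 : c * d * jostWt q z = (c * uP q z 0) * (d * vM q z (0 + 1))
          - (d * uM q z 0) * (c * vP q z (0 + 1)) := by
        simp only [jostWt, redW]; ring
      rw [e5, ← e1, ← e2, ← e3, ← e4]
      ring
    rw [mul_eq_zero, or_iff_right (mul_ne_zero hc hd), jostWt_eq q hz0, mul_eq_zero,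
      or_iff_right (one_sub_inv_ne_zero hz)] at hW
    exact hW
  · intro hV
    obtain ⟨c, hc, h⟩ := exists_prop_of_jostWt_eq_zero hq1 hq hz0 hz.le
      (by rw [jostWt_eq q hz0, hV, mul_zero])
    obtain ⟨s1, s2⟩ := summable_sq_of_prop hq hz hc h
    refine ⟨fun n => (uP q z n, vP q z n / (m + lam m z)), fun h0 => ?_, s1, ?_,
      (isJostPlus_sol hm hq1 hq hz0 hz.le).1⟩
    · obtain ⟨k, hk⟩ := (exists_uP_ne_zero hq hz0 hz.le).exists
      exact hk (congrArg Prod.fst (congrFun h0 k))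
    · simpa only [norm_div, div_pow] using s2.div_const _

end Decay

/-! ### Bound states. -/

section Zeros

variable {q : ℤ → ℝ}

lemma tsum_int_split {f : ℤ → ℂ} (hf : Summable f) :
    ∑' n, f n = ∑' k : ℕ, f (-k) + ∑' k : ℕ, f (k + 1) := by
  obtain ⟨h1, h2⟩ := summable_int_iff_summable_nat_and_neg.1 hf
  have h3 : Summable fun k : ℕ => f (k + 1) := by
    simpa using (summable_nat_add_iff 1).2 h1
  rw [← (Equiv.neg ℤ).tsum_eq f]
  refine (tsum_of_nat_of_neg_add_one (f := fun n => f (-n)) h2 (by simpa using h3)).trans ?_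
  simp

lemma tsum_telescope_int {E f : ℤ → ℂ} (hE : ∀ n, E n - E (n - 1) = f n) (hf : Summable f)
    (htop : Tendsto E atTop (𝓝 0)) (hbot : Tendsto E atBot (𝓝 0)) : ∑' n, f n = 0 := by
  obtain ⟨h1, h2⟩ := summable_int_iff_summable_nat_and_neg.1 hf
  have h3 : Summable fun k : ℕ => f (k + 1) := by
    simpa using (summable_nat_add_iff 1).2 h1
  rw [tsum_int_split hf, tsum_telescope_left hE h2 hbot, tsum_telescope_right hE h3 htop,
    add_neg_cancel]

lemma summable_mul_of_summable_sq {f g : ℤ → ℂ} (hf : Summable fun n => ‖f n‖ ^ 2)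
    (hg : Summable fun n => ‖g n‖ ^ 2) : Summable fun n => f n * g n := by
  refine Summable.of_norm_bounded (hf.add hg) fun n => ?_
  rw [norm_mul]
  nlinarith [sq_nonneg (‖f n‖ - ‖g n‖), sq_nonneg ‖f n‖, sq_nonneg ‖g n‖]

/-- At a zero of `jostV`, the square-summable Jost solution. -/
structure IsBoundState (q : ℤ → ℝ) (z c : ℂ) : Prop where
  ne_zero : z ≠ 0
  norm_lt_one : ‖z‖ < 1
  c_ne_zero : c ≠ 0
  fst : ∀ n, uM q z n = c * uP q z n
  snd : ∀ n, vM q z n = c * vP q z n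
  summable_fst : Summable fun n : ℤ => ‖uP q z n‖ ^ 2
  summable_snd : Summable fun n : ℤ => ‖vP q z n‖ ^ 2

lemma exists_isBoundState (hq1 : ∀ n, q n ≠ 1)
    (hq : Summable fun n : ℤ => (1 + |(n : ℝ)|) * |q n|) {z : ℂ} (hz0 : z ≠ 0) (hz : ‖z‖ < 1)
    (hV : jostV q z = 0) : ∃ c, IsBoundState q z c := by
  obtain ⟨c, hc, h⟩ := exists_prop_of_jostWt_eq_zero hq1 hq hz0 hz.le
    (by rw [jostWt_eq q hz0, hV, mul_zero])
  obtain ⟨s1, s2⟩ := summable_sq_of_prop hq hz hc h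
  exact ⟨c, hz0, hz, hc, fun n => (h n).1, fun n => (h n).2, s1, s2⟩

namespace IsBoundState

variable {z w c d : ℂ}

lemma tendsto_fst (h : IsBoundState q z c) : Tendsto (uP q z) cofinite (𝓝 0) :=
  tendsto_cofinite_of_summable_sq h.summable_fst

lemma tendsto_snd (h : IsBoundState q z c) : Tendsto (vP q z) cofinite (𝓝 0) :=
  tendsto_cofinite_of_summable_sq h.summable_snd

lemma conj (h : IsBoundState q z c) :
    IsBoundState q (starRingEnd ℂ z) (starRingEnd ℂ c) where
  ne_zero := by simpa using h.ne_zero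
  norm_lt_one := by simpa using h.norm_lt_one
  c_ne_zero := by simpa using h.c_ne_zero
  fst n := by rw [uM_conj, uP_conj, h.fst, map_mul]
  snd n := by rw [vM_conj, vP_conj, h.snd, map_mul]
  summable_fst := by simpa only [uP_conj, RCLike.norm_conj] using h.summable_fst
  summable_snd := by simpa only [vP_conj, RCLike.norm_conj] using h.summable_snd

/-- Green's identity summed over ℤ has no boundary terms. The pairing is bilinear; reality of z
later identifies it with the inner product. -/
lemma orthogonal (hq1 : ∀ n, q n ≠ 1) (hq : Summable fun n : ℤ => (1 + |(n : ℝ)|) * |q n|)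
    (h : IsBoundState q z c) (h' : IsBoundState q w d) :
    (redMu w - redMu z) * ∑' n, uP q z n * uP q w n = 0 := by
  rw [← tsum_mul_left]
  refine tsum_telescope_int (redW_sub (isRedSol_plus hq1 hq h.ne_zero h.norm_lt_one.le)
    (isRedSol_plus hq1 hq h'.ne_zero h'.norm_lt_one.le))
    ((summable_mul_of_summable_sq h.summable_fst h'.summable_fst).mul_left _)
    (tendsto_redW_zero tendsto_succ_atTop ?_ ?_ ?_ ?_)
    (tendsto_redW_zero tendsto_succ_atBot ?_ ?_ ?_ ?_)
  · exact h.tendsto_fst.mono_left atTop_le_cofinite_int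
  · exact h.tendsto_snd.mono_left atTop_le_cofinite_int
  · exact h'.tendsto_fst.mono_left atTop_le_cofinite_int
  · exact h'.tendsto_snd.mono_left atTop_le_cofinite_int
  · exact h.tendsto_fst.mono_left atBot_le_cofinite_int
  · exact h.tendsto_snd.mono_left atBot_le_cofinite_int
  · exact h'.tendsto_fst.mono_left atBot_le_cofinite_int
  · exact h'.tendsto_snd.mono_left atBot_le_cofinite_int

/-- Summation by parts: v_{n+1} u_n has increments μ u_n² - v_n², and it tends to 0 at both ends. -/
lemma tsum_snd_sq (hq1 : ∀ n, q n ≠ 1) (hq : Summable fun n : ℤ => (1 + |(n : ℝ)|) * |q n|)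
    (h : IsBoundState q z c) :
    ∑' n, vP q z n ^ 2 = redMu z * ∑' n, uP q z n ^ 2 := by
  have hsol := isRedSol_plus hq1 hq h.ne_zero h.norm_lt_one.le
  have s1 : Summable fun n => uP q z n ^ 2 := by
    simpa only [sq] using summable_mul_of_summable_sq h.summable_fst h.summable_fst
  have s2 : Summable fun n => vP q z n ^ 2 := by
    simpa only [sq] using summable_mul_of_summable_sq h.summable_snd h.summable_snd
  have hlim : ∀ l : Filter ℤ, l ≤ cofinite → Tendsto (fun n : ℤ => n + 1) l l →
      Tendsto (fun n => vP q z (n + 1) * uP q z n) l (𝓝 0) := fun l hl hl' => by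
    simpa using ((h.tendsto_snd.mono_left hl).comp hl').mul (h.tendsto_fst.mono_left hl)
  have := tsum_telescope_int (E := fun n => vP q z (n + 1) * uP q z n)
    (f := fun n => redMu z * uP q z n ^ 2 - vP q z n ^ 2)
    (fun n => by
      simp only [sub_add_cancel]
      rw [hsol.snd_succ n, hsol.fst_pred n]
      ring)
    ((s1.mul_left _).sub s2) (hlim _ atTop_le_cofinite_int tendsto_succ_atTop)
    (hlim _ atBot_le_cofinite_int tendsto_succ_atBot)
  rw [(s1.mul_left _).tsum_sub s2, tsum_mul_left] at this
  exact (sub_eq_zero.1 this).symm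

lemma exists_ne_zero (hq : Summable fun n : ℤ => (1 + |(n : ℝ)|) * |q n|)
    (h : IsBoundState q z c) : ∃ n, uP q z n ≠ 0 :=
  (exists_uP_ne_zero hq h.ne_zero h.norm_lt_one.le).exists

lemma tsum_norm_sq_pos (hq : Summable fun n : ℤ => (1 + |(n : ℝ)|) * |q n|)
    (h : IsBoundState q z c) : 0 < ∑' n, ‖uP q z n‖ ^ 2 := by
  obtain ⟨n, hn⟩ := h.exists_ne_zero hq
  exact h.summable_fst.tsum_pos (fun n => sq_nonneg _) n (by positivity)

/-- Orthogonality of the states at z and at its conjugate, whose pairing is ∑ |u|² > 0, forces μ to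
be real. Inside the disc this makes z real. -/
lemma im_eq_zero (hq1 : ∀ n, q n ≠ 1) (hq : Summable fun n : ℤ => (1 + |(n : ℝ)|) * |q n|)
    (h : IsBoundState q z c) : z.im = 0 := by
  have h1 := h.orthogonal hq1 hq h.conj
  have h2 : ∑' n, uP q z n * uP q (starRingEnd ℂ z) n = ((∑' n, ‖uP q z n‖ ^ 2 : ℝ) : ℂ) := by
    rw [Complex.ofReal_tsum]
    refine tsum_congr fun n => ?_
    rw [uP_conj, Complex.mul_conj, Complex.normSq_eq_norm_sq]
  rw [h2, mul_eq_zero, or_iff_left (by exact_mod_cast (h.tsum_norm_sq_pos hq).ne'),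
    sub_eq_zero] at h1
  have h3 := congrArg Complex.im h1
  have hn : 0 < Complex.normSq z := Complex.normSq_pos.2 h.ne_zero
  have hn1 : Complex.normSq z < 1 := by
    rw [Complex.normSq_eq_norm_sq]
    have := norm_nonneg z
    nlinarith [h.norm_lt_one]
  simp only [redMu, Complex.sub_im, Complex.inv_im, Complex.conj_im, Complex.normSq_conj,
    Complex.im_ofNat] at h3
  field_simp at h3
  have : z.im * (1 - Complex.normSq z) = 0 := by linarith
  rcases mul_eq_zero.1 this with h4 | h4
  · exact h4
  · linarith

lemma conj_eq (hq1 : ∀ n, q n ≠ 1) (hq : Summable fun n : ℤ => (1 + |(n : ℝ)|) * |q n|)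
    (h : IsBoundState q z c) : starRingEnd ℂ z = z :=
  Complex.conj_eq_iff_im.2 (h.im_eq_zero hq1 hq)

lemma tsum_sq_eq (hq1 : ∀ n, q n ≠ 1) (hq : Summable fun n : ℤ => (1 + |(n : ℝ)|) * |q n|)
    (h : IsBoundState q z c) :
    ∑' n, uP q z n ^ 2 = ((∑' n, ‖uP q z n‖ ^ 2 : ℝ) : ℂ) ∧
    ∑' n, vP q z n ^ 2 = ((∑' n, ‖vP q z n‖ ^ 2 : ℝ) : ℂ) := by
  have hz := h.conj_eq hq1 hq
  constructor
  · rw [Complex.ofReal_tsum]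
    refine tsum_congr fun n => ?_
    have := uP_conj q z n
    rw [hz] at this
    rw [← Complex.normSq_eq_norm_sq, ← Complex.mul_conj, ← this, sq]
  · rw [Complex.ofReal_tsum]
    refine tsum_congr fun n => ?_
    have := vP_conj q z n
    rw [hz] at this
    rw [← Complex.normSq_eq_norm_sq, ← Complex.mul_conj, ← this, sq]

lemma tsum_sq_ne_zero (hq1 : ∀ n, q n ≠ 1)
    (hq : Summable fun n : ℤ => (1 + |(n : ℝ)|) * |q n|) (h : IsBoundState q z c) :
    ∑' n, uP q z n ^ 2 ≠ 0 := by
  rw [(h.tsum_sq_eq hq1 hq).1]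
  exact_mod_cast (h.tsum_norm_sq_pos hq).ne'

/-- For real z the identity ∑ v² = μ ∑ u² gives μ ≥ 0, whereas μ = -(1 - z)²/z is negative for 0 < z
< 1. -/
lemma re_neg (hq1 : ∀ n, q n ≠ 1) (hq : Summable fun n : ℤ => (1 + |(n : ℝ)|) * |q n|)
    (h : IsBoundState q z c) : z.re < 0 := by
  have him := h.im_eq_zero hq1 hq
  have h1 := h.tsum_snd_sq hq1 hq
  rw [(h.tsum_sq_eq hq1 hq).1, (h.tsum_sq_eq hq1 hq).2] at h1
  have hz : z = (z.re : ℂ) := Complex.ext (by simp) (by simp [him])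
  have hlt : |z.re| < 1 := (Complex.abs_re_le_norm z).trans_lt h.norm_lt_one
  have hne : z.re ≠ 0 := by
    intro h0
    exact h.ne_zero (by rw [hz, h0, Complex.ofReal_zero])
  have h2 : redMu z = ((2 - z.re - z.re⁻¹ : ℝ) : ℂ) := by
    rw [redMu]; nth_rewrite 1 2 [hz]; push_cast; ring
  rw [h2, ← Complex.ofReal_mul, Complex.ofReal_inj] at h1
  have h3 : 0 ≤ ∑' n, ‖vP q z n‖ ^ 2 := tsum_nonneg fun n => sq_nonneg _
  rw [h1] at h3
  have h4 := nonneg_of_mul_nonneg_left h3 (h.tsum_norm_sq_pos hq)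
  by_contra hcon
  have hpos : 0 < z.re := lt_of_le_of_ne (not_lt.1 hcon) hne.symm
  have h5 : z.re < 1 := (le_abs_self _).trans_lt hlt
  have h6 : 2 - z.re - z.re⁻¹ = -(1 - z.re) ^ 2 / z.re := by field_simp; ring
  rw [h6] at h4
  have : -(1 - z.re) ^ 2 / z.re < 0 := div_neg_of_neg_of_pos (by nlinarith) hpos
  linarith

end IsBoundState

end Zeros

/-! ### Lower bound for the Wronskian near the unit circle. -/

section LowerBound

variable {q : ℤ → ℝ}

lemma redMu_conj (z : ℂ) : redMu (starRingEnd ℂ z) = starRingEnd ℂ (redMu z) := by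
  have h2 : starRingEnd ℂ 2 = 2 := map_ofNat _ 2
  simp [redMu, h2]

lemma tsum_norm_sq_lower {f : ℕ → ℂ} {r δ : ℝ} (hr0 : 0 ≤ r) (hr : r < 1) {N : ℕ}
    (hs : Summable fun k => ‖f k‖ ^ 2) (hδ : 0 ≤ δ) (h : ∀ k, N ≤ k → δ * r ^ k ≤ ‖f k‖) :
    δ ^ 2 * r ^ (2 * N) / (1 - r ^ 2) ≤ ∑' k, ‖f k‖ ^ 2 := by
  have hr2 : r ^ 2 < 1 := by nlinarith
  have hg : HasSum (fun k : ℕ => δ ^ 2 * r ^ (2 * N) * (r ^ 2) ^ k)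
      (δ ^ 2 * r ^ (2 * N) / (1 - r ^ 2)) := by
    rw [div_eq_mul_inv]
    exact (hasSum_geometric_of_lt_one (sq_nonneg r) hr2).mul_left _
  have hs' : Summable fun k => ‖f (k + N)‖ ^ 2 := (summable_nat_add_iff N).2 hs
  calc _ = ∑' k, δ ^ 2 * r ^ (2 * N) * (r ^ 2) ^ k := hg.tsum_eq.symm
    _ ≤ ∑' k, ‖f (k + N)‖ ^ 2 := by
        refine hg.summable.tsum_le_tsum (fun k => ?_) hs'
        calc δ ^ 2 * r ^ (2 * N) * (r ^ 2) ^ k = (δ * r ^ (k + N)) ^ 2 := by ring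
          _ ≤ _ := pow_le_pow_left₀ (by positivity) (h _ (Nat.le_add_left _ _)) 2
    _ ≤ ∑' k, ‖f k‖ ^ 2 := by
        rw [← hs.sum_add_tsum_nat_add N]
        exact le_add_of_nonneg_left (Finset.sum_nonneg fun k _ => sq_nonneg _)

/-- The Wronskian is bounded below by a multiple of the imaginary part. -/
lemma exists_lower_bound_jostWt (hq1 : ∀ n, q n ≠ 1)
    (hq : Summable fun n : ℤ => (1 + |(n : ℝ)|) * |q n|) :
    ∃ c : ℝ, 0 < c ∧ ∀ z : ℂ, 1 / 2 ≤ ‖z‖ → ‖z‖ < 1 → c * |z.im| ≤ ‖jostWt q z‖ := by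
  obtain ⟨N1, hN1⟩ := eventually_atTop.1
    (eventually_norm_jostF_sub_one hq (by norm_num : (0 : ℝ) < 1 / 2))
  obtain ⟨N2, hN2⟩ := eventually_atTop.1
    (eventually_norm_jostF_sub_one (summable_reflect hq) (by norm_num : (0 : ℝ) < 1 / 2))
  have hq2 : ∀ᶠ n : ℤ in atBot, ‖(1 - q n : ℂ)‖ ≤ 2 := by
    have := ((tendsto_one_sub_q hq).mono_left atBot_le_cofinite_int).norm
    rw [norm_one] at this
    exact (this.eventually (gt_mem_nhds (by norm_num : (1 : ℝ) < 2))).mono fun n hn => hn.le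
  obtain ⟨N3, hN3⟩ := eventually_atBot.1 hq2
  set N : ℕ := N1.toNat + N2.toNat + (-N3).toNat with hN
  refine ⟨1 / 8 * (1 / 2) ^ (2 * (N + 1)), by positivity, fun z hz1 hz => ?_⟩
  have hz0 : z ≠ 0 := norm_pos_iff.1 (by linarith)
  have hzc0 : starRingEnd ℂ z ≠ 0 := by simpa using hz0
  have hzc : ‖starRingEnd ℂ z‖ < 1 := by simpa using hz
  have hr0 := norm_nonneg z
  have hr2 : 0 < 1 - ‖z‖ ^ 2 := by nlinarith
  -- `L` bounds both half-line sums from below: beyond N the Jost functions exceed 1/2 in modulus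
  -- and |1 - q| ≤ 2 on the left, so the terms of u are at least a quarter of a power of |z|. The
  -- denominator 1 - |z|² of the geometric series will compensate the factor 1 - |z|² in Im μ.
  set L : ℝ := 1 / 16 * (1 / 2) ^ (2 * (N + 1)) / (1 - ‖z‖ ^ 2) with hL
  have hLpos : 0 < L := by positivity
  have half_le : ∀ a : ℂ, ‖a - 1‖ ≤ 1 / 2 → 1 / 2 ≤ ‖a‖ := fun a ha => by
    have := norm_sub_norm_le 1 (1 - a)
    rw [sub_sub_cancel, norm_one, norm_sub_rev 1 a] at this
    linarith
  have hLle : L ≤ (1 / 4) ^ 2 * ‖z‖ ^ (2 * (N + 1)) / (1 - ‖z‖ ^ 2) := by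
    rw [hL]
    gcongr
    · norm_num
  have hz2 : ‖z‖ ^ (2 * (N + 1)) ≤ ‖z‖ ^ (2 * N) :=
    pow_le_pow_of_le_one hr0 hz.le (by omega)
  have hA : L ≤ ∑' k : ℕ, ‖uP q z (k + 1)‖ ^ 2 := by
    have hs : Summable fun k : ℕ => ‖uP q z k‖ ^ 2 := by
      simpa only [norm_mul, ← sq, norm_pow] using (summable_uP_mul hq hz hz).norm
    have hs' : Summable fun k : ℕ => ‖uP q z (k + 1)‖ ^ 2 := by
      simpa using (summable_nat_add_iff 1).2 hs
    refine hLle.trans ?_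
    have := tsum_norm_sq_lower (f := fun k : ℕ => uP q z (k + 1)) (δ := 1 / 4 * ‖z‖) (N := N)
      hr0 hz hs' (by positivity) fun k hk => by
        have := half_le _ (hN1 (k + 1) (by omega) z hz.le).1
        rw [uP, norm_mul, zpow_add_one₀ hz0, zpow_natCast, norm_mul, norm_pow]
        have h0 : 0 ≤ ‖z‖ ^ k * ‖z‖ := by positivity
        nlinarith
    refine le_trans (le_of_eq ?_) this
    ring
  have hA' : L ≤ ∑' k : ℕ, ‖uM q z (-k)‖ ^ 2 := by
    have hs : Summable fun k : ℕ => ‖uM q z (-k)‖ ^ 2 := by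
      simpa only [norm_mul, ← sq, norm_pow] using (summable_uM_mul hq hz hz).norm
    refine hLle.trans ?_
    have := tsum_norm_sq_lower (f := fun k : ℕ => uM q z (-k)) (δ := 1 / 4) (N := N)
      hr0 hz hs (by positivity) fun k hk => by
        have h1 : 1 / 2 ≤ ‖jostGm q (-k) z‖ := by
          rw [jostGm, neg_neg]
          exact half_le _ (hN2 k (by omega) z hz.le).2
        have h2 := hN3 (-k) (by omega)
        have h3 : 0 < ‖(1 - q (-k) : ℂ)‖ := norm_pos_iff.2 (one_sub_ne_zero_of_ne hq1 _)
        rw [uM, norm_mul, neg_neg, zpow_natCast, norm_pow, norm_div, mul_comm]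
        refine mul_le_mul_of_nonneg_left ?_ (by positivity)
        rw [le_div_iff₀ h3]
        linarith
    refine le_trans ?_ this
    gcongr
  set A := ∑' k : ℕ, ‖uP q z (k + 1)‖ ^ 2
  set A' := ∑' k : ℕ, ‖uM q z (-k)‖ ^ 2
  set y := (redMu z).im with hy
  have hmu : redMu z - redMu (starRingEnd ℂ z) = 2 * Complex.I * y := by
    rw [redMu_conj, Complex.sub_conj]; push_cast; ring
  have h2I : (2 * Complex.I : ℂ) ≠ 0 := mul_ne_zero two_ne_zero Complex.I_ne_zero
  have hP := tsum_uP_mul hq1 hq hzc0 hzc hz0 hz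
  have hM := tsum_uM_mul hq1 hq hzc0 hzc hz0 hz
  have hPs : ∑' k : ℕ, uP q (starRingEnd ℂ z) (k + 1) * uP q z (k + 1) = (A : ℂ) := by
    rw [Complex.ofReal_tsum]
    refine tsum_congr fun n => ?_
    rw [uP_conj, mul_comm, Complex.mul_conj, Complex.normSq_eq_norm_sq]
  have hMs : ∑' k : ℕ, uM q (starRingEnd ℂ z) (-k) * uM q z (-k) = (A' : ℂ) := by
    rw [Complex.ofReal_tsum]
    refine tsum_congr fun n => ?_
    rw [uM_conj, mul_comm, Complex.mul_conj, Complex.normSq_eq_norm_sq]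
  rw [hPs, hmu] at hP
  rw [hMs, hmu] at hM
  simp only [redW, uP_conj, vP_conj, uM_conj, vM_conj, zero_add] at hP hM
  set a := uP q z 0 with ha
  set b := vP q z 1
  set a' := uM q z 0 with ha'
  set b' := vM q z 1
  have hW : jostWt q z = a * b' - a' * b := by simp [jostWt, redW, ha, ha', b, b']
  have hP' : (starRingEnd ℂ a * b).im = -(y * A) := by
    have : starRingEnd ℂ a * b - a * starRingEnd ℂ b = 2 * Complex.I * (starRingEnd ℂ a * b).im := by
      have := Complex.sub_conj (starRingEnd ℂ a * b)
      rw [map_mul, Complex.conj_conj] at this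
      rw [this]; push_cast; ring
    rw [this, mul_assoc, ← mul_neg] at hP
    have := mul_left_cancel₀ h2I hP
    have h5 : ((y * A : ℝ) : ℂ) = ((-(starRingEnd ℂ a * b).im : ℝ) : ℂ) := by
      push_cast; exact this
    rw [Complex.ofReal_inj] at h5
    linarith
  have hM' : (starRingEnd ℂ a' * b').im = y * A' := by
    have : starRingEnd ℂ a' * b' - a' * starRingEnd ℂ b'
        = 2 * Complex.I * (starRingEnd ℂ a' * b').im := by
      have := Complex.sub_conj (starRingEnd ℂ a' * b')
      rw [map_mul, Complex.conj_conj] at this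
      rw [this]; push_cast; ring
    rw [this, mul_assoc] at hM
    have := mul_left_cancel₀ h2I hM
    have h5 : ((y * A' : ℝ) : ℂ) = (((starRingEnd ℂ a' * b').im : ℝ) : ℂ) := by
      push_cast; exact this
    rw [Complex.ofReal_inj] at h5
    linarith
  -- The Herglotz property: Im(b/a) and Im(b'/a') have opposite signs, so in their difference, which
  -- is the Wronskian up to a factor, the two half-line contributions add and cannot cancel.
  have hIm : (jostWt q z * (starRingEnd ℂ a * starRingEnd ℂ a')).im
      = y * (‖a‖ ^ 2 * A' + ‖a'‖ ^ 2 * A) := by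
    have e : jostWt q z * (starRingEnd ℂ a * starRingEnd ℂ a')
        = (a * starRingEnd ℂ a) * (starRingEnd ℂ a' * b')
          - (a' * starRingEnd ℂ a') * (starRingEnd ℂ a * b) := by rw [hW]; ring
    rw [e, Complex.mul_conj, Complex.mul_conj, Complex.sub_im, Complex.im_ofReal_mul,
      Complex.im_ofReal_mul, hP', hM', Complex.normSq_eq_norm_sq, Complex.normSq_eq_norm_sq]
    ring
  have hlow : |y| * (‖a‖ ^ 2 * A' + ‖a'‖ ^ 2 * A) ≤ ‖jostWt q z‖ * (‖a‖ * ‖a'‖) := by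
    have h6 := Complex.abs_im_le_norm (jostWt q z * (starRingEnd ℂ a * starRingEnd ℂ a'))
    have hnn : 0 ≤ ‖a‖ ^ 2 * A' + ‖a'‖ ^ 2 * A := by
      have := hLpos.le.trans hA
      have := hLpos.le.trans hA'
      positivity
    rw [hIm, abs_mul, abs_of_nonneg hnn] at h6
    simpa only [norm_mul, RCLike.norm_conj] using h6
  -- Im μ = Im z (1 - |z|²)/|z|².
  have hyim : |z.im| * (1 - ‖z‖ ^ 2) ≤ |y| := by
    have hn : 0 < ‖z‖ ^ 2 := by positivity
    have : y = z.im * ((1 - ‖z‖ ^ 2) / ‖z‖ ^ 2) := by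
      simp only [hy, redMu, Complex.sub_im, Complex.inv_im, Complex.im_ofNat,
        Complex.normSq_eq_norm_sq]
      field_simp
      ring
    rw [this, abs_mul, abs_of_pos (div_pos hr2 hn)]
    refine mul_le_mul_of_nonneg_left ?_ (abs_nonneg _)
    rw [le_div_iff₀ hn]
    nlinarith
  have hfin : 2 * |y| * L ≤ ‖jostWt q z‖ := by
    by_cases hy0 : y = 0
    · rw [hy0]; simp
    · have hyp : 0 < |y| := abs_pos.2 hy0
      have ha0 : 0 < ‖a‖ := by
        rw [norm_pos_iff]
        intro h0
        rw [h0] at hP'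
        simp only [map_zero, zero_mul, Complex.zero_im] at hP'
        have : y * A = 0 := by linarith
        rcases mul_eq_zero.1 this with h | h
        · exact hy0 h
        · linarith
      have ha0' : 0 < ‖a'‖ := by
        rw [norm_pos_iff]
        intro h0
        rw [h0] at hM'
        simp only [map_zero, zero_mul, Complex.zero_im] at hM'
        rcases mul_eq_zero.1 hM'.symm with h | h
        · exact hy0 h
        · linarith
      have haa : 0 < ‖a‖ * ‖a'‖ := mul_pos ha0 ha0'
      refine le_of_mul_le_mul_right (le_trans ?_ hlow) haa
      have h7 : 2 * (‖a‖ * ‖a'‖) * L ≤ ‖a‖ ^ 2 * A' + ‖a'‖ ^ 2 * A := by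
        have h8 := mul_le_mul_of_nonneg_left hA (sq_nonneg ‖a'‖)
        have h9 := mul_le_mul_of_nonneg_left hA' (sq_nonneg ‖a‖)
        nlinarith [mul_nonneg (sq_nonneg (‖a‖ - ‖a'‖)) hLpos.le]
      nlinarith
  refine le_trans ?_ hfin
  have h10 := mul_le_mul_of_nonneg_right hyim hLpos.le
  have h11 : (1 - ‖z‖ ^ 2) * L = 1 / 16 * (1 / 2) ^ (2 * (N + 1)) := by
    rw [hL]; field_simp
  rw [mul_assoc, h11] at h10
  linarith

end LowerBound

/-! ### Finiteness of the set of bound states. -/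

section FiniteZeros

variable {q : ℤ → ℝ}

lemma redMu_injOn {z w : ℂ} (hz0 : z ≠ 0) (hw0 : w ≠ 0) (hz : ‖z‖ < 1) (hw : ‖w‖ < 1)
    (h : redMu z = redMu w) : z = w := by
  have h1 : (z - w) * (z * w - 1) = 0 := by
    simp only [redMu] at h
    field_simp at h
    linear_combination -h
  rcases mul_eq_zero.1 h1 with h2 | h2
  · exact sub_eq_zero.1 h2
  · exfalso
    have h3 : ‖z * w‖ = 1 := by rw [sub_eq_zero.1 h2, norm_one]
    rw [norm_mul] at h3
    nlinarith [norm_nonneg z, norm_nonneg w]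

/-- The zeros of `jostV` in the punctured unit disc. -/
def jostZeros (q : ℤ → ℝ) : Set ℂ := {z | z ≠ 0 ∧ ‖z‖ < 1 ∧ jostV q z = 0}

lemma continuousWithinAt_uP (hq : Summable fun n : ℤ => (1 + |(n : ℝ)|) * |q n|) (n : ℤ) :
    ContinuousWithinAt (fun z => uP q z n) (Metric.closedBall 0 1) (-1) ∧
    ContinuousWithinAt (fun z => uM q z n) (Metric.closedBall 0 1) (-1) := by
  have hmem : (-1 : ℂ) ∈ Metric.closedBall (0 : ℂ) 1 := by simp
  have hz : ∀ k : ℤ, ContinuousWithinAt (fun z : ℂ => z ^ k) (Metric.closedBall 0 1) (-1) :=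
    fun k => (continuousAt_zpow₀ _ k (Or.inl (by norm_num))).continuousWithinAt
  exact ⟨(hz n).mul ((isWiener_jostF hq n).continuousOn _ hmem),
    (hz (-n)).mul (((isWiener_jostGm hq n).continuousOn _ hmem).div_const _)⟩

lemma eventually_re_mul_pos {f : ℂ → ℂ} {s : Set ℂ} {x : ℂ} (hf : ContinuousWithinAt f s x)
    (h : 0 < (f x * f x).re) : ∀ᶠ p : ℂ × ℂ in 𝓝[s] x ×ˢ 𝓝[s] x, 0 < (f p.1 * f p.2).re := by
  have h1 : Tendsto (fun p : ℂ × ℂ => (f p.1 * f p.2).re) (𝓝[s] x ×ˢ 𝓝[s] x)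
      (𝓝 (f x * f x).re) :=
    (Complex.continuous_re.tendsto _).comp
      ((hf.tendsto.comp tendsto_fst).mul (hf.tendsto.comp tendsto_snd))
  exact h1.eventually (lt_mem_nhds h)

/-- Two bound states close to `-1` would have a positive inner product. -/
lemma exists_nhds_jostZeros_subsingleton (hq1 : ∀ n, q n ≠ 1)
    (hq : Summable fun n : ℤ => (1 + |(n : ℝ)|) * |q n|) (hW : jostWt q (-1) = 0) :
    ∃ U ∈ 𝓝[Metric.closedBall 0 1] (-1 : ℂ), ∀ z ∈ U, ∀ w ∈ U, z ∈ jostZeros q →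
      w ∈ jostZeros q → z = w := by
  have hreal : ∀ (z : ℂ), starRingEnd ℂ z = z → ∀ n, (uP q z n).im = 0 ∧ (uM q z n).im = 0 :=
    fun z hz n => by
      have h1 := uP_conj q z n
      have h2 := uM_conj q z n
      rw [hz] at h1 h2
      exact ⟨Complex.conj_eq_iff_im.1 h1.symm, Complex.conj_eq_iff_im.1 h2.symm⟩
  have hm1 : starRingEnd ℂ (-1 : ℂ) = -1 := by simp
  obtain ⟨c₀, hc₀, hprop⟩ := exists_prop_of_jostWt_eq_zero hq1 hq (z := -1) (by norm_num)
    (by simp) hW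
  obtain ⟨N1, hN1⟩ := eventually_atTop.1
    (eventually_norm_jostF_sub_one hq (by norm_num : (0 : ℝ) < 1 / 2))
  obtain ⟨N2, hN2⟩ := eventually_atTop.1
    (eventually_norm_jostF_sub_one (summable_reflect hq) (by norm_num : (0 : ℝ) < 1 / 2))
  have hq2 : ∀ᶠ n : ℤ in atBot, 0 < 1 - q n := by
    have := ((tendsto_q hq).mono_left atBot_le_cofinite_int).const_sub 1
    rw [sub_zero] at this
    exact this.eventually (lt_mem_nhds one_pos)
  obtain ⟨N3, hN3⟩ := eventually_atBot.1 hq2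
  -- To the right of `N` the functions f have positive real part; to the left of `-N` so do the
  -- reflected g, and 1 - q_n > 0.
  set N : ℤ := |N1| + |N2| + |N3| with hN
  have hNN1 : N1 ≤ N := by
    have := le_abs_self N1; have := abs_nonneg N2; have := abs_nonneg N3; omega
  have hNN2 : N2 ≤ N := by
    have := le_abs_self N2; have := abs_nonneg N1; have := abs_nonneg N3; omega
  have hNN3 : -N ≤ N3 := by
    have := neg_abs_le N3; have := abs_nonneg N1; have := abs_nonneg N2; omega
  have hN0 : 0 ≤ N := by positivity
  have hre : ∀ a : ℂ, ‖a - 1‖ ≤ 1 / 2 → 0 < a.re := fun a ha => by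
    have h1 := (Complex.abs_re_le_norm (a - 1)).trans ha
    rw [Complex.sub_re, Complex.one_re, abs_le] at h1
    linarith [h1.1]
  have huN : uP q (-1) N ≠ 0 := by
    refine mul_ne_zero (zpow_ne_zero _ (by norm_num)) fun h0 => ?_
    have := hre _ (hN1 N hNN1 (-1) (by simp)).1
    rw [h0] at this
    simp at this
  have hsq : ∀ a : ℂ, a.im = 0 → (a * a).re = a.re ^ 2 := fun a ha => by
    rw [Complex.mul_re, ha]; ring
  have hsqpos : ∀ a : ℂ, a.im = 0 → a ≠ 0 → 0 < (a * a).re := fun a ha ha0 => by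
    rw [hsq a ha]
    have : a.re ≠ 0 := fun h => ha0 (Complex.ext h ha)
    positivity
  -- At z = -1 the solutions are real, so products of nearby values at one site are close to
  -- squares.
  have ev1 := eventually_re_mul_pos (continuousWithinAt_uP hq N).1
    (hsqpos _ (hreal _ hm1 N).1 huN)
  have ev2 := eventually_re_mul_pos (continuousWithinAt_uP hq N).2
    (hsqpos _ (hreal _ hm1 N).2 (by rw [(hprop N).1]; exact mul_ne_zero hc₀ huN))
  have ev3 : ∀ᶠ p : ℂ × ℂ in 𝓝[Metric.closedBall 0 1] (-1 : ℂ) ×ˢ 𝓝[Metric.closedBall 0 1] (-1),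
      0 < ∑ n ∈ Finset.Icc (-N) N, (uP q p.1 n * uP q p.2 n).re := by
    have h1 : Tendsto (fun p : ℂ × ℂ => ∑ n ∈ Finset.Icc (-N) N, (uP q p.1 n * uP q p.2 n).re)
        (𝓝[Metric.closedBall 0 1] (-1 : ℂ) ×ˢ 𝓝[Metric.closedBall 0 1] (-1))
        (𝓝 (∑ n ∈ Finset.Icc (-N) N, (uP q (-1) n * uP q (-1) n).re)) :=
      tendsto_finsetSum _ fun n _ => (Complex.continuous_re.tendsto _).comp
        (((continuousWithinAt_uP hq n).1.tendsto.comp tendsto_fst).mul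
          ((continuousWithinAt_uP hq n).1.tendsto.comp tendsto_snd))
    refine h1.eventually (lt_mem_nhds ?_)
    refine Finset.sum_pos' (fun n _ => ?_) ⟨N, Finset.mem_Icc.2 ⟨by omega, le_rfl⟩, ?_⟩
    · rw [hsq _ (hreal _ hm1 n).1]; positivity
    · exact hsqpos _ (hreal _ hm1 N).1 huN
  obtain ⟨U, hU, hUU⟩ := (Filter.eventually_prod_self_iff (r := fun z w : ℂ =>
    0 < (uP q z N * uP q w N).re ∧ 0 < (uM q z N * uM q w N).re ∧
      0 < ∑ n ∈ Finset.Icc (-N) N, (uP q z n * uP q w n).re)).1 (ev1.and (ev2.and ev3))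
  refine ⟨U, hU, fun z hz w hw hzZ hwZ => ?_⟩
  obtain ⟨c, hc⟩ := exists_isBoundState hq1 hq hzZ.1 hzZ.2.1 hzZ.2.2
  obtain ⟨d, hd⟩ := exists_isBoundState hq1 hq hwZ.1 hwZ.2.1 hwZ.2.2
  obtain ⟨p1, p2, p3⟩ := hUU z hz w hw
  by_contra hne
  have horth := hc.orthogonal hq1 hq hd
  rw [mul_eq_zero, or_iff_right (sub_ne_zero.2 fun h => hne
    (redMu_injOn hzZ.1 hwZ.1 hzZ.2.1 hwZ.2.1 h.symm))] at horth
  have hsum := summable_mul_of_summable_sq hc.summable_fst hd.summable_fst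
  have hsre : Summable fun n => (uP q z n * uP q w n).re := Complex.reCLM.summable hsum
  have htre : ∑' n, (uP q z n * uP q w n).re = 0 := by
    rw [← Complex.re_tsum hsum, horth, Complex.zero_re]
  have hzc := hc.conj_eq hq1 hq
  have hwc := hd.conj_eq hq1 hq
  have hmulre : ∀ a b : ℂ, a.im = 0 → (a * b).re = a.re * b.re := fun a b ha => by
    rw [Complex.mul_re, ha]; ring
  have hofre : ∀ {a : ℂ}, a.im = 0 → a = (a.re : ℂ) := fun ha => Complex.ext (by simp) (by simp [ha])
  have hzre := hc.re_neg hq1 hq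
  have hwre := hd.re_neg hq1 hq
  have hzwpow : ∀ n : ℤ, 0 < (z ^ n * w ^ n).re := fun n => by
    rw [← mul_zpow, hofre (hc.im_eq_zero hq1 hq), hofre (hd.im_eq_zero hq1 hq),
      ← Complex.ofReal_mul, ← Complex.ofReal_zpow, Complex.ofReal_re]
    exact zpow_pos (mul_pos_of_neg_of_neg hzre hwre) n
  have hzwim : ∀ n : ℤ, (z ^ n * w ^ n).im = 0 := fun n => by
    rw [← mul_zpow, hofre (hc.im_eq_zero hq1 hq), hofre (hd.im_eq_zero hq1 hq),
      ← Complex.ofReal_mul, ← Complex.ofReal_zpow, Complex.ofReal_im]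
  have hFre : ∀ n (y : ℂ), starRingEnd ℂ y = y → (jostF q n y).im = 0 := fun n y hy => by
    have := jostF_conj q n y
    rw [hy] at this
    exact Complex.conj_eq_iff_im.1 this.symm
  have hGre : ∀ n (y : ℂ), starRingEnd ℂ y = y → (jostGm q n y).im = 0 := fun n y hy => by
    have : jostGm q n (starRingEnd ℂ y) = starRingEnd ℂ (jostGm q n y) := jostG_conj _ _ _
    rw [hy] at this
    exact Complex.conj_eq_iff_im.1 this.symm
  have hright : ∀ n, N ≤ n → 0 ≤ (uP q z n * uP q w n).re := fun n hn => by
    have e : uP q z n * uP q w n = (z ^ n * w ^ n) * (jostF q n z * jostF q n w) := by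
      simp only [uP]; ring
    rw [e, hmulre _ _ (hzwim n), hmulre _ _ (hFre n z hzc)]
    have h1 := hre _ (hN1 n (hNN1.trans hn) z hc.norm_lt_one.le).1
    have h2 := hre _ (hN1 n (hNN1.trans hn) w hd.norm_lt_one.le).1
    have := hzwpow n
    positivity
  have hMim : ∀ n, (uM q z n).im = 0 := fun n => (hreal z hzc n).2
  have hPim : ∀ n, (uP q z n).im = 0 := fun n => (hreal z hzc n).1
  have hleftM : ∀ n, n ≤ -N → 0 ≤ (uM q z n * uM q w n).re := fun n hn => by
    have hn1 := hN3 n (hn.trans hNN3)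
    have e : uM q z n * uM q w n = (z ^ (-n) * w ^ (-n)) *
        ((((1 - q n) ^ 2)⁻¹ : ℝ) * (jostGm q n z * jostGm q n w)) := by
      simp only [uM]; push_cast; field_simp
    rw [e, hmulre _ _ (hzwim (-n)), Complex.re_ofReal_mul, hmulre _ _ (hGre n z hzc)]
    have h1 : 0 < (jostGm q n z).re := hre _ (hN2 (-n) (by omega) z hc.norm_lt_one.le).2
    have h2 : 0 < (jostGm q n w).re := hre _ (hN2 (-n) (by omega) w hd.norm_lt_one.le).2
    have := hzwpow (-n)
    positivity
  have hcim : ∀ {y e : ℂ}, IsBoundState q y e → e.im = 0 := fun {y e} h => by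
    have hy := h.conj_eq hq1 hq
    obtain ⟨n, hn⟩ := h.exists_ne_zero hq
    have h1 := h.fst n
    have h2 := congrArg (starRingEnd ℂ) h1
    rw [← uM_conj, map_mul, ← uP_conj, hy, h1] at h2
    exact Complex.conj_eq_iff_im.1 (mul_right_cancel₀ hn h2).symm
  -- The products of the u⁺ and of the u⁻ at site `N` are both positive, hence so is c d. This
  -- carries positivity on the left tail from u⁻ = c u⁺ to u⁺.
  have hcd : 0 < (c * d).re := by
    have e : uM q z N * uM q w N = (c * d) * (uP q z N * uP q w N) := by
      rw [hc.fst, hd.fst]; ring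
    have hcdim : (c * d).im = 0 := by rw [Complex.mul_im, hcim hc, hcim hd]; ring
    have p2' : 0 < (uM q z N * uM q w N).re := p2
    rw [e, hmulre _ _ hcdim] at p2'
    exact pos_of_mul_pos_left p2' (le_of_lt p1)
  have hleft : ∀ n, n ≤ -N → 0 ≤ (uP q z n * uP q w n).re := fun n hn => by
    have h1 := hleftM n hn
    have e : uM q z n * uM q w n = (c * d) * (uP q z n * uP q w n) := by
      rw [hc.fst, hd.fst]; ring
    have hcdim : (c * d).im = 0 := by rw [Complex.mul_im, hcim hc, hcim hd]; ring
    rw [e, hmulre _ _ hcdim] at h1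
    exact nonneg_of_mul_nonneg_right h1 hcd
  have := hsre.sum_le_tsum (Finset.Icc (-N) N) fun n hn => by
    rw [Finset.mem_Icc, not_and_or, not_le, not_le] at hn
    rcases hn with hn | hn
    · exact hleft n hn.le
    · exact hright n hn.le
  rw [htre] at this
  have p3' : 0 < ∑ n ∈ Finset.Icc (-N) N, (uP q z n * uP q w n).re := p3
  linarith

/-- Compactness reduces the claim to excluding accumulation points, and the only delicate candidate
is -1, the edge of the continuous spectrum. There the first moment condition acts through continuity
of the Jost solutions up to the circle. -/
lemma finite_jostZeros (hq1 : ∀ n, q n ≠ 1)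
    (hq : Summable fun n : ℤ => (1 + |(n : ℝ)|) * |q n|) : (jostZeros q).Finite := by
  by_contra hinf
  have hsub : jostZeros q ⊆ Metric.closedBall 0 1 := fun z hz =>
    mem_closedBall_zero_iff.2 hz.2.1.le
  obtain ⟨x, hx, hacc⟩ := Set.Infinite.exists_accPt_of_subset_isCompact hinf
    (isCompact_closedBall (0 : ℂ) 1) hsub
  have hfreq : ∃ᶠ z in 𝓝[≠] x, z ∈ jostZeros q := accPt_iff_frequently_nhdsNE.1 hacc
  -- An interior accumulation point would make V vanish identically, against V(0) ≠ 0.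
  have hxn : ¬ ‖x‖ < 1 := by
    intro hx1
    have han : AnalyticOnNhd ℂ (jostV q) (Metric.ball 0 1) :=
      (jostV_differentiableOn hq).analyticOnNhd Metric.isOpen_ball
    have := han.eqOn_zero_of_preconnected_of_frequently_eq_zero
      (convex_ball (0 : ℂ) 1).isPreconnected (mem_ball_zero_iff.2 hx1)
      (hfreq.mono fun z hz => hz.2.2)
    exact jostV_zero_ne_zero hq1 hq (this (Metric.mem_ball_self one_pos))
  -- All zeros are negative reals, so a limit point on the circle is -1.
  have hxeq : x = -1 := by
    have hcl : IsClosed {z : ℂ | z.im = 0 ∧ z.re ≤ 0} :=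
      (isClosed_eq Complex.continuous_im continuous_const).inter
        (isClosed_le Complex.continuous_re continuous_const)
    have hmem : x ∈ {z : ℂ | z.im = 0 ∧ z.re ≤ 0} := by
      refine hcl.mem_of_frequently_of_tendsto (f := fun z : ℂ => z) (b := 𝓝[≠] x)
        (hfreq.mono fun z hz => ?_) (tendsto_id.mono_left nhdsWithin_le_nhds)
      obtain ⟨c, hc⟩ := exists_isBoundState hq1 hq hz.1 hz.2.1 hz.2.2
      exact ⟨hc.im_eq_zero hq1 hq, (hc.re_neg hq1 hq).le⟩
    have h1 : ‖x‖ = 1 := le_antisymm (mem_closedBall_zero_iff.1 hx) (not_lt.1 hxn)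
    obtain ⟨him, hre⟩ := hmem
    have h2 : x = (x.re : ℂ) := Complex.ext (by simp) (by simp [him])
    rw [h2, Complex.norm_real, Real.norm_eq_abs, abs_of_nonpos hre] at h1
    rw [h2, show x.re = -1 by linarith]
    simp
  subst hxeq
  have hV : jostV q (-1) = 0 := by
    by_contra hV
    have h1 := (jostV_continuousOn hq).continuousWithinAt hx
    have h2 := h1.eventually_ne hV
    rw [eventually_nhdsWithin_iff] at h2
    have h3 : ∃ᶠ z in 𝓝 (-1 : ℂ), z ∈ jostZeros q := hfreq.filter_mono nhdsWithin_le_nhds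
    obtain ⟨z, hz1, hz2⟩ := (h3.and_eventually h2).exists
    exact hz2 (hsub hz1) hz1.2.2
  obtain ⟨U, hU, hUU⟩ := exists_nhds_jostZeros_subsingleton hq1 hq
    (by rw [jostWt_eq q (by norm_num), hV, mul_zero])
  rw [mem_nhdsWithin_iff_eventually] at hU
  obtain ⟨z, ⟨hz1, hz2⟩, hzne⟩ := ((hfreq.and_eventually
    (hU.filter_mono nhdsWithin_le_nhds)).and_eventually self_mem_nhdsWithin).exists
  have hne : ∀ᶠ w in 𝓝[≠] (-1 : ℂ), w ≠ z :=
    (eventually_ne_nhds (Ne.symm hzne)).filter_mono nhdsWithin_le_nhds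
  obtain ⟨w, ⟨hw1, hw2⟩, hwne⟩ := ((hfreq.and_eventually
    (hU.filter_mono nhdsWithin_le_nhds)).and_eventually hne).exists
  exact hwne (hUU w (hw2 (hsub hw1)) z (hz2 (hsub hz1)) hw1 hz1)

end FiniteZeros

/-! ### Boundedness of T near the unit circle. -/

section TransmissionBound

variable {q : ℤ → ℝ}

/-- Because z² - 1 = z(z - z̄) - (1 - |z|²). This numerator bound matches the lower bound c |Im z|
for the Wronskian. -/
lemma norm_sq_sub_one_le {z : ℂ} (hz : ‖z‖ ≤ 1) :
    ‖z ^ 2 - 1‖ ≤ 2 * (|z.im| + (1 - ‖z‖)) := by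
  have e : z ^ 2 - 1 = z * (z - starRingEnd ℂ z) - ((1 - ‖z‖ ^ 2 : ℝ) : ℂ) := by
    have := Complex.mul_conj z
    rw [Complex.normSq_eq_norm_sq] at this
    rw [mul_sub, this]; push_cast; ring
  have h0 := norm_nonneg z
  rw [e]
  refine (norm_sub_le _ _).trans ?_
  rw [norm_mul, Complex.sub_conj, norm_mul, Complex.norm_I, Complex.norm_real, Complex.norm_real,
    Real.norm_eq_abs, Real.norm_eq_abs, mul_one, abs_mul, abs_two,
    abs_of_nonneg (by nlinarith : 0 ≤ 1 - ‖z‖ ^ 2)]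
  nlinarith [mul_nonneg (sub_nonneg.2 hz) (abs_nonneg z.im)]

/-- The transmission coefficient is bounded near the unit circle. -/
lemma exists_bound_jostT (hq1 : ∀ n, q n ≠ 1)
    (hq : Summable fun n : ℤ => (1 + |(n : ℝ)|) * |q n|) :
    ∃ ρ B : ℝ, 0 < ρ ∧ ρ < 1 ∧
      ∀ z : ℂ, ρ ≤ ‖z‖ → ‖z‖ < 1 → jostV q z ≠ 0 ∧ ‖jostT q z‖ ≤ B := by
  obtain ⟨c, hc, hlow⟩ := exists_lower_bound_jostWt hq1 hq
  obtain ⟨ρ₁, hρ₁, hρ₁', hV⟩ : ∃ ρ₁ : ℝ, 1 / 2 ≤ ρ₁ ∧ ρ₁ < 1 ∧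
      ∀ z : ℂ, ρ₁ ≤ ‖z‖ → ‖z‖ < 1 → jostV q z ≠ 0 := by
    have hfin := finite_jostZeros hq1 hq
    have hev : ∀ᶠ ρ in 𝓝[<] (1 : ℝ), ∀ z ∈ jostZeros q, ‖z‖ < ρ := by
      rw [hfin.eventually_all]
      intro z hz
      exact (lt_mem_nhds hz.2.1).filter_mono nhdsWithin_le_nhds
    have hev2 : ∀ᶠ ρ in 𝓝[<] (1 : ℝ), 1 / 2 < ρ :=
      (lt_mem_nhds (by norm_num)).filter_mono nhdsWithin_le_nhds
    obtain ⟨ρ, ⟨h1, h2⟩, h3⟩ := ((hev.and hev2).and self_mem_nhdsWithin).exists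
    refine ⟨ρ, h2.le, h3, fun z hz hz1 hVz => ?_⟩
    have hz0 : z ≠ 0 := norm_pos_iff.1 (by linarith)
    exact absurd (h1 z ⟨hz0, hz1, hVz⟩) (not_lt.2 hz)
  have hT : ∀ z : ℂ, ρ₁ ≤ ‖z‖ → ‖z‖ < 1 →
      ‖jostT q z‖ * |z.im| ≤ 4 / c * (|z.im| + (1 - ‖z‖)) := by
    intro z hz hz1
    have hz0 : z ≠ 0 := norm_pos_iff.1 (by linarith)
    have hzne : z ≠ 1 := by rintro rfl; simp at hz1
    have hWne : jostWt q z ≠ 0 := by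
      rw [jostWt_eq q hz0]
      exact mul_ne_zero (one_sub_inv_ne_zero hz1) (hV z hz hz1)
    have hWpos := norm_pos_iff.2 hWne
    have hl := hlow z (hρ₁.trans hz) hz1
    have h1 : ‖z - z⁻¹‖ ≤ 2 * ‖z ^ 2 - 1‖ := by
      have : z - z⁻¹ = (z ^ 2 - 1) / z := by field_simp
      rw [this, norm_div, div_le_iff₀ (norm_pos_iff.2 hz0)]
      nlinarith [norm_nonneg (z ^ 2 - 1)]
    have h2 := norm_sq_sub_one_le hz1.le
    rw [jostT_eq q hz0 hzne, norm_div, div_mul_eq_mul_div, div_le_iff₀ hWpos]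
    have hn : 0 ≤ |z.im| + (1 - ‖z‖) := by linarith [abs_nonneg z.im]
    calc ‖z - z⁻¹‖ * |z.im| ≤ (4 * (|z.im| + (1 - ‖z‖))) * |z.im| :=
          mul_le_mul_of_nonneg_right (by linarith) (abs_nonneg _)
      _ = 4 / c * (|z.im| + (1 - ‖z‖)) * (c * |z.im|) := by field_simp
      _ ≤ _ := mul_le_mul_of_nonneg_left hl (by positivity)
  -- The radius is such that, when |Im z| < (1 - |z|)/4, the disc of centre Re z and radius (1 -
  -- |z|)/2 stays in |y| ≥ ρ₁. The constant 40 is 2 · 4 · 5 from the maximum principle below.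
  refine ⟨(4 * ρ₁ + 3) / 7, 40 / c, by linarith, by linarith, fun z hz hz1 => ?_⟩
  have hzρ : ρ₁ ≤ ‖z‖ := by linarith
  refine ⟨hV z hzρ hz1, ?_⟩
  by_cases him : (1 - ‖z‖) / 4 ≤ |z.im|
  · have hpos : 0 < |z.im| := by linarith
    have h1 := hT z hzρ hz1
    refine le_of_mul_le_mul_right (h1.trans ?_) hpos
    have h3 : |z.im| + (1 - ‖z‖) ≤ 10 * |z.im| := by linarith
    calc 4 / c * (|z.im| + (1 - ‖z‖)) ≤ 4 / c * (10 * |z.im|) :=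
          mul_le_mul_of_nonneg_left h3 (by positivity)
      _ = 40 / c * |z.im| := by ring
  · rw [not_le] at him
    set x : ℂ := (z.re : ℂ) with hx
    set r : ℝ := (1 - ‖z‖) / 2 with hr
    have hrpos : 0 < r := by rw [hr]; linarith
    have hzx : z - x = z.im * Complex.I := by
      rw [hx, sub_eq_iff_eq_add, add_comm]; exact (Complex.re_add_im z).symm
    have hxle : ‖x‖ ≤ ‖z‖ := by
      rw [hx, Complex.norm_real]; exact Complex.abs_re_le_norm z
    have hnzx : ‖z - x‖ = |z.im| := by rw [hzx]; simp
    have hxge : ‖z‖ - |z.im| ≤ ‖x‖ := by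
      have := norm_sub_norm_le z x
      linarith
    have hball : ∀ y ∈ Metric.closedBall x r, ρ₁ ≤ ‖y‖ ∧ ‖y‖ < 1 ∧ 1 - ‖y‖ ≤ 4 * r := by
      intro y hy
      rw [mem_closedBall_iff_norm] at hy
      have h1 : ‖y‖ ≤ ‖x‖ + r := by
        have := norm_sub_norm_le y x
        linarith
      have h2 : ‖x‖ - r ≤ ‖y‖ := by
        have := norm_sub_norm_le x y
        rw [norm_sub_rev] at this
        linarith
      refine ⟨?_, ?_, ?_⟩ <;> linarith
    -- On the circle |y - x| = r about a real centre, (y - x)² - r² has modulus 2r |Im y|, which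
    -- cancels the blow-up of the bound for T at real points. At y = z, which lies on the vertical
    -- line through x, its modulus is at least r².
    have hd : DifferentiableOn ℂ (fun y => jostT q y * ((y - x) ^ 2 - r ^ 2))
        (Metric.closedBall x r) := by
      intro y hy
      obtain ⟨h1, h2, -⟩ := hball y hy
      have hVd : DifferentiableAt ℂ (jostV q) y := (jostV_differentiableOn hq).differentiableAt
        (Metric.isOpen_ball.mem_nhds (mem_ball_zero_iff.2 h2))
      have hTd : DifferentiableAt ℂ (jostT q) y :=
        (by fun_prop : DifferentiableAt ℂ (fun y : ℂ => 1 + y) y).div hVd (hV y h1 h2)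
      exact (hTd.mul (by fun_prop)).differentiableWithinAt
    have hmax := Complex.norm_le_of_forall_mem_frontier_norm_le (Metric.isBounded_ball)
      (hd.diffContOnCl_ball subset_rfl) (C := 40 / c * r ^ 2) (fun y hy => ?_)
      (z := z) (subset_closure ?_)
    · have h5 : r ^ 2 ≤ ‖(z - x) ^ 2 - (r : ℂ) ^ 2‖ := by
        have : (z - x) ^ 2 - (r : ℂ) ^ 2 = ((-(z.im ^ 2 + r ^ 2) : ℝ) : ℂ) := by
          rw [hzx, mul_pow, Complex.I_sq]; push_cast; ring
        rw [this, Complex.norm_real, norm_neg, Real.norm_eq_abs,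
          abs_of_nonneg (by positivity)]
        nlinarith [sq_nonneg z.im]
      rw [norm_mul] at hmax
      have h6 := mul_le_mul_of_nonneg_left h5 (norm_nonneg (jostT q z))
      exact le_of_mul_le_mul_right (h6.trans hmax) (by positivity)
    · rw [frontier_ball x hrpos.ne'] at hy
      obtain ⟨h1, h2, h3⟩ := hball y (Metric.sphere_subset_closedBall hy)
      rw [mem_sphere_iff_norm] at hy
      have hyim : (y - x).im = y.im := by simp [hx]
      have h4 : ‖(y - x) ^ 2 - (r : ℂ) ^ 2‖ = 2 * r * |y.im| := by
        have e : (y - x) ^ 2 - (r : ℂ) ^ 2 = (y - x) * ((y - x) - starRingEnd ℂ (y - x)) := by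
          have h5 := Complex.mul_conj (y - x)
          rw [Complex.normSq_eq_norm_sq, hy] at h5
          rw [mul_sub, h5]; push_cast; ring
        rw [e, norm_mul, Complex.sub_conj, hy, norm_mul, Complex.norm_I, Complex.norm_real, hyim,
          Real.norm_eq_abs, abs_mul, abs_two]
        ring
      have h5 := hT y h1 h2
      have h6 : |y.im| ≤ r := by
        rw [← hyim, ← hy]; exact Complex.abs_im_le_norm _
      rw [norm_mul, h4]
      calc ‖jostT q y‖ * (2 * r * |y.im|) = 2 * r * (‖jostT q y‖ * |y.im|) := by ring
        _ ≤ 2 * r * (4 / c * (|y.im| + (1 - ‖y‖))) :=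
            mul_le_mul_of_nonneg_left h5 (by positivity)
        _ ≤ 2 * r * (4 / c * (5 * r)) := by gcongr; linarith
        _ = 40 / c * r ^ 2 := by ring
    · rw [mem_ball_iff_norm, hnzx]
      linarith

end TransmissionBound

/-! ### Residues of T and the norming constants. -/

section Residues

variable {m : ℝ} {q : ℤ → ℝ}

lemma differentiableAt_sol (hq : Summable fun n : ℤ => (1 + |(n : ℝ)|) * |q n|) {z : ℂ}
    (hz0 : z ≠ 0) (hz : ‖z‖ < 1) (n : ℤ) :
    DifferentiableAt ℂ (fun z => uP q z n) z ∧ DifferentiableAt ℂ (fun z => vP q z n) z ∧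
    DifferentiableAt ℂ (fun z => uM q z n) z ∧ DifferentiableAt ℂ (fun z => vM q z n) z := by
  have hmem : Metric.ball (0 : ℂ) 1 ∈ 𝓝 z := Metric.isOpen_ball.mem_nhds (by simpa using hz)
  have hpow : ∀ k : ℤ, DifferentiableAt ℂ (fun z : ℂ => z ^ k) z := fun k =>
    differentiableAt_zpow.2 (Or.inl hz0)
  have hinv : DifferentiableAt ℂ (fun z : ℂ => z⁻¹) z := differentiableAt_inv hz0
  have h1 := (isWiener_jostF hq n).differentiableOn.differentiableAt hmem
  have h2 := (isWiener_jostG hq n).differentiableOn.differentiableAt hmem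
  have h3 := (isWiener_jostFm hq n).differentiableOn.differentiableAt hmem
  have h4 := (isWiener_jostGm hq n).differentiableOn.differentiableAt hmem
  exact ⟨(hpow n).mul h1, (hpow n).mul (((hinv.sub_const 1).mul h2).div_const _),
    (hpow (-n)).mul (h4.div_const _), (hpow (-n)).mul ((differentiableAt_id.sub_const 1).mul h3)⟩

/-- The factor at z₀ alone decays geometrically and the other is bounded, so the sum is dominated
uniformly in z. -/
lemma tendsto_tsum_mul_of_geometric {f : ℂ → ℕ → ℂ} {z₀ : ℂ} {C : ℝ} (hz₀ : ‖z₀‖ < 1)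
    (hf : ∀ z, ‖z‖ ≤ 1 → ∀ k, ‖f z k‖ ≤ C * ‖z‖ ^ k)
    (hcont : ∀ k, ContinuousAt (fun z => f z k) z₀) :
    Tendsto (fun z => ∑' k, f z k * f z₀ k) (𝓝 z₀) (𝓝 (∑' k, f z₀ k * f z₀ k)) := by
  have hC : 0 ≤ C := by
    have := (norm_nonneg _).trans (hf z₀ hz₀.le 0)
    simpa using this
  refine tendsto_tsum_of_dominated_convergence (bound := fun k => C * (C * ‖z₀‖ ^ k))
    (((summable_geometric_of_lt_one (norm_nonneg _) hz₀).mul_left C).mul_left C)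
    (fun k => (hcont k).tendsto.mul_const _) ?_
  have : Metric.ball (0 : ℂ) 1 ∈ 𝓝 z₀ := Metric.isOpen_ball.mem_nhds (by simpa using hz₀)
  filter_upwards [this] with z hz k
  rw [mem_ball_zero_iff] at hz
  rw [norm_mul]
  refine mul_le_mul ((hf z hz.le k).trans ?_) (hf z₀ hz₀.le k) (norm_nonneg _) hC
  exact mul_le_of_le_one_right hC (pow_le_one₀ (norm_nonneg _) hz.le)

lemma tendsto_sub_mul_div {f g : ℂ → ℂ} {z₀ : ℂ} (hf : DifferentiableAt ℂ f z₀)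
    (hg : ContinuousAt g z₀) :
    Tendsto (fun z => (f z - f z₀) * (g z - g z₀) / (z - z₀)) (𝓝[≠] z₀) (𝓝 0) := by
  have h1 := hasDerivAt_iff_tendsto_slope.1 hf.hasDerivAt
  have h2 : Tendsto (fun z => g z - g z₀) (𝓝[≠] z₀) (𝓝 0) := by
    simpa using (hg.tendsto.mono_left nhdsWithin_le_nhds).sub_const (g z₀)
  have := h1.mul h2
  rw [mul_zero] at this
  refine this.congr fun z => ?_
  rw [slope_def_field]
  ring

/-- This is the derivative of the Wronskian at its zero. At z₀ the solutions are proportional, so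
the mixed Wronskians become Wronskians of one Jost solution at z and z₀. Green's identity evaluates
these as μ(z) - μ(z₀) times half-line sums, and only continuity of those sums is needed. -/
lemma IsBoundState.tendsto_jostWt_div (hq1 : ∀ n, q n ≠ 1)
    (hq : Summable fun n : ℤ => (1 + |(n : ℝ)|) * |q n|) {z₀ c : ℂ} (h : IsBoundState q z₀ c) :
    Tendsto (fun z => jostWt q z / (z - z₀)) (𝓝[≠] z₀)
      (𝓝 ((-1 + (z₀ ^ 2)⁻¹) * (c * ∑' n, uP q z₀ n ^ 2))) := by
  obtain ⟨hz0, hz1, hc0, hfst, hsnd, hs1, hs2⟩ := h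
  obtain ⟨C, hC, hbd⟩ := exists_bound_sol hq
  obtain ⟨d1, d2, d3, d4⟩ := differentiableAt_sol hq hz0 hz1 0
  obtain ⟨e1, e2, e3, e4⟩ := differentiableAt_sol hq hz0 hz1 1
  have hW0 : redW (uP q z₀) (vP q z₀) (uM q z₀) (vM q z₀) 0 = 0 := by
    simp only [redW, hfst, hsnd]; ring
  have hμ : Tendsto (fun z => (redMu z - redMu z₀) / (z - z₀)) (𝓝[≠] z₀)
      (𝓝 (-1 + (z₀ ^ 2)⁻¹)) := by
    have hd : HasDerivAt redMu (-1 + (z₀ ^ 2)⁻¹) z₀ := by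
      have : HasDerivAt redMu (-1 - -(z₀ ^ 2)⁻¹) z₀ :=
        ((hasDerivAt_id z₀).const_sub 2).sub (hasDerivAt_inv hz0)
      rwa [sub_neg_eq_add] at this
    refine (hasDerivAt_iff_tendsto_slope.1 hd).congr fun z => ?_
    rw [slope_def_field]
  have sM : Tendsto (fun z => ∑' k : ℕ, uM q z (-k) * uM q z₀ (-k)) (𝓝 z₀)
      (𝓝 (∑' k : ℕ, uM q z₀ (-k) * uM q z₀ (-k))) :=
    tendsto_tsum_mul_of_geometric (f := fun z k => uM q z (-k)) hz1
      (fun z hz k => (hbd z hz k).2.1)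
      fun k => (differentiableAt_sol hq hz0 hz1 _).2.2.1.continuousAt
  have sP : Tendsto (fun z => ∑' k : ℕ, uP q z (k + 1) * uP q z₀ (k + 1)) (𝓝 z₀)
      (𝓝 (∑' k : ℕ, uP q z₀ (k + 1) * uP q z₀ (k + 1))) := by
    refine tendsto_tsum_mul_of_geometric (f := fun z k => uP q z (k + 1)) (C := C) hz1
      (fun z hz k => ?_) fun k => (differentiableAt_sol hq hz0 hz1 _).1.continuousAt
    have := (hbd z hz (k + 1)).1
    push_cast at this
    refine this.trans (mul_le_mul_of_nonneg_left ?_ hC.le)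
    exact pow_le_pow_of_le_one (norm_nonneg _) hz (Nat.le_succ k)
  have hsum : c⁻¹ * ∑' k : ℕ, uM q z₀ (-k) * uM q z₀ (-k)
      + c * ∑' k : ℕ, uP q z₀ (k + 1) * uP q z₀ (k + 1) = c * ∑' n, uP q z₀ n ^ 2 := by
    have s1 : Summable fun n => uP q z₀ n ^ 2 := by
      simpa only [sq] using summable_mul_of_summable_sq hs1 hs1
    rw [tsum_int_split s1, mul_add]
    congr 1
    · have : ∀ k : ℕ, uM q z₀ (-k) * uM q z₀ (-k) = c ^ 2 * uP q z₀ (-k) ^ 2 := fun k => by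
        rw [hfst]; ring
      simp_rw [this]
      rw [tsum_mul_left]
      field_simp
    · simp_rw [sq]
  have hball : Metric.ball (0 : ℂ) 1 ∩ {0}ᶜ ∈ 𝓝[≠] z₀ :=
    mem_nhdsWithin_of_mem_nhds ((Metric.isOpen_ball.inter isOpen_compl_singleton).mem_nhds
      ⟨by simpa using hz1, hz0⟩)
  have hmain := (tendsto_sub_mul_div d1 e4.continuousAt).sub
    (tendsto_sub_mul_div d3 e2.continuousAt)
  have hmain2 := hmain.add (hμ.mul (((sM.mono_left nhdsWithin_le_nhds).const_mul c⁻¹).add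
    ((sP.mono_left nhdsWithin_le_nhds).const_mul c)))
  rw [hsum, sub_zero, zero_add] at hmain2
  refine hmain2.congr' ?_
  filter_upwards [hball] with z hz
  obtain ⟨hz, hzz⟩ := hz
  rw [mem_ball_zero_iff] at hz
  have t1 := tsum_uM_mul hq1 hq (show z ≠ 0 from hzz) hz hz0 hz1
  have t2 := tsum_uP_mul hq1 hq (show z ≠ 0 from hzz) hz hz0 hz1
  have g1 : redW (uP q z₀) (vP q z₀) (uM q z) (vM q z) 0
      = (redMu z - redMu z₀) * (c⁻¹ * ∑' k : ℕ, uM q z (-k) * uM q z₀ (-k)) := by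
    have : redW (uP q z₀) (vP q z₀) (uM q z) (vM q z) 0
        = -c⁻¹ * redW (uM q z) (vM q z) (uM q z₀) (vM q z₀) 0 := by
      simp only [redW, hfst, hsnd]; field_simp; ring
    rw [this, ← t1]; ring
  have g2 : redW (uP q z) (vP q z) (uM q z₀) (vM q z₀) 0
      = (redMu z - redMu z₀) * (c * ∑' k : ℕ, uP q z (k + 1) * uP q z₀ (k + 1)) := by
    have : redW (uP q z) (vP q z) (uM q z₀) (vM q z₀) 0
        = c * redW (uP q z) (vP q z) (uP q z₀) (vP q z₀) 0 := by
      simp only [redW, hfst, hsnd]; ring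
    rw [this]
    linear_combination c * t2
  -- Bilinear expansion about z₀: the products of two increments are of second order and drop out
  -- after division by z - z₀.
  have g3 : jostWt q z = (uP q z 0 - uP q z₀ 0) * (vM q z 1 - vM q z₀ 1)
      - (uM q z 0 - uM q z₀ 0) * (vP q z 1 - vP q z₀ 1)
      + (redW (uP q z₀) (vP q z₀) (uM q z) (vM q z) 0
        + redW (uP q z) (vP q z) (uM q z₀) (vM q z₀) 0
        - redW (uP q z₀) (vP q z₀) (uM q z₀) (vM q z₀) 0) := by
    simp only [jostWt, redW, zero_add]; ring
  rw [g3, g1, g2, hW0]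
  ring

/-- The derivative found above is nonzero because ∑ u² > 0 and |z₀| < 1, so the pole is simple. -/
lemma IsBoundState.tendsto_mul_jostT (hq1 : ∀ n, q n ≠ 1)
    (hq : Summable fun n : ℤ => (1 + |(n : ℝ)|) * |q n|) {z₀ c : ℂ} (h : IsBoundState q z₀ c) :
    Tendsto (fun z => (z - z₀) * jostT q z) (𝓝[≠] z₀)
      (𝓝 (-z₀ / (c * ∑' n, uP q z₀ n ^ 2))) := by
  have hz0 := h.ne_zero
  have hz1 := h.norm_lt_one
  have hS := h.tsum_sq_ne_zero hq1 hq
  have h1z : 1 - z₀ ^ 2 ≠ 0 := by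
    intro h0
    have : ‖z₀ ^ 2‖ = 1 := by rw [← sub_eq_zero.1 h0, norm_one]
    rw [norm_pow] at this
    have := pow_lt_one₀ (norm_nonneg z₀) hz1 two_ne_zero
    linarith
  have hd : (-1 + (z₀ ^ 2)⁻¹ : ℂ) ≠ 0 := by
    intro h0
    apply h1z
    field_simp at h0
    linear_combination h0
  have hL := (h.tendsto_jostWt_div hq1 hq).inv₀ (mul_ne_zero hd (mul_ne_zero h.c_ne_zero hS))
  have hz : Tendsto (fun z : ℂ => z - z⁻¹) (𝓝[≠] z₀) (𝓝 (z₀ - z₀⁻¹)) :=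
    ((continuousAt_id.sub (continuousAt_inv₀ hz0)).tendsto).mono_left nhdsWithin_le_nhds
  have := hz.mul hL
  have e : (z₀ - z₀⁻¹) * ((-1 + (z₀ ^ 2)⁻¹) * (c * ∑' n, uP q z₀ n ^ 2))⁻¹
      = -z₀ / (c * ∑' n, uP q z₀ n ^ 2) := by
    have : (z₀ - z₀⁻¹) = -z₀ * (-1 + (z₀ ^ 2)⁻¹) := by field_simp; ring
    rw [this, mul_inv, div_eq_mul_inv, mul_assoc (-z₀), mul_inv_cancel_left₀ hd]
  rw [e] at this
  refine this.congr' ?_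
  have hball : Metric.ball (0 : ℂ) 1 ∩ {0}ᶜ ∈ 𝓝[≠] z₀ :=
    mem_nhdsWithin_of_mem_nhds ((Metric.isOpen_ball.inter isOpen_compl_singleton).mem_nhds
      ⟨by simpa using hz1, hz0⟩)
  filter_upwards [hball] with z hz
  have hne1 : z ≠ 1 := by
    rintro rfl
    simp at hz
  rw [jostT_eq q hz.2 hne1, inv_div]
  ring

/-- Since ∑ v² = (λ - m)(λ + m) ∑ u² before undoing the rescaling, the full norm is 2λ/(m + λ) ∑ u².
The prefactor in γ is chosen to cancel this. -/
lemma IsBoundState.gammaOf_plus (hm : 0 < m) (hq1 : ∀ n, q n ≠ 1)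
    (hq : Summable fun n : ℤ => (1 + |(n : ℝ)|) * |q n|) {z c : ℂ} (h : IsBoundState q z c) :
    gammaOf m z (jostPlus m q z) = (∑' n, uP q z n ^ 2)⁻¹ ∧
    gammaOf m z (jostMinus m q z) = (c ^ 2 * ∑' n, uP q z n ^ 2)⁻¹ := by
  have hz0 := h.ne_zero
  have hz1 := h.norm_lt_one.le
  have hS := h.tsum_sq_ne_zero hq1 hq
  have hc := h.c_ne_zero
  have hml := add_lam_ne_zero hm z
  have hlam : lam m z ≠ 0 := by
    intro h0
    have h1 := lam_sq m z
    rw [h0] at h1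
    have hre := h.re_neg hq1 hq
    have him := h.im_eq_zero hq1 hq
    have h2 := congrArg Complex.re h1
    simp [Complex.inv_re, ← Complex.ofReal_pow] at h2
    have h3 : z.re / Complex.normSq z ≤ 0 := div_nonpos_of_nonpos_of_nonneg hre.le
      (Complex.normSq_nonneg _)
    nlinarith
  have s1 : Summable fun n => uP q z n ^ 2 := by
    simpa only [sq] using summable_mul_of_summable_sq h.summable_fst h.summable_fst
  have s2 : Summable fun n => vP q z n ^ 2 := by
    simpa only [sq] using summable_mul_of_summable_sq h.summable_snd h.summable_snd
  have hsum : ∑' n, (uP q z n ^ 2 + (vP q z n / (m + lam m z)) ^ 2)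
      = 2 * lam m z / (m + lam m z) * ∑' n, uP q z n ^ 2 := by
    simp_rw [div_pow]
    rw [s1.tsum_add (s2.div_const _), tsum_div_const, h.tsum_snd_sq hq1 hq]
    have hmu : redMu z = (lam m z - m) * (lam m z + m) := by
      have := lam_sq m z
      simp only [redMu]
      linear_combination -this
    rw [hmu]
    field_simp
    ring
  constructor
  · rw [jostPlus_eq hm hq1 hq hz0 hz1, gammaOf]
    dsimp only
    rw [hsum]
    field_simp
  · rw [jostMinus_eq hm hq1 hq hz0 hz1, gammaOf]
    dsimp only
    have : ∀ n, uM q z n ^ 2 + (vM q z n / (m + lam m z)) ^ 2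
        = c ^ 2 * (uP q z n ^ 2 + (vP q z n / (m + lam m z)) ^ 2) := fun n => by
      rw [h.fst, h.snd]; ring
    simp_rw [this]
    rw [tsum_mul_left, hsum]
    field_simp

end Residues

/-! ### Residue calculus with boundary values on the circle. -/

section Contour

open MeasureTheory

lemma exists_differentiableOn_of_removable {U : Set ℂ} (hU : IsOpen U) (S : Finset ℂ) :
    ∀ h : ℂ → ℂ, DifferentiableOn ℂ h (U \ S) → (∀ s ∈ S, s ∈ U) →
      (∀ s ∈ S, Tendsto (fun z => (z - s) * h z) (𝓝[≠] s) (𝓝 0)) →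
      ∃ g : ℂ → ℂ, DifferentiableOn ℂ g U ∧ ∀ z ∉ S, g z = h z := by
  classical
  induction S using Finset.induction_on with
  | empty => exact fun h hd _ _ => ⟨h, by simpa using hd, fun _ _ => rfl⟩
  | insert a S ha ih =>
    intro h hd hSU hlim
    have hopen : IsOpen (U \ S) := hU.sdiff S.finite_toSet.isClosed
    have hmem : U \ S ∈ 𝓝 a := hopen.mem_nhds ⟨hSU a (Finset.mem_insert_self a S), ha⟩
    have hdiff : DifferentiableOn ℂ h ((U \ S) \ {a}) := by
      refine hd.mono fun z hz => ⟨hz.1.1, ?_⟩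
      rw [Finset.coe_insert, Set.mem_insert_iff, not_or]
      exact ⟨hz.2, hz.1.2⟩
    have ho : (fun z => h z - h a) =o[𝓝[≠] a] fun z => (z - a)⁻¹ := by
      refine isLittleO_of_tendsto' ?_ ?_
      · filter_upwards [self_mem_nhdsWithin] with z hz h0
        exact absurd h0 (inv_ne_zero (sub_ne_zero.2 hz))
      · have h1 : Tendsto (fun z => (z - a) * h a) (𝓝[≠] a) (𝓝 0) := by
          have : Tendsto (fun z => (z - a) * h a) (𝓝 a) (𝓝 ((a - a) * h a)) :=
            ((tendsto_id.sub_const a).mul_const _)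
          rw [sub_self, zero_mul] at this
          exact this.mono_left nhdsWithin_le_nhds
        have h2 := (hlim a (Finset.mem_insert_self a S)).sub h1
        rw [sub_zero] at h2
        refine h2.congr fun z => ?_
        rw [div_inv_eq_mul]
        ring
    obtain ⟨g, hg, hgh⟩ := ih (Function.update h a (limUnder (𝓝[≠] a) h))
      (Complex.differentiableOn_update_limUnder_of_isLittleO hmem hdiff ho)
      (fun s hs => hSU s (Finset.mem_insert_of_mem hs)) (fun s hs => by
        refine (hlim s (Finset.mem_insert_of_mem hs)).congr' ?_
        have hne : s ≠ a := fun h => ha (h ▸ hs)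
        filter_upwards [mem_nhdsWithin_of_mem_nhds (isOpen_ne.mem_nhds hne)] with z hz
        rw [Function.update_of_ne hz])
    refine ⟨g, hg, fun z hz => ?_⟩
    rw [Finset.mem_insert, not_or] at hz
    rw [hgh z hz.2, Function.update_of_ne hz.1]

/-- A function on the closed unit disc which is holomorphic inside except for simple poles,
bounded near the unit circle, and has almost everywhere its boundary values there. -/
structure HasSimplePoles (f : ℂ → ℂ) (S : Finset ℂ) (res : ℂ → ℂ) : Prop where
  norm_lt_one : ∀ s ∈ S, ‖s‖ < 1
  differentiableOn : DifferentiableOn ℂ f (Metric.ball 0 1 \ S)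
  tendsto_residue : ∀ s ∈ S, Tendsto (fun z => (z - s) * f z) (𝓝[≠] s) (𝓝 (res s))
  bounded : ∃ ρ < (1 : ℝ), ∃ B : ℝ, ∀ z, ρ ≤ ‖z‖ → ‖z‖ < 1 → ‖f z‖ ≤ B
  continuousWithinAt : ∃ E : Set ℂ, E.Countable ∧
    ∀ z, ‖z‖ = 1 → z ∉ E → ContinuousWithinAt f (Metric.ball 0 1) z

variable {f : ℂ → ℂ} {S : Finset ℂ} {res : ℂ → ℂ}

/-- Subtracting the principal parts leaves removable singularities, to which Cauchy's theorem
applies. -/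
lemma HasSimplePoles.circleIntegral_of_lt (h : HasSimplePoles f S res) {r : ℝ} (hr : r < 1)
    (hr0 : 0 < r) (hS : ∀ s ∈ S, ‖s‖ < r) :
    ∮ z in C(0, r), f z = 2 * Real.pi * Complex.I * ∑ s ∈ S, res s := by
  classical
  have hpole : ∀ s t : ℂ, t ≠ s → ContinuousAt (fun z : ℂ => res s / (z - s)) t := fun s t hts =>
    continuousAt_const.div (continuousAt_id.sub continuousAt_const) (sub_ne_zero.2 hts)
  obtain ⟨g, hg, hgf⟩ := exists_differentiableOn_of_removable (U := Metric.ball (0 : ℂ) 1)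
    Metric.isOpen_ball S (fun z => f z - ∑ s ∈ S, res s / (z - s))
    (h.differentiableOn.sub (DifferentiableOn.fun_sum fun s hs =>
      (differentiableOn_const _).div (differentiableOn_id.sub_const s) fun z hz =>
        sub_ne_zero.2 fun hzs => hz.2 (hzs ▸ hs)))
    (fun s hs => mem_ball_zero_iff.2 (h.norm_lt_one s hs)) (fun s hs => by
      have h1 : Tendsto (fun z => ∑ t ∈ S.erase s, res t / (z - t)) (𝓝[≠] s)
          (𝓝 (∑ t ∈ S.erase s, res t / (s - t))) :=
        (tendsto_finsetSum _ fun t ht =>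
          (hpole t s (Finset.ne_of_mem_erase ht).symm).tendsto).mono_left nhdsWithin_le_nhds
      have h0 : Tendsto (fun z => z - s) (𝓝[≠] s) (𝓝 0) := by
        have : Tendsto (fun z => z - s) (𝓝 s) (𝓝 (s - s)) := tendsto_id.sub_const s
        rw [sub_self] at this
        exact this.mono_left nhdsWithin_le_nhds
      have h2 := ((h.tendsto_residue s hs).sub_const (res s)).sub (h0.mul h1)
      rw [sub_self, zero_mul, sub_zero] at h2
      refine h2.congr' ?_
      filter_upwards [self_mem_nhdsWithin] with z hz
      have hzs : z - s ≠ 0 := sub_ne_zero.2 hz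
      rw [← Finset.add_sum_erase S _ hs, mul_sub, mul_add, mul_div_cancel₀ _ hzs]
      ring)
  have hsphere : ∀ z ∈ Metric.sphere (0 : ℂ) r, z ∉ S := fun z hz hzS => by
    rw [mem_sphere_zero_iff_norm] at hz
    exact (hS z hzS).ne hz
  have hcb : Metric.closedBall (0 : ℂ) r ⊆ Metric.ball 0 1 := Metric.closedBall_subset_ball hr
  have hgint : ∮ z in C(0, r), g z = 0 :=
    Complex.circleIntegral_eq_zero_of_differentiable_on_off_countable hr0.le Set.countable_empty
      (hg.continuousOn.mono hcb) fun z hz => hg.differentiableAt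
        (Metric.isOpen_ball.mem_nhds (hcb (Metric.ball_subset_closedBall hz.1)))
  have e : ∮ z in C(0, r), f z = ∮ z in C(0, r), (g z + ∑ s ∈ S, res s * (z - s)⁻¹) :=
    circleIntegral.integral_congr hr0.le fun z hz => by
      rw [hgf z (hsphere z hz)]
      simp only [div_eq_mul_inv]
      ring
  have hpint : ∀ s ∈ S, CircleIntegrable (fun z => res s * (z - s)⁻¹) 0 r := fun s hs => by
    refine ContinuousOn.circleIntegrable hr0.le fun z hz => ?_
    have := hpole s z fun hzs => hsphere z hz (hzs ▸ hs)
    simp only [div_eq_mul_inv] at this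
    exact this.continuousWithinAt
  rw [e, circleIntegral.integral_add
    ((hg.continuousOn.mono (Metric.sphere_subset_closedBall.trans hcb)).circleIntegrable hr0.le)
    (CircleIntegrable.fun_sum S hpint), hgint, zero_add, circleIntegral.integral_fun_sum hpint,
    Finset.mul_sum]
  refine Finset.sum_congr rfl fun s hs => ?_
  rw [circleIntegral.integral_const_mul,
    circleIntegral.integral_sub_inv_of_mem_ball (by simpa using hS s hs)]
  ring

/-- The integrals over |z| = r are constant for r near 1. Boundedness near the circle and boundary
values off a countable set permit the limit r → 1 by dominated convergence. -/
lemma HasSimplePoles.circleIntegral_eq (h : HasSimplePoles f S res) :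
    ∮ z in C(0, 1), f z = 2 * Real.pi * Complex.I * ∑ s ∈ S, res s := by
  obtain ⟨ρ, hρ, B, hB⟩ := h.bounded
  obtain ⟨E, hE, hcont⟩ := h.continuousWithinAt
  have hS : ∀ᶠ r : ℝ in 𝓝[<] 1, ∀ s ∈ S, ‖s‖ < r :=
    (Filter.eventually_all_finset S).2 fun s hs =>
      mem_nhdsWithin_of_mem_nhds (lt_mem_nhds (h.norm_lt_one s hs))
  have hr1 : ∀ᶠ r : ℝ in 𝓝[<] 1, r < 1 ∧ max ρ 0 < r :=
    eventually_mem_nhdsWithin.and (mem_nhdsWithin_of_mem_nhds (lt_mem_nhds (max_lt hρ one_pos)))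
  have h1 : Tendsto (fun r : ℝ => ∮ z in C(0, r), f z) (𝓝[<] 1)
      (𝓝 (2 * Real.pi * Complex.I * ∑ s ∈ S, res s)) := by
    refine tendsto_const_nhds.congr' ?_
    filter_upwards [hS, hr1] with r hSr hr
    exact (h.circleIntegral_of_lt hr.1 ((le_max_right _ _).trans_lt hr.2) hSr).symm
  refine tendsto_nhds_unique ?_ h1
  simp only [circleIntegral]
  refine intervalIntegral.tendsto_integral_filter_of_dominated_convergence (fun _ => |B|) ?_ ?_
    intervalIntegrable_const ?_
  · filter_upwards [hS, hr1] with r hSr hr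
    have hr0 : 0 < r := (le_max_right _ _).trans_lt hr.2
    have hc : Continuous fun θ => f (circleMap 0 r θ) := by
      refine continuous_iff_continuousAt.2 fun θ => ?_
      have hn : ‖circleMap 0 r θ‖ = r := by rw [norm_circleMap_zero, abs_of_pos hr0]
      have hmem : Metric.ball (0 : ℂ) 1 \ S ∈ 𝓝 (circleMap 0 r θ) :=
        (Metric.isOpen_ball.sdiff S.finite_toSet.isClosed).mem_nhds
          ⟨by rw [mem_ball_zero_iff, hn]; exact hr.1, fun hs => (hSr _ hs).ne hn⟩
      exact ContinuousAt.comp (f := circleMap 0 r)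
        (h.differentiableOn.continuousOn.continuousAt hmem) (continuous_circleMap 0 r).continuousAt
    have hd : Continuous fun θ => deriv (circleMap 0 r) θ := by
      simp only [deriv_circleMap]
      exact (continuous_circleMap 0 r).mul continuous_const
    exact (hd.smul hc).aestronglyMeasurable
  · filter_upwards [hr1] with r hr
    refine Eventually.of_forall fun θ _ => ?_
    have hr0 : 0 < r := (le_max_right _ _).trans_lt hr.2
    have hn : ‖circleMap 0 r θ‖ = r := by rw [norm_circleMap_zero, abs_of_pos hr0]
    rw [norm_smul, deriv_circleMap, norm_mul, hn, Complex.norm_I, mul_one]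
    have := hB (circleMap 0 r θ) (by rw [hn]; exact (le_max_left _ _).trans hr.2.le)
      (by rw [hn]; exact hr.1)
    exact (mul_le_of_le_one_left (norm_nonneg _) hr.1.le).trans (this.trans (le_abs_self B))
  · have : (circleMap 0 1 ⁻¹' E).Countable := hE.preimage_circleMap 0 one_ne_zero
    filter_upwards [this.ae_notMem volume] with θ hθ _
    have hcm : Tendsto (fun r : ℝ => circleMap 0 r θ) (𝓝[<] 1) (𝓝 (circleMap 0 1 θ)) := by
      have : Continuous fun r : ℝ => circleMap 0 r θ := by
        simp only [circleMap]
        fun_prop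
      exact (this.tendsto 1).mono_left nhdsWithin_le_nhds
    have hcm' : Tendsto (fun r : ℝ => circleMap 0 r θ) (𝓝[<] 1)
        (𝓝[Metric.ball 0 1] (circleMap 0 1 θ)) := by
      refine tendsto_nhdsWithin_iff.2 ⟨hcm, ?_⟩
      filter_upwards [hr1] with r hr
      have hr0 : 0 < r := (le_max_right _ _).trans_lt hr.2
      rw [mem_ball_zero_iff, norm_circleMap_zero, abs_of_pos hr0]
      exact hr.1
    simp only [deriv_circleMap, smul_eq_mul]
    exact (hcm.mul_const _).mul ((hcont _ (norm_circleMap_one θ) hθ).tendsto.comp hcm')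

lemma HasSimplePoles.mul (h : HasSimplePoles f S res) {φ : ℂ → ℂ}
    (hd : DifferentiableOn ℂ φ (Metric.ball 0 1))
    (hc : ContinuousOn φ (Metric.closedBall 0 1)) :
    HasSimplePoles (fun z => f z * φ z) S (fun s => res s * φ s) := by
  obtain ⟨ρ, hρ, B, hB⟩ := h.bounded
  obtain ⟨E, hE, hcont⟩ := h.continuousWithinAt
  obtain ⟨D, hD⟩ := (isCompact_closedBall (0 : ℂ) 1).exists_bound_of_continuousOn hc
  refine ⟨h.norm_lt_one, h.differentiableOn.mul (hd.mono Set.sdiff_subset), fun s hs => ?_,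
    ⟨ρ, hρ, B * D, fun z hz hz1 => ?_⟩, E, hE, fun z hz hzE => ?_⟩
  · have := (h.tendsto_residue s hs).mul ((hd.differentiableAt (Metric.isOpen_ball.mem_nhds
      (mem_ball_zero_iff.2 (h.norm_lt_one s hs)))).continuousAt.tendsto.mono_left
        nhdsWithin_le_nhds)
    exact this.congr fun z => by ring
  · rw [norm_mul]
    have h1 := hB z hz hz1
    exact mul_le_mul h1 (hD z (mem_closedBall_zero_iff.2 hz1.le)) (norm_nonneg _)
      ((norm_nonneg _).trans h1)
  · exact (hcont z hz hzE).mul ((hc z (mem_closedBall_zero_iff.2 hz.le)).mono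
      Metric.ball_subset_closedBall)

/-- Division by z may create a pole at 0 or, when f(0) = 0, may not. The separate pole set `T`
serves both cases. -/
lemma HasSimplePoles.of_mul_id {g : ℂ → ℂ} (h : HasSimplePoles f S res) (hg : ∀ z ≠ 0, g z = f z / z)
    {T : Finset ℂ} {res' : ℂ → ℂ} (hTS : ∀ s, s ∈ T → s = 0 ∨ s ∈ S) (hST : ∀ s ∈ S, s ∈ T)
    (hd : 0 ∉ T → DifferentiableAt ℂ g 0)
    (h0 : 0 ∈ T → Tendsto (fun z => (z - 0) * g z) (𝓝[≠] 0) (𝓝 (res' 0)))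
    (hres : ∀ s ∈ S, s ≠ 0 → res' s = res s / s) : HasSimplePoles g T res' := by
  obtain ⟨ρ, hρ, B, hB⟩ := h.bounded
  obtain ⟨E, hE, hcont⟩ := h.continuousWithinAt
  have hS0 : IsOpen (Metric.ball (0 : ℂ) 1 \ S) :=
    Metric.isOpen_ball.sdiff S.finite_toSet.isClosed
  have heq : ∀ z ≠ (0 : ℂ), g =ᶠ[𝓝 z] fun z => f z / z := fun z hz => by
    filter_upwards [isOpen_ne.mem_nhds hz] with w hw using hg w hw
  refine ⟨fun s hs => ?_, fun z hz => ?_, fun s hs => ?_,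
    ⟨max ρ (1 / 2), max_lt hρ (by norm_num), B * 2, fun z hz hz1 => ?_⟩, E, hE, fun z hz hzE => ?_⟩
  · rcases hTS s hs with rfl | hs
    · simp
    · exact h.norm_lt_one s hs
  · refine DifferentiableAt.differentiableWithinAt ?_
    by_cases hz0 : z = 0
    · subst hz0
      exact hd hz.2
    · have hzS : z ∉ S := fun hs => hz.2 (hST z hs)
      exact ((h.differentiableOn.differentiableAt (hS0.mem_nhds ⟨hz.1, hzS⟩)).div
        differentiableAt_id hz0).congr_of_eventuallyEq (heq z hz0)
  · by_cases hs0 : s = 0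
    · subst hs0
      exact h0 hs
    · have hsS := (hTS s hs).resolve_left hs0
      rw [hres s hsS hs0]
      refine Tendsto.congr' ?_ ((h.tendsto_residue s hsS).div
        (tendsto_id.mono_left nhdsWithin_le_nhds) hs0)
      filter_upwards [mem_nhdsWithin_of_mem_nhds (isOpen_ne.mem_nhds hs0)] with w hw
      simp only [Pi.div_apply, id]
      rw [hg w hw, mul_div_assoc]
  · have hz2 : 1 / 2 ≤ ‖z‖ := (le_max_right _ _).trans hz
    have hz0 : z ≠ 0 := norm_pos_iff.1 (by linarith)
    have h1 := hB z ((le_max_left _ _).trans hz) hz1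
    rw [hg z hz0, norm_div, div_eq_mul_inv]
    refine mul_le_mul h1 ?_ (by positivity) ((norm_nonneg _).trans h1)
    rw [inv_le_comm₀ (by linarith) two_pos]
    linarith
  · have hz0 : z ≠ 0 := norm_pos_iff.1 (by rw [hz]; exact one_pos)
    exact ((hcont z hz hzE).div continuousWithinAt_id hz0).congr_of_eventuallyEq
      ((heq z hz0).filter_mono nhdsWithin_le_nhds) (hg z hz0)

/-- The moments of order at least `-1` of the boundary values of a function with simple poles. -/
lemma HasSimplePoles.circleMoment_eq (h : HasSimplePoles f S res) (hS0 : 0 ∉ S)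
    (hf : CircleIntegrable f 0 1) {k : ℤ} (hk : -1 ≤ k) :
    circleMoment f k = ∑ s ∈ S, res s * s ^ (k - 1)
      + (if k = 0 then f 0 else 0) + (if k = -1 then deriv f 0 else 0) := by
  classical
  have h2 : (2 * (Real.pi : ℂ) * Complex.I) ≠ 0 := Complex.two_pi_I_ne_zero
  have hne : ∀ s ∈ S, s ≠ 0 := fun s hs h => hS0 (h ▸ hs)
  have hcirc : ∀ z ∈ Metric.sphere (0 : ℂ) 1, z ≠ 0 := fun z hz h0 => by
    rw [h0] at hz; simp at hz
  have hdiff : ∀ {g : ℂ → ℂ} {r : ℂ → ℂ}, HasSimplePoles g S r → DifferentiableAt ℂ g 0 :=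
    fun hg => hg.differentiableOn.differentiableAt
      ((Metric.isOpen_ball.sdiff S.finite_toSet.isClosed).mem_nhds ⟨by simp, hS0⟩)
  have key : ∀ {g : ℂ → ℂ} {r : ℂ → ℂ}, HasSimplePoles g S r →
      circleMoment g 0 = ∑ s ∈ S, r s / s + g 0 := fun {g r} hg => by
    have h1 : HasSimplePoles (fun z => g z / z) (insert 0 S)
        (fun s => if s = 0 then g 0 else r s / s) := by
      refine hg.of_mul_id (fun _ _ => rfl) (fun s hs => Finset.mem_insert.1 hs)
        (fun s hs => Finset.mem_insert_of_mem hs)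
        (fun h => absurd (Finset.mem_insert_self 0 S) h) (fun _ => ?_)
        (fun s _ hs => if_neg hs)
      rw [if_pos rfl]
      refine ((hdiff hg).continuousAt.tendsto.mono_left nhdsWithin_le_nhds).congr' ?_
      filter_upwards [self_mem_nhdsWithin] with z hz
      rw [sub_zero, mul_div_cancel₀ _ hz]
    have h3 := h1.circleIntegral_eq
    rw [Finset.sum_insert hS0, if_pos rfl] at h3
    have h4 : ∑ s ∈ S, (if s = 0 then g 0 else r s / s) = ∑ s ∈ S, r s / s :=
      Finset.sum_congr rfl fun s hs => if_neg (hne s hs)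
    unfold circleMoment
    simp only [zpow_zero, mul_one]
    rw [h3, h4, inv_mul_cancel_left₀ h2, add_comm]
  rcases (show k = -1 ∨ k = 0 ∨ 1 ≤ k by omega) with rfl | rfl | hk1
  -- For k = -1 the double pole of f/z² at 0 is avoided by subtracting f(0), whose moment of order
  -- -1 vanishes, and treating the quotient `dslope f 0` as in the case k = 0.
  · have h1 : HasSimplePoles (fun z => f z - f 0) S res := by
      obtain ⟨ρ, hρ, B, hB⟩ := h.bounded
      obtain ⟨E, hE, hcont⟩ := h.continuousWithinAt
      refine ⟨h.norm_lt_one, h.differentiableOn.sub_const _, fun s hs => ?_,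
        ⟨ρ, hρ, B + ‖f 0‖, fun z hz hz1 => (norm_sub_le _ _).trans (by
          gcongr; exact hB z hz hz1)⟩,
        E, hE, fun z hz hzE => (hcont z hz hzE).sub continuousWithinAt_const⟩
      have ht : Tendsto (fun z => (z - s) * f 0) (𝓝[≠] s) (𝓝 ((s - s) * f 0)) :=
        ((tendsto_id.sub_const s).mul_const _).mono_left nhdsWithin_le_nhds
      have := (h.tendsto_residue s hs).sub ht
      rw [sub_self, zero_mul, sub_zero] at this
      exact this.congr fun z => by ring
    have h3 : HasSimplePoles (dslope f 0) S (fun s => res s / s) := by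
      refine h1.of_mul_id (fun z hz => ?_) (fun s hs => Or.inr hs) (fun s hs => hs) (fun _ => ?_)
        (fun h => absurd h hS0) (fun s _ _ => rfl)
      · rw [dslope_of_ne _ hz, slope_def_field, sub_zero]
      · have hn : Metric.ball (0 : ℂ) 1 \ S ∈ 𝓝 (0 : ℂ) :=
          (Metric.isOpen_ball.sdiff S.finite_toSet.isClosed).mem_nhds ⟨by simp, hS0⟩
        exact ((Complex.differentiableOn_dslope hn).2 h.differentiableOn).differentiableAt hn
    have h4 : circleMoment f (-1) = circleMoment (dslope f 0) 0 := by
      have e1 : circleMoment (dslope f 0) 0 = circleMoment (fun z => z ^ (-1 : ℤ) *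
          (f z - f 0)) 0 := circleMoment_congr' (fun z hz => by
        have hz0 : z ≠ 0 := norm_pos_iff.1 (by rw [hz]; exact one_pos)
        rw [dslope_of_ne _ hz0, slope_def_field, sub_zero, zpow_neg_one]
        ring) 0
      have e2 : circleMoment (fun _ : ℂ => f 0) (-1) = 0 := by
        have := circleMoment_const_mul (f 0) (fun _ => 1) (-1)
        rw [circleMoment_one] at this
        simpa using this
      rw [e1, circleMoment_zpow_mul, add_zero,
        circleMoment_sub hf (continuousOn_const.circleIntegrable zero_le_one), e2, sub_zero]
    rw [h4, key h3, dslope_same, if_neg (by norm_num), if_pos rfl, add_zero]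
    congr 1
    refine Finset.sum_congr rfl fun s hs => ?_
    have := hne s hs
    rw [show (-1 - 1 : ℤ) = -2 by norm_num, zpow_neg]
    field_simp
  · rw [key h, if_pos rfl, if_neg (by norm_num), add_zero]
    simp only [zero_sub, zpow_neg_one, div_eq_mul_inv]
  · obtain ⟨j, rfl⟩ : ∃ j : ℕ, k = j + 1 := ⟨(k - 1).toNat, by omega⟩
    have h1 := (h.mul (φ := fun z => z ^ j) (by fun_prop) (by fun_prop)).circleIntegral_eq
    rw [if_neg (by omega), if_neg (by omega), add_zero, add_zero]
    have h3 : ∮ z in C(0, 1), f z * z ^ ((j : ℤ) + 1) / z = ∮ z in C(0, 1), f z * z ^ j :=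
      circleIntegral.integral_congr zero_le_one fun z hz => by
        have := hcirc z hz
        rw [zpow_add_one₀ this, zpow_natCast]
        field_simp
    unfold circleMoment
    rw [h3, h1, inv_mul_cancel_left₀ h2]
    simp

end Contour

/-! ### From scattering relations to Marchenko equations. -/

section MomentEquations

open MeasureTheory

/-- The moments of `R` together with the contribution of finitely many poles. -/
noncomputable def poleMoment (R : ℂ → ℂ) (S : Finset ℂ) (γ : ℂ → ℂ) (k : ℤ) : ℂ :=
  circleMoment R k + ∑ l ∈ S, γ l * l ^ k

lemma norm_poleMoment_le {R : ℂ → ℂ} {S : Finset ℂ} {γ : ℂ → ℂ} {B : ℝ}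
    (hB : ∀ z, ‖z‖ = 1 → ‖R z‖ ≤ B) (hS : ∀ l ∈ S, l ≠ 0 ∧ ‖l‖ < 1) (k : ℤ) :
    ∃ C, ∀ n, k ≤ n → ‖poleMoment R S γ n‖ ≤ C := by
  refine ⟨B + ∑ l ∈ S, ‖γ l * l ^ k‖, fun n hn => ?_⟩
  refine (norm_add_le _ _).trans (add_le_add (norm_circleMoment_le hB n)
    ((norm_sum_le _ _).trans (Finset.sum_le_sum fun l hl => ?_)))
  obtain ⟨h0, h1⟩ := hS l hl
  rw [norm_mul, norm_mul, norm_zpow, norm_zpow]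
  exact mul_le_mul_of_nonneg_left
    (zpow_le_zpow_right_of_le_one₀ (norm_pos_iff.2 h0) h1.le hn) (norm_nonneg _)

lemma IsWiener.hasSum_poleMoment {c : ℕ → ℂ} {Ψ : ℂ → ℂ} (h : IsWiener c Ψ) {R : ℂ → ℂ}
    (hR : CircleIntegrable R 0 1) {B : ℝ} (hB : ∀ z, ‖z‖ = 1 → ‖R z‖ ≤ B) {S : Finset ℂ}
    (hS : ∀ l ∈ S, l ≠ 0 ∧ ‖l‖ < 1) (γ : ℂ → ℂ) (N : ℤ) :
    HasSum (fun p : ℕ => poleMoment R S γ (N + p) * c p)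
      (circleMoment (fun z => R z * Ψ z) N + ∑ l ∈ S, γ l * l ^ N * Ψ l) := by
  have h2 : HasSum (fun p : ℕ => ∑ l ∈ S, γ l * l ^ N * (c p * l ^ p))
      (∑ l ∈ S, γ l * l ^ N * Ψ l) :=
    hasSum_sum fun l hl => (h.hasSum l (hS l hl).2.le).mul_left _
  refine hasSum_of_eq ((h.hasSum_circleMoment hR hB N).add h2) (fun p => ?_) rfl
  rw [poleMoment, add_mul, Finset.sum_mul]
  congr 1
  refine Finset.sum_congr rfl fun l hl => ?_
  rw [zpow_add₀ (hS l hl).1, zpow_natCast]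
  ring

lemma circleIntegrable_congr {f g : ℂ → ℂ} {E : Set ℂ} (hE : E.Countable)
    (h : ∀ z, ‖z‖ = 1 → z ∉ E → f z = g z) (hf : CircleIntegrable f 0 1) :
    CircleIntegrable g 0 1 := by
  have : (circleMap 0 1 ⁻¹' E).Countable := hE.preimage_circleMap 0 one_ne_zero
  refine IntervalIntegrable.congr_ae hf ((ae_restrict_of_ae (this.ae_notMem volume)).mono ?_)
  intro θ hθ
  exact h _ (norm_circleMap_one θ) hθ

/-- A scattering relation on the unit circle turns into a Marchenko equation for the
Fourier coefficients. -/
lemma marchenko_of_scattering {ψ φ : ℕ → ℂ} {Ψ Φ R T res γ : ℂ → ℂ} {S : Finset ℂ} {B : ℝ}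
    {N : ℤ} {s a : ℂ} (hΨ : IsWiener ψ Ψ) (hΦ : IsWiener φ Φ) (hR : CircleIntegrable R 0 1)
    (hB : ∀ z, ‖z‖ = 1 → ‖R z‖ ≤ B) (hS : ∀ l ∈ S, l ≠ 0 ∧ ‖l‖ < 1) (hT : HasSimplePoles T S res)
    (hcirc : ∀ z, ‖z‖ = 1 → z ≠ 1 → z ≠ -1 →
      T z * (a * Φ z) = Ψ z⁻¹ + s * (R z * (z ^ N * Ψ z)))
    (hres : ∀ l ∈ S, res l * (a * Φ l) = -(s * γ l * l ^ (N + 1) * Ψ l)) {j : ℤ} (hj : -1 ≤ j) :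
    Summable (fun p : ℕ => poleMoment R S γ (N + p + j) * ψ p) ∧
    intCoeff ψ j + s * ∑' p : ℕ, poleMoment R S γ (N + p + j) * ψ p
      = a * (T 0 * φ 0 * kron j 0 + (deriv T 0 * φ 0 + T 0 * φ 1) * kron j (-1)) := by
  have hsum : HasSum (fun p : ℕ => poleMoment R S γ (N + p + j) * ψ p)
      (circleMoment (fun z => R z * Ψ z) (N + j) + ∑ l ∈ S, γ l * l ^ (N + j) * Ψ l) :=
    hasSum_of_eq (hΨ.hasSum_poleMoment hR hB hS γ (N + j))
      (fun p => by rw [add_right_comm]) rfl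
  refine ⟨hsum.summable, ?_⟩
  rw [hsum.tsum_eq]
  have hS0 : (0 : ℂ) ∉ S := fun h => (hS 0 h).1 rfl
  have hTΦ : HasSimplePoles (fun z => T z * (a * Φ z)) S (fun l => res l * (a * Φ l)) :=
    hT.mul (hΦ.differentiableOn.const_mul a) (continuousOn_const.mul hΦ.continuousOn)
  set E : Set ℂ := {1, -1} with hE
  have hEc : E.Countable := (Set.countable_singleton (-1)).insert 1
  have hEmem : ∀ z ∉ E, z ≠ 1 ∧ z ≠ -1 := fun z hz =>
    ⟨fun h => hz (Or.inl h), fun h => hz (Or.inr h)⟩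
  have hΨs : ContinuousOn Ψ (Metric.sphere 0 1) :=
    hΨ.continuousOn.mono Metric.sphere_subset_closedBall
  have i1 : CircleIntegrable (fun z => Ψ z⁻¹) 0 1 :=
    (continuousOn_inv_sphere hΨs).circleIntegrable zero_le_one
  have i3 : CircleIntegrable (fun z => R z * (z ^ N * Ψ z)) 0 1 := by
    have hc : Continuous fun θ => circleMap 0 1 θ ^ N * Ψ (circleMap 0 1 θ) :=
      ((continuous_circleMap 0 1).zpow₀ N fun θ => Or.inl (circleMap_zero_one_ne_zero θ)).mul
        (hΨs.comp_continuous (continuous_circleMap 0 1)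
          fun θ => circleMap_mem_sphere 0 zero_le_one θ)
    exact IntervalIntegrable.mul_continuousOn hR hc.continuousOn
  have i2 : CircleIntegrable (fun z => s * (R z * (z ^ N * Ψ z))) 0 1 :=
    IntervalIntegrable.const_mul i3 s
  have hint : CircleIntegrable (fun z => T z * (a * Φ z)) 0 1 :=
    circleIntegrable_congr hEc (fun z hz hzE => by
      obtain ⟨h1, h2⟩ := hEmem z hzE
      exact (hcirc z hz h1 h2).symm) (i1.add i2)
  have m1 := hTΦ.circleMoment_eq hS0 hint hj
  have m2 : circleMoment (fun z => T z * (a * Φ z)) j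
      = intCoeff ψ j + s * circleMoment (fun z => R z * Ψ z) (N + j) := by
    rw [circleMoment_congr hEc (fun z hz hzE => by
      obtain ⟨h1, h2⟩ := hEmem z hzE
      exact hcirc z hz h1 h2) j, circleMoment_add i1 i2, hΨ.circleMoment_comp_inv,
      circleMoment_const_mul, ← circleMoment_zpow_mul]
    congr 3
    funext z
    ring
  have hTd : DifferentiableAt ℂ T 0 := hT.differentiableOn.differentiableAt
    ((Metric.isOpen_ball.sdiff S.finite_toSet.isClosed).mem_nhds ⟨by simp, hS0⟩)
  have hd : deriv (fun z => T z * (a * Φ z)) 0 = a * (deriv T 0 * φ 0 + T 0 * φ 1) := by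
    have := hTd.hasDerivAt.mul (hΦ.deriv_zero.const_mul a)
    rw [hΦ.eval_zero] at this
    rw [show (fun z => T z * (a * Φ z)) = T * fun z => a * Φ z from rfl, this.deriv]
    ring
  -- The residues of T Φ match, up to the sign built into `hres`, the pole part of `poleMoment`; the
  -- norming constants enter the kernel for this reason.
  have hrs : ∑ l ∈ S, res l * (a * Φ l) * l ^ (j - 1)
      = -(s * ∑ l ∈ S, γ l * l ^ (N + j) * Ψ l) := by
    rw [Finset.mul_sum, ← Finset.sum_neg_distrib]
    refine Finset.sum_congr rfl fun l hl => ?_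
    have e : l ^ (N + j) = l ^ (N + 1) * l ^ (j - 1) := by
      rw [← zpow_add₀ (hS l hl).1]
      congr 1
      ring
    rw [hres l hl, e]
    generalize l ^ (N + 1) = x
    ring
  rw [m2, hrs, hd, hΦ.eval_zero] at m1
  simp only [kron]
  have e1 : (if j = 0 then T 0 * (a * φ 0) else 0) = a * (T 0 * φ 0 * if j = 0 then 1 else 0) := by
    split_ifs <;> ring
  have e2 : (if j = -1 then a * (deriv T 0 * φ 0 + T 0 * φ 1) else 0)
      = a * ((deriv T 0 * φ 0 + T 0 * φ 1) * if j = -1 then 1 else 0) := by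
    split_ifs <;> ring
  rw [e1, e2] at m1
  linear_combination m1

variable {m : ℝ} {q : ℤ → ℝ}

/-- The zeros of `jostV` in the punctured unit disc, as a finite set. -/
noncomputable def jostZerosFinset (hq1 : ∀ n, q n ≠ 1)
    (hq : Summable fun n : ℤ => (1 + |(n : ℝ)|) * |q n|) : Finset ℂ :=
  (finite_jostZeros hq1 hq).toFinset

lemma mem_jostZerosFinset {hq1 : ∀ n, q n ≠ 1}
    {hq : Summable fun n : ℤ => (1 + |(n : ℝ)|) * |q n|} {z : ℂ} :
    z ∈ jostZerosFinset hq1 hq ↔ z ≠ 0 ∧ ‖z‖ < 1 ∧ jostV q z = 0 := by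
  rw [jostZerosFinset, Set.Finite.mem_toFinset]
  rfl

lemma hasSimplePoles_jostT (hq1 : ∀ n, q n ≠ 1)
    (hq : Summable fun n : ℤ => (1 + |(n : ℝ)|) * |q n|) :
    HasSimplePoles (jostT q) (jostZerosFinset hq1 hq)
      (fun l => limUnder (𝓝[≠] l) fun z => (z - l) * jostT q z) := by
  obtain ⟨ρ, B, hρ0, hρ1, hB⟩ := exists_bound_jostT hq1 hq
  refine ⟨fun s hs => (mem_jostZerosFinset.1 hs).2.1, fun z hz => ?_, fun s hs => ?_,
    ⟨ρ, hρ1, B, fun z hz hz1 => (hB z hz hz1).2⟩, {1, -1},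
    (Set.countable_singleton (-1)).insert 1, fun z hz hzE => ?_⟩
  · obtain ⟨hz1, hzS⟩ := hz
    have hV : jostV q z ≠ 0 := fun h0 => by
      rcases eq_or_ne z 0 with rfl | hz0
      · exact jostV_zero_ne_zero hq1 hq h0
      · exact hzS (mem_jostZerosFinset.2 ⟨hz0, mem_ball_zero_iff.1 hz1, h0⟩)
    exact (((differentiableAt_id.const_add 1).div ((jostV_differentiableOn hq).differentiableAt
      (Metric.isOpen_ball.mem_nhds hz1)) hV)).differentiableWithinAt
  · obtain ⟨h0, h1, h2⟩ := mem_jostZerosFinset.1 hs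
    obtain ⟨c, hc⟩ := exists_isBoundState hq1 hq h0 h1 h2
    exact tendsto_nhds_limUnder ⟨_, hc.tendsto_mul_jostT hq1 hq⟩
  · have h1 : z ≠ 1 := fun h => hzE (Or.inl h)
    have h2 : z ≠ -1 := fun h => hzE (Or.inr h)
    have hz0 := ne_zero_of_norm_eq_one hz
    have hV : jostV q z ≠ 0 := fun h0 => jostWt_ne_zero_of_circle hq1 hq hz h1 h2 (by
      rw [jostWt_eq q hz0, h0, mul_zero])
    exact (continuousWithinAt_const.add continuousWithinAt_id).div
      (((jostV_continuousOn hq) z (mem_closedBall_zero_iff.2 hz.le)).mono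
        Metric.ball_subset_closedBall) hV

/-- The norming constant `γ⁺`. -/
noncomputable def normPlus (m : ℝ) (q : ℤ → ℝ) (z : ℂ) : ℂ := gammaOf m z (jostPlus m q z)

/-- The norming constant `γ⁻`. -/
noncomputable def normMinus (m : ℝ) (q : ℤ → ℝ) (z : ℂ) : ℂ := gammaOf m z (jostMinus m q z)

lemma glmPlus_eq (hm : 0 < m) (hq1 : ∀ n, q n ≠ 1)
    (hq : Summable fun n : ℤ => (1 + |(n : ℝ)|) * |q n|) (n : ℤ) :
    glmPlus m q n = poleMoment (reflPlus m q) (jostZerosFinset hq1 hq) (normPlus m q) n := by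
  have : eigenPoints m q = ↑(jostZerosFinset hq1 hq) := by
    rw [eigenPoints_eq hm hq1 hq, jostZerosFinset, Set.Finite.coe_toFinset]; rfl
  rw [glmPlus, poleMoment, this, finsum_mem_coe_finset]
  rfl

lemma glmMinus_eq (hm : 0 < m) (hq1 : ∀ n, q n ≠ 1)
    (hq : Summable fun n : ℤ => (1 + |(n : ℝ)|) * |q n|) (n : ℤ) :
    glmMinus m q n = poleMoment (reflMinus m q) (jostZerosFinset hq1 hq) (normMinus m q) (-n) := by
  have : eigenPoints m q = ↑(jostZerosFinset hq1 hq) := by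
    rw [eigenPoints_eq hm hq1 hq, jostZerosFinset, Set.Finite.coe_toFinset]; rfl
  rw [glmMinus, poleMoment, this, finsum_mem_coe_finset]
  rfl

/-- At a bound state w⁻ = c w⁺ rewrites the functions of one side through those of the other. The
residue -l/(c ∑ u²), multiplied or divided by c as the side requires, then becomes a norming
constant times -l. -/
lemma residue_relations (hm : 0 < m) (hq1 : ∀ n, q n ≠ 1)
    (hq : Summable fun n : ℤ => (1 + |(n : ℝ)|) * |q n|) {l : ℂ}
    (hl : l ∈ jostZerosFinset hq1 hq) (n : ℤ) {r : ℂ}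
    (hr : r = limUnder (𝓝[≠] l) fun z => (z - l) * jostT q z) :
    r * ((1 - q n : ℂ)⁻¹ * jostGm q n l) = -(normPlus m q l * l ^ (2 * n + 1) * jostF q n l) ∧
    r * ((1 - q n) * jostFm q n l) = normPlus m q l * l ^ (2 * n) * jostG q n l ∧
    r * ((1 - q n) * jostF q n l) = -(normMinus m q l * l ^ (-(2 * n) + 1) * jostGm q n l) ∧
    r * ((1 - q n : ℂ)⁻¹ * jostG q n l) = normMinus m q l * l ^ (2 - 2 * n) * jostFm q n l := by
  obtain ⟨h0, h1, h2⟩ := mem_jostZerosFinset.1 hl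
  obtain ⟨c, hc⟩ := exists_isBoundState hq1 hq h0 h1 h2
  have hS := hc.tsum_sq_ne_zero hq1 hq
  have hc0 := hc.c_ne_zero
  obtain ⟨g1, g2⟩ := hc.gammaOf_plus hm hq1 hq
  rw [(hc.tendsto_mul_jostT hq1 hq).limUnder_eq] at hr
  have hqn := one_sub_ne_zero_of_ne hq1 n
  have hpow := zpow_ne_zero n h0
  have hl1 : l - 1 ≠ 0 := sub_ne_zero.2 fun h => by rw [h] at h1; simp at h1
  have e1 : (1 - q n : ℂ)⁻¹ * jostGm q n l = c * (l ^ n) ^ 2 * jostF q n l := by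
    have := hc.fst n
    rw [uM, uP, zpow_neg] at this
    field_simp at this ⊢
    linear_combination this
  have e2 : (1 - q n : ℂ) * jostFm q n l = -(c * (l ^ n) ^ 2 * l⁻¹ * jostG q n l) := by
    have := hc.snd n
    rw [vM, vP, zpow_neg] at this
    field_simp at this ⊢
    refine mul_left_cancel₀ hl1 ?_
    linear_combination this
  have p1 : l ^ (2 * n + 1) = (l ^ n) ^ 2 * l := by
    rw [zpow_add_one₀ h0, mul_comm 2 n, zpow_mul, zpow_ofNat]
  have p2 : l ^ (2 * n) = (l ^ n) ^ 2 := by rw [mul_comm 2 n, zpow_mul, zpow_ofNat]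
  have p3 : l ^ (-(2 * n) + 1) = ((l ^ n) ^ 2)⁻¹ * l := by
    rw [zpow_add_one₀ h0, zpow_neg, p2]
  have p4 : l ^ (2 - 2 * n) = ((l ^ n) ^ 2)⁻¹ * l ^ 2 := by
    rw [zpow_sub₀ h0, p2, zpow_ofNat]; ring
  rw [normPlus, normMinus, g1, g2, p1, p2, p3, p4, hr]
  set A := ∑' n, uP q l n ^ 2
  refine ⟨?_, ?_, ?_, ?_⟩
  · rw [e1]; field_simp
  · rw [e2]; field_simp
  · have : jostGm q n l = (1 - q n) * (c * (l ^ n) ^ 2 * jostF q n l) := by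
      rw [← e1, mul_inv_cancel_left₀ hqn]
    rw [this]; field_simp
  · have : jostFm q n l = (1 - q n : ℂ)⁻¹ * -(c * (l ^ n) ^ 2 * l⁻¹ * jostG q n l) := by
      rw [← e2, inv_mul_cancel_left₀ hqn]
    rw [this]; field_simp

section Marchenko

variable (hm : 0 < m) (hq1 : ∀ n, q n ≠ 1)
  (hq : Summable fun n : ℤ => (1 + |(n : ℝ)|) * |q n|) (n : ℤ) {j : ℤ} (hj : -1 ≤ j)
include hm hq1 hq hj

lemma marchenko_jostF :
    Summable (fun p : ℕ => glmPlus m q (2 * n + p + j) * jostFCoeff q n p) ∧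
    intCoeff (jostFCoeff q n) j + ∑' p : ℕ, glmPlus m q (2 * n + p + j) * jostFCoeff q n p
      = (1 - q n : ℂ)⁻¹ * (jostT q 0 * jostGmCoeff q n 0 * kron j 0
        + (deriv (jostT q) 0 * jostGmCoeff q n 0 + jostT q 0 * jostGmCoeff q n 1)
          * kron j (-1)) := by
  have := marchenko_of_scattering (N := 2 * n) (s := 1) (a := (1 - q n : ℂ)⁻¹)
    (γ := normPlus m q) (isWiener_jostF hq n) (isWiener_jostGm hq n)
    (circleIntegrable_reflPlus hm hq1 hq) (norm_reflPlus_le hm hq1 hq)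
    (fun l hl => ⟨(mem_jostZerosFinset.1 hl).1, (mem_jostZerosFinset.1 hl).2.1⟩)
    (hasSimplePoles_jostT hq1 hq) (fun z hz h1 h2 => by
      rw [one_mul, ← (scattering_plus hm hq1 hq hz h1 h2 n).1]; ring)
    (fun l hl => by rw [(residue_relations hm hq1 hq hl n rfl).1]; ring) hj
  simpa only [glmPlus_eq hm hq1 hq, one_mul] using this

lemma marchenko_jostG :
    Summable (fun p : ℕ => glmPlus m q (2 * n - 1 + p + j) * jostGCoeff q n p) ∧
    intCoeff (jostGCoeff q n) j - ∑' p : ℕ, glmPlus m q (2 * n - 1 + p + j) * jostGCoeff q n p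
      = (1 - q n) * (jostT q 0 * jostFmCoeff q n 0 * kron j 0
        + (deriv (jostT q) 0 * jostFmCoeff q n 0 + jostT q 0 * jostFmCoeff q n 1)
          * kron j (-1)) := by
  have := marchenko_of_scattering (N := 2 * n - 1) (s := -1) (a := (1 - q n : ℂ))
    (γ := normPlus m q) (isWiener_jostG hq n) (isWiener_jostFm hq n)
    (circleIntegrable_reflPlus hm hq1 hq) (norm_reflPlus_le hm hq1 hq)
    (fun l hl => ⟨(mem_jostZerosFinset.1 hl).1, (mem_jostZerosFinset.1 hl).2.1⟩)
    (hasSimplePoles_jostT hq1 hq) (fun z hz h1 h2 => by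
      rw [(scattering_plus hm hq1 hq hz h1 h2 n).2]; ring)
    (fun l hl => by rw [(residue_relations hm hq1 hq hl n rfl).2.1, sub_add_cancel]; ring) hj
  simpa only [glmPlus_eq hm hq1 hq, neg_one_mul, ← sub_eq_add_neg] using this

lemma marchenko_jostGm :
    Summable (fun p : ℕ => glmMinus m q (2 * n - p - j) * jostGmCoeff q n p) ∧
    intCoeff (jostGmCoeff q n) j + ∑' p : ℕ, glmMinus m q (2 * n - p - j) * jostGmCoeff q n p
      = (1 - q n) * (jostT q 0 * jostFCoeff q n 0 * kron j 0
        + (deriv (jostT q) 0 * jostFCoeff q n 0 + jostT q 0 * jostFCoeff q n 1)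
          * kron j (-1)) := by
  have := marchenko_of_scattering (N := -(2 * n)) (s := 1) (a := (1 - q n : ℂ))
    (γ := normMinus m q) (isWiener_jostGm hq n) (isWiener_jostF hq n)
    (circleIntegrable_reflMinus hm hq1 hq) (norm_reflMinus_le hm hq1 hq)
    (fun l hl => ⟨(mem_jostZerosFinset.1 hl).1, (mem_jostZerosFinset.1 hl).2.1⟩)
    (hasSimplePoles_jostT hq1 hq) (fun z hz h1 h2 => by
      rw [one_mul, ← (scattering_minus hm hq1 hq hz h1 h2 n).1])
    (fun l hl => by rw [(residue_relations hm hq1 hq hl n rfl).2.2.1]; ring) hj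
  have e : ∀ p : ℕ, -(2 * n - p - j) = -(2 * n) + p + j := fun p => by ring
  simpa only [glmMinus_eq hm hq1 hq, one_mul, e] using this

lemma marchenko_jostFm :
    Summable (fun p : ℕ => glmMinus m q (2 * n - 1 - p - j) * jostFmCoeff q n p) ∧
    intCoeff (jostFmCoeff q n) j
        - ∑' p : ℕ, glmMinus m q (2 * n - 1 - p - j) * jostFmCoeff q n p
      = (1 - q n : ℂ)⁻¹ * (jostT q 0 * jostGCoeff q n 0 * kron j 0
        + (deriv (jostT q) 0 * jostGCoeff q n 0 + jostT q 0 * jostGCoeff q n 1)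
          * kron j (-1)) := by
  have := marchenko_of_scattering (N := 1 - 2 * n) (s := -1) (a := (1 - q n : ℂ)⁻¹)
    (γ := normMinus m q) (isWiener_jostFm hq n) (isWiener_jostG hq n)
    (circleIntegrable_reflMinus hm hq1 hq) (norm_reflMinus_le hm hq1 hq)
    (fun l hl => ⟨(mem_jostZerosFinset.1 hl).1, (mem_jostZerosFinset.1 hl).2.1⟩)
    (hasSimplePoles_jostT hq1 hq) (fun z hz h1 h2 => by
      rw [neg_one_mul, ← sub_eq_add_neg, ← (scattering_minus hm hq1 hq hz h1 h2 n).2]; ring)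
    (fun l hl => by
      rw [(residue_relations hm hq1 hq hl n rfl).2.2.2, show 1 - 2 * n + 1 = 2 - 2 * n by ring]
      ring) hj
  have e : ∀ p : ℕ, -(2 * n - 1 - p - j) = 1 - 2 * n + p + j := fun p => by ring
  simpa only [glmMinus_eq hm hq1 hq, neg_one_mul, ← sub_eq_add_neg, e] using this

end Marchenko

end MomentEquations

/-! ### The equations for a and b. -/

section Equations

lemma hasSum_mul_kron (A : ℕ → ℂ) : HasSum (fun p : ℕ => A p * kron p 0) (A 0) := by
  have h := hasSum_single (f := fun p : ℕ => A p * kron p 0) 0 fun p hp => by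
    simp [kron, hp]
  simpa [kron] using h

lemma hasSum_mul_sub_kron {A c : ℕ → ℂ} (h : Summable fun p => A p * c p) :
    HasSum (fun p : ℕ => A p * (c p - kron p 0)) (∑' p, A p * c p - A 0) :=
  hasSum_of_eq (h.hasSum.sub (hasSum_mul_kron A)) (fun p => by ring) rfl

lemma hasSum_mul_pred {A c : ℕ → ℂ} {X : ℂ}
    (h : HasSum (fun p : ℕ => A (p + 1) * (c p - kron p 0)) X) :
    HasSum (fun p : ℕ => A p * (intCoeff c ((p : ℤ) - 1) - kron ((p : ℤ) - 1) 0)) X := by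
  set f : ℕ → ℂ := fun p => A p * (intCoeff c ((p : ℤ) - 1) - kron ((p : ℤ) - 1) 0) with hf
  have h0 : ∑ i ∈ Finset.range 1, f i = 0 := by simp [hf, intCoeff, kron]
  have h1 : HasSum (fun p : ℕ => f (p + 1)) X := by
    refine hasSum_of_eq h (fun p => ?_) rfl
    simp only [hf, Nat.cast_add, Nat.cast_one, add_sub_cancel_right, intCoeff_natCast]
  have h2 := (hasSum_nat_add_iff (f := f) 1).1 h1
  rwa [h0, add_zero] at h2

variable {m : ℝ} {q : ℤ → ℝ} (hm : 0 < m) (hq1 : ∀ n, q n ≠ 1)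
  (hq : Summable fun n : ℤ => (1 + |(n : ℝ)|) * |q n|)
include hm hq1 hq

lemma transm_zero : transm m q 0 = jostT q 0 := transm_eq hm hq1 hq (by simp)

lemma deriv_transm_zero : deriv (transm m q) 0 = deriv (jostT q) 0 :=
  (transm_eventuallyEq hm hq1 hq).deriv_eq

lemma transm_analyticAt : AnalyticAt ℂ (transm m q) 0 :=
  (jostT_analyticAt hq1 hq).congr (transm_eventuallyEq hm hq1 hq).symm

lemma marchenko_aPlus (n j : ℤ) (hj : 0 ≤ j) :
    Summable (fun p : ℕ => glmPlus m q (2 * n + p + j) * aPlus m q n p) ∧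
    kron j 0 + aPlus m q n j + glmPlus m q (2 * n + j)
        + ∑' p : ℕ, glmPlus m q (2 * n + p + j) * aPlus m q n p
      = transm m q 0 * (1 + aMinus m q n 0) / (1 - (q n : ℂ)) * kron j 0 := by
  obtain ⟨hs, he⟩ := marchenko_jostF hm hq1 hq n (by omega : -1 ≤ j)
  have h := hasSum_mul_sub_kron hs
  simp only [Nat.cast_zero, add_zero] at h
  have ha : ∀ p : ℕ, aPlus m q n p = jostFCoeff q n p - kron p 0 := fun p => by
    rw [aPlus_eq hm hq1 hq, intCoeff_natCast]
  have hM : aMinus m q n 0 = jostGmCoeff q n 0 - 1 := by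
    have := aMinus_eq hm hq1 hq n 0
    rw [neg_zero] at this
    rw [this, ← Nat.cast_zero, intCoeff_natCast, kron, if_pos rfl]
  have hk : kron j (-1) = 0 := if_neg (by omega)
  simp only [ha]
  refine ⟨h.summable, ?_⟩
  rw [h.tsum_eq, aPlus_eq hm hq1 hq, transm_zero hm hq1 hq, hM]
  rw [hk] at he
  linear_combination he

/-- Subtract the g equation at j from the one at j + 1. The derivative of T enters only through the
former at j = -1. -/
lemma marchenko_bPlus (n j : ℤ) (hj : -1 ≤ j) :
    Summable (fun p : ℕ => glmPlus m q (2 * n + ((p : ℤ) - 1) + j) * bPlus m q n ((p : ℤ) - 1)) ∧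
    kron j (-1) - kron j 0 + bPlus m q n j
        + glmPlus m q (2 * n + j - 1) - glmPlus m q (2 * n + j)
        + ∑' p : ℕ, glmPlus m q (2 * n + ((p : ℤ) - 1) + j) * bPlus m q n ((p : ℤ) - 1)
      = (1 - (q n : ℂ)) * (transm m q 0 * (bMinus m q n 0 - 1) * kron j 0
          + (deriv (transm m q) 0 * (bMinus m q n 0 - 1)
            + transm m q 0 * (bMinus m q n (-1) + 1)) * kron j (-1)) := by
  obtain ⟨hs, he⟩ := marchenko_jostG hm hq1 hq n hj
  obtain ⟨hs', he'⟩ := marchenko_jostG hm hq1 hq n (by omega : -1 ≤ j + 1)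
  have h := hasSum_mul_sub_kron hs
  have h' := hasSum_mul_sub_kron hs'
  have i1 : ∀ p : ℕ, 2 * n - 1 + (p : ℤ) + j = 2 * n + ((p : ℤ) - 1) + j := fun p => by ring
  have i2 : ∀ p : ℕ, 2 * n - 1 + (p : ℤ) + (j + 1) = 2 * n + (((p + 1 : ℕ) : ℤ) - 1) + j :=
    fun p => by push_cast; ring
  simp only [i1] at h he
  simp only [i2] at h' he'
  have h'' := hasSum_mul_pred (A := fun p : ℕ => glmPlus m q (2 * n + ((p : ℤ) - 1) + j)) h'
  have hb : ∀ p : ℕ, bPlus m q n ((p : ℤ) - 1) = (jostGCoeff q n p - kron p 0)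
      - (intCoeff (jostGCoeff q n) ((p : ℤ) - 1) - kron ((p : ℤ) - 1) 0) := fun p => by
    rw [bPlus_eq hm hq1 hq, sub_add_cancel, intCoeff_natCast]
  have hsum := h.sub h''
  simp only [← mul_sub, ← hb] at hsum
  refine ⟨hsum.summable, ?_⟩
  have hb0 : bMinus m q n 0 = 1 - jostFmCoeff q n 0 := by
    have := bMinus_eq hm hq1 hq n 0
    rw [neg_zero] at this
    rw [this]
    simp [intCoeff, kron]
  have hb1 : bMinus m q n (-1) = jostFmCoeff q n 0 - 1 - jostFmCoeff q n 1 := by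
    rw [bMinus_eq hm hq1 hq n 1]
    simp [intCoeff, kron]
  have k1 : kron (j + 1) (-1) = 0 := if_neg (by omega)
  have k2 : kron (j + 1) 0 = kron j (-1) := by
    simp only [kron]; congr 1; exact propext (by omega)
  rw [hsum.tsum_eq, bPlus_eq hm hq1 hq, transm_zero hm hq1 hq, deriv_transm_zero hm hq1 hq, hb0,
    hb1, k2]
  rw [k1, k2] at he'
  have e1 : 2 * n + (((0 : ℕ) : ℤ) - 1) + j = 2 * n + j - 1 := by push_cast; ring
  have e2 : 2 * n + (((0 + 1 : ℕ) : ℤ) - 1) + j = 2 * n + j := by push_cast; ring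
  rw [e1, e2]
  linear_combination he' - he

lemma marchenko_aMinus (n j : ℤ) (hj : j ≤ 0) :
    Summable (fun p : ℕ => glmMinus m q (2 * n - p + j) * aMinus m q n (-(p : ℤ))) ∧
    kron j 0 + aMinus m q n j + glmMinus m q (2 * n + j)
        + ∑' p : ℕ, glmMinus m q (2 * n - p + j) * aMinus m q n (-(p : ℤ))
      = (1 - (q n : ℂ)) * (transm m q 0 * (1 + aPlus m q n 0) * kron j 0) := by
  obtain ⟨i, rfl⟩ : ∃ i, j = -i := ⟨-j, by ring⟩
  obtain ⟨hs, he⟩ := marchenko_jostGm hm hq1 hq n (by omega : -1 ≤ i)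
  have h := hasSum_mul_sub_kron hs
  simp only [Nat.cast_zero, sub_zero] at h
  have ha : ∀ p : ℕ, aMinus m q n (-(p : ℤ)) = jostGmCoeff q n p - kron p 0 := fun p => by
    rw [aMinus_eq hm hq1 hq, intCoeff_natCast]
  have hP : aPlus m q n 0 = jostFCoeff q n 0 - 1 := by
    rw [aPlus_eq hm hq1 hq n 0, ← Nat.cast_zero, intCoeff_natCast, kron, if_pos rfl]
  have k1 : kron i (-1) = 0 := if_neg (by omega)
  have k2 : kron (-i) 0 = kron i 0 := by
    simp only [kron]; congr 1; exact propext (by omega)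
  simp only [ha, ← sub_eq_add_neg]
  refine ⟨h.summable, ?_⟩
  rw [h.tsum_eq, aMinus_eq hm hq1 hq, transm_zero hm hq1 hq, hP, k2]
  rw [k1] at he
  linear_combination he

/-- With i = -j, subtract the equation at i from the one at i - 1. For j = 0 the latter sits at
index -1, which produces T'(0). -/
lemma marchenko_bMinus (n j : ℤ) (hj : j ≤ 0) :
    Summable (fun p : ℕ => glmMinus m q (2 * n - p + j) * bMinus m q n (-(p : ℤ))) ∧
    kron j (-1) - kron j 0 + bMinus m q n j
        + glmMinus m q (2 * n + j - 1) - glmMinus m q (2 * n + j)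
        + ∑' p : ℕ, glmMinus m q (2 * n - p + j) * bMinus m q n (-(p : ℤ))
      = ((transm m q 0 * (bPlus m q n 0 - 1)
            + deriv (transm m q) 0 * (1 + bPlus m q n (-1))) * kron j 0
          + transm m q 0 * (1 + bPlus m q n (-1)) * kron j (-1)) / (1 - (q n : ℂ)) := by
  obtain ⟨i, rfl⟩ : ∃ i, j = -i := ⟨-j, by ring⟩
  obtain ⟨hs, he⟩ := marchenko_jostFm hm hq1 hq n (by omega : -1 ≤ i)
  obtain ⟨hs', he'⟩ := marchenko_jostFm hm hq1 hq n (by omega : -1 ≤ i - 1)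
  have h := hasSum_mul_sub_kron hs
  have h' := hasSum_mul_sub_kron hs'
  have i1 : ∀ p : ℕ, 2 * n - 1 - (p : ℤ) - i = 2 * n - ((p + 1 : ℕ) : ℤ) + -i := fun p => by
    push_cast; ring
  have i2 : ∀ p : ℕ, 2 * n - 1 - (p : ℤ) - (i - 1) = 2 * n - (p : ℤ) + -i := fun p => by ring
  simp only [i1] at h he
  simp only [i2] at h' he'
  have h'' := hasSum_mul_pred (A := fun p : ℕ => glmMinus m q (2 * n - (p : ℤ) + -i)) h
  have hb : ∀ p : ℕ, bMinus m q n (-(p : ℤ)) =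
      (intCoeff (jostFmCoeff q n) ((p : ℤ) - 1) - kron ((p : ℤ) - 1) 0)
      - (jostFmCoeff q n p - kron p 0) := fun p => by
    rw [bMinus_eq hm hq1 hq, intCoeff_natCast]
  have hsum := h''.sub h'
  simp only [← mul_sub, ← hb] at hsum
  refine ⟨hsum.summable, ?_⟩
  have hb0 : bPlus m q n 0 = jostGCoeff q n 1 - jostGCoeff q n 0 + 1 := by
    rw [bPlus_eq hm hq1 hq n 0]
    simp [intCoeff, kron]
    ring
  have hb1 : bPlus m q n (-1) = jostGCoeff q n 0 - 1 := by
    rw [bPlus_eq hm hq1 hq n (-1)]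
    simp [intCoeff, kron]
  have k1 : kron i (-1) = 0 := if_neg (by omega)
  have k2 : kron (i - 1) 0 = kron (-i) (-1) := by
    simp only [kron]; congr 1; exact propext (by omega)
  have k3 : kron i 0 = kron (-i) 0 := by
    simp only [kron]; congr 1; exact propext (by omega)
  have k4 : kron (i - 1) (-1) = kron (-i) 0 := by
    simp only [kron]; congr 1; exact propext (by omega)
  rw [hsum.tsum_eq, bMinus_eq hm hq1 hq, transm_zero hm hq1 hq, deriv_transm_zero hm hq1 hq, hb0,
    hb1, k2, k3]
  rw [k1, k3] at he
  rw [k2, k4] at he'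
  have e1 : 2 * n - ((0 + 1 : ℕ) : ℤ) + -i = 2 * n + -i - 1 := by push_cast; ring
  have e2 : 2 * n - ((0 : ℕ) : ℤ) + -i = 2 * n + -i := by push_cast; ring
  rw [e1, e2]
  linear_combination he' - he

end Equations

/-! ### Decay of the kernels. -/

section Decay

/-- With s_i the supremum of |A_k| over k ≥ i, the equation gives s_i ≤ κ_i + s_i/2. Monotonicity of
κ passes the bound to the supremum, and the a priori bound makes it finite. -/
lemma norm_le_two_mul_of_tsum {A ψ : ℕ → ℂ} {κ : ℕ → ℝ} (hA : ∃ C, ∀ i, ‖A i‖ ≤ C)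
    (hκ : Antitone κ) (hs : Summable fun p => ‖ψ p - if p = 0 then 1 else 0‖)
    (hle : ∑' p, ‖ψ p - if p = 0 then 1 else 0‖ ≤ 1 / 2)
    (hsum : ∀ i, Summable fun p => A (i + p) * ψ p)
    (heq : ∀ i, ‖∑' p, A (i + p) * ψ p‖ ≤ κ i) (i : ℕ) : ‖A i‖ ≤ 2 * κ i := by
  obtain ⟨C, hC⟩ := hA
  have hbdd : ∀ i, BddAbove (Set.range fun k => ‖A (i + k)‖) := fun i =>
    ⟨C, by rintro _ ⟨k, rfl⟩; exact hC _⟩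
  set s : ℕ → ℝ := fun i => ⨆ k, ‖A (i + k)‖ with hs_def
  have hs0 : ∀ i, 0 ≤ s i := fun i => Real.iSup_nonneg fun k => norm_nonneg _
  have hstep : ∀ i, ‖A i‖ ≤ κ i + 1 / 2 * s i := fun i => by
    have e : HasSum (fun p => A (i + p) * (ψ p - if p = 0 then 1 else 0))
        (∑' p, A (i + p) * ψ p - A i) := by
      have h1 : HasSum (fun p => A (i + p) * if p = 0 then 1 else 0) (A i) := by
        have := hasSum_single (f := fun p : ℕ => A (i + p) * if p = 0 then 1 else 0) 0
          fun p hp => by simp [hp]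
        simpa using this
      exact hasSum_of_eq ((hsum i).hasSum.sub h1) (fun p => by ring) rfl
    have hb : ‖∑' p, A (i + p) * ψ p - A i‖ ≤ s i * (1 / 2) := by
      refine (e.norm_le_of_bounded (hs.hasSum.mul_left (s i)) fun p => ?_).trans
        (mul_le_mul_of_nonneg_left hle (hs0 i))
      rw [norm_mul]
      exact mul_le_mul_of_nonneg_right (le_ciSup (hbdd i) p) (norm_nonneg _)
    have h2 : A i = ∑' p, A (i + p) * ψ p - (∑' p, A (i + p) * ψ p - A i) := by ring
    calc ‖A i‖ ≤ ‖∑' p, A (i + p) * ψ p‖ + ‖∑' p, A (i + p) * ψ p - A i‖ := by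
          conv_lhs => rw [h2]
          exact norm_sub_le _ _
      _ ≤ _ := by linarith [heq i]
  have hmono : ∀ k, s (i + k) ≤ s i := fun k => ciSup_le fun l => by
    rw [add_assoc]
    exact le_ciSup (hbdd i) (k + l)
  have hle2 : s i ≤ κ i + 1 / 2 * s i := ciSup_le fun k =>
    (hstep (i + k)).trans (add_le_add (hκ (Nat.le_add_right i k))
      (mul_le_mul_of_nonneg_left (hmono k) (by norm_num)))
  have := hstep i
  linarith

variable {m : ℝ} {q : ℤ → ℝ}

lemma summable_qWeight_add (hq : Summable fun n : ℤ => (1 + |(n : ℝ)|) * |q n|) (k : ℤ) :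
    Summable fun l : ℕ => qWeight q (k + l) := by
  refine Summable.of_nonneg_of_le (fun l => qWeight_nonneg q _) (fun l => ?_) (summable_tail hq k)
  have := mul_nonneg (Nat.cast_nonneg (α := ℝ) l) (qWeight_nonneg q (k + l))
  linarith

lemma qWeight_eq_zero_of_tsum_eq_zero
    (hq : Summable fun n : ℤ => (1 + |(n : ℝ)|) * |q n|) {k : ℤ}
    (h : ∑' l : ℕ, qWeight q (k + l) = 0) (l : ℕ) : qWeight q (k + l) = 0 := by
  have hs := (summable_qWeight_add hq k).hasSum
  rw [h, hasSum_zero_iff_of_nonneg fun l => qWeight_nonneg q _] at hs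
  exact congrFun hs l

lemma antitone_tsum_qWeight (hq : Summable fun n : ℤ => (1 + |(n : ℝ)|) * |q n|) :
    Antitone fun k : ℤ => ∑' l : ℕ, qWeight q (k + l) := by
  refine antitone_int_of_succ_le fun k => ?_
  have h := (summable_qWeight_add hq k).tsum_eq_zero_add
  have e : ∀ l : ℕ, k + ((l + 1 : ℕ) : ℤ) = k + 1 + l := fun l => by push_cast; ring
  simp only [e] at h
  rw [h]
  have := qWeight_nonneg q (k + ((0 : ℕ) : ℤ))
  linarith

lemma qWeight_reflect (q : ℤ → ℝ) (k : ℤ) : qWeight (fun k => q (-k)) k = qWeight q (-k) := rfl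

lemma totalCoeff_eq_zero {p : ℕ → Polynomial ℝ} (h : ∀ d, CoeffBdd 0 (p d)) (j : ℕ) :
    totalCoeff p j = 0 := by
  have : ∀ d, (p d).coeff j = 0 := fun d => abs_nonpos_iff.1 (h d j)
  simp [totalCoeff, this]

/-- The Jost functions are trivial where the potential vanishes beyond the base point. -/
lemma jostCoeff_of_qWeight_eq_zero (hq : Summable fun n : ℤ => (1 + |(n : ℝ)|) * |q n|) {n : ℤ}
    (h : ∀ l : ℕ, qWeight q (n + 1 + l) = 0) (j : ℕ) :
    jostFCoeff q n j = (if j = 0 then 1 else 0) ∧ jostGCoeff q n j = (if j = 0 then 1 else 0) := by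
  have hb := coeffBdd_jostIncr (summable_tail hq (n + 1))
  simp only [h, mul_zero] at hb
  simp [jostFCoeff, jostGCoeff, totalCoeff_eq_zero fun d => (hb d).1,
    totalCoeff_eq_zero fun d => (hb d).2]

lemma jostConst_nonneg (q : ℤ → ℝ) (n : ℤ) : 0 ≤ jostConst q n := by
  unfold jostConst; positivity

variable (hm : 0 < m) (hq1 : ∀ n, q n ≠ 1)
  (hq : Summable fun n : ℤ => (1 + |(n : ℝ)|) * |q n|)
include hm hq1 hq

lemma glmPlus_bounded (k : ℤ) : ∃ C, ∀ n, k ≤ n → ‖glmPlus m q n‖ ≤ C := by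
  simp only [glmPlus_eq hm hq1 hq]
  exact norm_poleMoment_le (norm_reflPlus_le hm hq1 hq)
    (fun l hl => ⟨(mem_jostZerosFinset.1 hl).1, (mem_jostZerosFinset.1 hl).2.1⟩) k

lemma glmMinus_bounded (k : ℤ) : ∃ C, ∀ n, n ≤ k → ‖glmMinus m q n‖ ≤ C := by
  simp only [glmMinus_eq hm hq1 hq]
  obtain ⟨C, hC⟩ := norm_poleMoment_le (γ := normMinus m q) (norm_reflMinus_le hm hq1 hq)
    (fun l (hl : l ∈ jostZerosFinset hq1 hq) =>
      ⟨(mem_jostZerosFinset.1 hl).1, (mem_jostZerosFinset.1 hl).2.1⟩) (-k)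
  exact ⟨C, fun n hn => hC _ (by omega)⟩

/-- One base point n, far enough out for the perturbation to be small, serves all k ≥ 2n + 1 by
letting j = k - 2n vary. -/
lemma norm_glmPlus_le {n : ℤ}
    (hn : 3 * jostConst q n * ∑' l : ℕ, ((l : ℝ) + 1) * qWeight q (n + 1 + l) ≤ 1 / 2) {k : ℤ}
    (hk : 2 * n + 1 ≤ k) :
    ‖glmPlus m q k‖ ≤ 2 * jostConst q n * ∑' l : ℕ, qWeight q (k / 2 + l) := by
  obtain ⟨i, rfl⟩ : ∃ i : ℕ, k = 2 * n + 1 + i := ⟨(k - (2 * n + 1)).toNat, by omega⟩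
  obtain ⟨C, hC⟩ := glmPlus_bounded hm hq1 hq (2 * n + 1)
  obtain ⟨t1, t2⟩ := tsum_norm_jostFCoeff_sub_le hq n
  have hmar : ∀ i : ℕ,
      Summable (fun p : ℕ => glmPlus m q (2 * n + 1 + (i + p : ℕ)) * jostFCoeff q n p) ∧
      ∑' p : ℕ, glmPlus m q (2 * n + 1 + (i + p : ℕ)) * jostFCoeff q n p
        = -jostFCoeff q n (i + 1) := fun i => by
    have h := marchenko_jostF hm hq1 hq n (by omega : -1 ≤ ((i + 1 : ℕ) : ℤ))
    have e : ∀ p : ℕ, 2 * n + (p : ℤ) + ((i + 1 : ℕ) : ℤ) = 2 * n + 1 + (i + p : ℕ) := fun p => by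
      push_cast; ring
    have k1 : kron ((i + 1 : ℕ) : ℤ) 0 = 0 := if_neg (by omega)
    have k2 : kron ((i + 1 : ℕ) : ℤ) (-1) = 0 := if_neg (by omega)
    simp only [e, k1, k2, intCoeff_natCast, mul_zero, add_zero] at h
    exact ⟨h.1, eq_neg_of_add_eq_zero_right h.2⟩
  have key := norm_le_two_mul_of_tsum (A := fun i : ℕ => glmPlus m q (2 * n + 1 + i))
    (κ := fun i => jostConst q n * ∑' l : ℕ, qWeight q (n + 1 + ((i + 1) / 2 : ℕ) + l))
    ⟨C, fun i => hC _ (by omega)⟩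
    (fun a b hab => mul_le_mul_of_nonneg_left (antitone_tsum_qWeight hq (by
      have := Nat.div_le_div_right (c := 2) (Nat.succ_le_succ hab)
      simp only [Nat.succ_eq_add_one] at this
      omega)) (jostConst_nonneg q n)) t1 (t2.trans hn)
    (fun i => (hmar i).1) (fun i => by
      rw [(hmar i).2, norm_neg]
      exact norm_jostFCoeff_le hq n (Nat.succ_ne_zero i)) i
  refine key.trans ?_
  rw [← mul_assoc]
  refine mul_le_mul_of_nonneg_left (antitone_tsum_qWeight hq ?_)
    (mul_nonneg two_pos.le (jostConst_nonneg q n))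
  omega

/-- The equation for `jostFm` is used because its coefficients have the exact cut-off j / 2. Its
index shift by one makes the tail start precisely at k / 2. -/
lemma norm_glmMinus_le {n : ℤ}
    (hn : 3 * jostConst (fun k => q (-k)) (-n) *
      ∑' l : ℕ, ((l : ℝ) + 1) * qWeight (fun k => q (-k)) (-n + 1 + l) ≤ 1 / 2) {k : ℤ}
    (hk : k ≤ 2 * n - 2) :
    ‖glmMinus m q k‖ ≤ 2 * jostConst (fun k => q (-k)) (-n) * ∑' l : ℕ, qWeight q (k / 2 - l) := by
  obtain ⟨i, rfl⟩ : ∃ i : ℕ, k = 2 * n - 2 - i := ⟨(2 * n - 2 - k).toNat, by omega⟩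
  obtain ⟨C, hC⟩ := glmMinus_bounded hm hq1 hq (2 * n - 2)
  have hq' := summable_reflect hq
  obtain ⟨t1, t2⟩ := tsum_norm_jostFCoeff_sub_le hq' (-n)
  have hmar : ∀ i : ℕ,
      Summable (fun p : ℕ => glmMinus m q (2 * n - 2 - (i + p : ℕ)) * jostFmCoeff q n p) ∧
      ∑' p : ℕ, glmMinus m q (2 * n - 2 - (i + p : ℕ)) * jostFmCoeff q n p
        = jostFmCoeff q n (i + 1) := fun i => by
    have h := marchenko_jostFm hm hq1 hq n (by omega : -1 ≤ ((i + 1 : ℕ) : ℤ))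
    have e : ∀ p : ℕ, 2 * n - 1 - (p : ℤ) - ((i + 1 : ℕ) : ℤ) = 2 * n - 2 - (i + p : ℕ) :=
      fun p => by push_cast; ring
    have k1 : kron ((i + 1 : ℕ) : ℤ) 0 = 0 := if_neg (by omega)
    have k2 : kron ((i + 1 : ℕ) : ℤ) (-1) = 0 := if_neg (by omega)
    simp only [e, k1, k2, intCoeff_natCast, mul_zero, add_zero] at h
    exact ⟨h.1, (sub_eq_zero.1 h.2).symm⟩
  have key := norm_le_two_mul_of_tsum (A := fun i : ℕ => glmMinus m q (2 * n - 2 - i))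
    (κ := fun i => jostConst (fun k => q (-k)) (-n) *
      ∑' l : ℕ, qWeight (fun k => q (-k)) (-n + 1 + ((i + 1) / 2 : ℕ) + l))
    ⟨C, fun i => hC _ (by omega)⟩
    (fun a b hab => mul_le_mul_of_nonneg_left (antitone_tsum_qWeight hq' (by
      have := Nat.div_le_div_right (c := 2) (Nat.succ_le_succ hab)
      simp only [Nat.succ_eq_add_one] at this
      omega)) (jostConst_nonneg _ _)) t1 (t2.trans hn)
    (fun i => (hmar i).1) (fun i => (congrArg norm (hmar i).2).le.trans
      (norm_jostFCoeff_le hq' (-n) (Nat.succ_ne_zero i))) i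
  refine key.trans (le_of_eq ?_)
  rw [← mul_assoc]
  congr 1
  refine tsum_congr fun l => ?_
  rw [qWeight_reflect]
  congr 1
  omega

/-- If the potential vanishes from site k / 2 on, then f at k / 2 - 1 is identically 1 and the
Marchenko equation reduces to its kernel term. -/
lemma glmPlus_eq_zero {k : ℤ} (h : ∑' l : ℕ, qWeight q (k / 2 + l) = 0) : glmPlus m q k = 0 := by
  have h0 := qWeight_eq_zero_of_tsum_eq_zero hq h
  have hc := fun j => (jostCoeff_of_qWeight_eq_zero hq (n := k / 2 - 1) (fun l => by
    rw [sub_add_cancel]; exact h0 l) j).1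
  obtain ⟨i, hi⟩ : ∃ i : ℕ, k = 2 * (k / 2 - 1) + (i + 1 : ℕ) :=
    ⟨(k - 2 * (k / 2 - 1) - 1).toNat, by omega⟩
  have h2 := (marchenko_jostF hm hq1 hq (k / 2 - 1) (by omega : -1 ≤ ((i + 1 : ℕ) : ℤ))).2
  have k1 : kron ((i + 1 : ℕ) : ℤ) 0 = 0 := if_neg (by omega)
  have k2 : kron ((i + 1 : ℕ) : ℤ) (-1) = 0 := if_neg (by omega)
  rw [intCoeff_natCast, hc, k1, k2, if_neg (Nat.succ_ne_zero i), tsum_eq_single 0 fun p hp => by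
    rw [hc, if_neg hp, mul_zero]] at h2
  simp only [hc, if_pos, Nat.cast_zero, add_zero, mul_one, mul_zero, zero_add] at h2
  rwa [← hi] at h2

/-- Here the equation for `jostGm` is used: with j = 1, 2 at the site k / 2 + 1 it reaches both
parities of k, whereas the one for `jostFm` with j ≥ 1 starts at the even index. -/
lemma glmMinus_eq_zero {k : ℤ} (h : ∑' l : ℕ, qWeight q (k / 2 - l) = 0) :
    glmMinus m q k = 0 := by
  have hq' := summable_reflect hq
  have e : ∀ l : ℕ, qWeight q (k / 2 - l) = qWeight (fun k => q (-k)) (-(k / 2) + l) := fun l => by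
    rw [qWeight_reflect]; congr 1; ring
  simp only [e] at h
  have h0 := qWeight_eq_zero_of_tsum_eq_zero hq' h
  have hc : ∀ j, jostGmCoeff q (k / 2 + 1) j = if j = 0 then 1 else 0 := fun j =>
    (jostCoeff_of_qWeight_eq_zero hq' (n := -(k / 2 + 1)) (fun l => by
      rw [neg_add, neg_add_cancel_right]; exact h0 l) j).2
  obtain ⟨i, hi⟩ : ∃ i : ℕ, k = 2 * (k / 2 + 1) - (i + 1 : ℕ) :=
    ⟨(2 * (k / 2 + 1) - k - 1).toNat, by omega⟩
  have h2 := (marchenko_jostGm hm hq1 hq (k / 2 + 1) (by omega : -1 ≤ ((i + 1 : ℕ) : ℤ))).2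
  have k1 : kron ((i + 1 : ℕ) : ℤ) 0 = 0 := if_neg (by omega)
  have k2 : kron ((i + 1 : ℕ) : ℤ) (-1) = 0 := if_neg (by omega)
  rw [intCoeff_natCast, hc, k1, k2, if_neg (Nat.succ_ne_zero i), tsum_eq_single 0 fun p hp => by
    rw [hc, if_neg hp, mul_zero]] at h2
  simp only [hc, if_pos, Nat.cast_zero, sub_zero, add_zero, mul_one, mul_zero, zero_add] at h2
  rwa [← hi] at h2

lemma exists_bound_glmPlus : ∃ M : ℤ → ℝ, M =O[atTop] (fun _ => (1 : ℝ)) ∧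
    ∀ n : ℤ, ‖glmPlus m q n‖ ≤ M n * ∑' k : ℕ, qWeight q (n / 2 + k) := by
  obtain ⟨n, hn⟩ := ((tendsto_jostConst hq).eventually
    (gt_mem_nhds (by norm_num : (0 : ℝ) < 1 / 2))).exists
  -- Below the threshold M may be the quotient itself. Division by a zero tail is harmless because
  -- the kernel vanishes there.
  refine ⟨fun k => if 2 * n + 1 ≤ k then 2 * jostConst q n else
    ‖glmPlus m q k‖ / ∑' l : ℕ, qWeight q (k / 2 + l), ?_, fun k => ?_⟩
  · refine (isBigO_const_const (2 * jostConst q n) one_ne_zero atTop).congr' ?_ EventuallyEq.rfl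
    filter_upwards [eventually_ge_atTop (2 * n + 1)] with k hk
    rw [if_pos hk]
  · beta_reduce
    split_ifs with hk
    · exact norm_glmPlus_le hm hq1 hq hn.le hk
    · by_cases h0 : ∑' l : ℕ, qWeight q (k / 2 + l) = 0
      · rw [glmPlus_eq_zero hm hq1 hq h0, h0, norm_zero, mul_zero]
      · rw [div_mul_cancel₀ _ h0]

lemma exists_bound_glmMinus : ∃ M : ℤ → ℝ, M =O[atBot] (fun _ => (1 : ℝ)) ∧
    ∀ n : ℤ, ‖glmMinus m q n‖ ≤ M n * ∑' k : ℕ, qWeight q (n / 2 - k) := by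
  obtain ⟨n', hn'⟩ := ((tendsto_jostConst (summable_reflect hq)).eventually
    (gt_mem_nhds (by norm_num : (0 : ℝ) < 1 / 2))).exists
  obtain ⟨n, rfl⟩ : ∃ n, n' = -n := ⟨-n', by ring⟩
  refine ⟨fun k => if k ≤ 2 * n - 2 then 2 * jostConst (fun k => q (-k)) (-n) else
    ‖glmMinus m q k‖ / ∑' l : ℕ, qWeight q (k / 2 - l), ?_, fun k => ?_⟩
  · refine (isBigO_const_const (2 * jostConst (fun k => q (-k)) (-n)) one_ne_zero atBot).congr' ?_
      EventuallyEq.rfl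
    filter_upwards [eventually_le_atBot (2 * n - 2)] with k hk
    rw [if_pos hk]
  · beta_reduce
    split_ifs with hk
    · exact norm_glmMinus_le hm hq1 hq hn'.le hk
    · by_cases h0 : ∑' l : ℕ, qWeight q (k / 2 - l) = 0
      · rw [glmMinus_eq_zero hm hq1 hq h0, h0, norm_zero, mul_zero]
      · rw [div_mul_cancel₀ _ h0]

end Decay

end DiscreteDirac

/-! ### The proposition. -/

theorem proposition4p3 (m : ℝ) (hm : 0 < m) (q : ℤ → ℝ) (hq1 : ∀ n, q n ≠ 1)
    (hq : Summable fun n : ℤ => (1 + |(n : ℝ)|) * |q n|) :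
    -- the objects in the equations are well defined
    ((∀ z : ℂ, 0 < ‖z‖ → ‖z‖ ≤ 1 →
        (∃! w, IsJostPlus m q z w) ∧ (∃! w, IsJostMinus m q z w)) ∧
      (∀ (n : ℤ) (z : ℂ), 0 < ‖z‖ → ‖z‖ ≤ 1 →
        HasSum (fun k : ℕ => aPlus m q n ((k : ℤ) - 1) * z ^ ((k : ℤ) - 1))
          ((hPlus m q n z).1 - 1) ∧
        HasSum (fun k : ℕ => bPlus m q n ((k : ℤ) - 1) / (lam m z + m) * z ^ ((k : ℤ) - 1))
          ((1 - (q n : ℂ)) * (hPlus m q n z).2 - (z⁻¹ - 1) / (m + lam m z)) ∧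
        HasSum (fun k : ℕ => aMinus m q n (1 - (k : ℤ)) * z ^ (-(1 - (k : ℤ))))
          ((1 - (q n : ℂ)) * (hMinus m q n z).1 - 1) ∧
        HasSum (fun k : ℕ => bMinus m q n (1 - (k : ℤ)) / (lam m z + m) * z ^ (-(1 - (k : ℤ))))
          ((hMinus m q n z).2 - (z - 1) / (m + lam m z))) ∧
      (eigenPoints m q).Finite ∧
      CircleIntegrable (reflPlus m q) 0 1 ∧
      CircleIntegrable (reflMinus m q) 0 1 ∧
      AnalyticAt ℂ (transm m q) 0) ∧
    -- (i) the equations for `𝓕⁺`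
    ((∀ n j : ℤ, 0 ≤ j →
        Summable (fun p : ℕ => glmPlus m q (2 * n + p + j) * aPlus m q n p) ∧
        kron j 0 + aPlus m q n j + glmPlus m q (2 * n + j)
            + ∑' p : ℕ, glmPlus m q (2 * n + p + j) * aPlus m q n p
          = transm m q 0 * (1 + aMinus m q n 0) / (1 - (q n : ℂ)) * kron j 0) ∧
      (∀ n j : ℤ, -1 ≤ j →
        Summable (fun p : ℕ => glmPlus m q (2 * n + ((p : ℤ) - 1) + j)
          * bPlus m q n ((p : ℤ) - 1)) ∧
        kron j (-1) - kron j 0 + bPlus m q n j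
            + glmPlus m q (2 * n + j - 1) - glmPlus m q (2 * n + j)
            + ∑' p : ℕ, glmPlus m q (2 * n + ((p : ℤ) - 1) + j) * bPlus m q n ((p : ℤ) - 1)
          = (1 - (q n : ℂ)) * (transm m q 0 * (bMinus m q n 0 - 1) * kron j 0
              + (deriv (transm m q) 0 * (bMinus m q n 0 - 1)
                + transm m q 0 * (bMinus m q n (-1) + 1)) * kron j (-1)))) ∧
    -- (ii) the equations for `𝓕⁻`; the summation index of the paper is `-p`
    ((∀ n j : ℤ, j ≤ 0 →
        Summable (fun p : ℕ => glmMinus m q (2 * n - p + j) * aMinus m q n (-(p : ℤ))) ∧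
        kron j 0 + aMinus m q n j + glmMinus m q (2 * n + j)
            + ∑' p : ℕ, glmMinus m q (2 * n - p + j) * aMinus m q n (-(p : ℤ))
          = (1 - (q n : ℂ)) * (transm m q 0 * (1 + aPlus m q n 0) * kron j 0)) ∧
      (∀ n j : ℤ, j ≤ 0 →
        Summable (fun p : ℕ => glmMinus m q (2 * n - p + j) * bMinus m q n (-(p : ℤ))) ∧
        kron j (-1) - kron j 0 + bMinus m q n j
            + glmMinus m q (2 * n + j - 1) - glmMinus m q (2 * n + j)
            + ∑' p : ℕ, glmMinus m q (2 * n - p + j) * bMinus m q n (-(p : ℤ))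
          = ((transm m q 0 * (bPlus m q n 0 - 1)
                + deriv (transm m q) 0 * (1 + bPlus m q n (-1))) * kron j 0
              + transm m q 0 * (1 + bPlus m q n (-1)) * kron j (-1)) / (1 - (q n : ℂ)))) ∧
    -- (iii) the decay estimates; `n / 2` is the integer part of one half of `n`
    ((∃ M : ℤ → ℝ, M =O[atTop] (fun _ => (1 : ℝ)) ∧
        ∀ n : ℤ, ‖glmPlus m q n‖ ≤ M n * ∑' k : ℕ, qWeight q (n / 2 + k)) ∧
      (∃ M : ℤ → ℝ, M =O[atBot] (fun _ => (1 : ℝ)) ∧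
        ∀ n : ℤ, ‖glmMinus m q n‖ ≤ M n * ∑' k : ℕ, qWeight q (n / 2 - k))) := by
  refine ⟨⟨fun z hz0 hz => ?_, fun n z hz0 hz => ?_, ?_, circleIntegrable_reflPlus hm hq1 hq,
    circleIntegrable_reflMinus hm hq1 hq, transm_analyticAt hm hq1 hq⟩,
    ⟨marchenko_aPlus hm hq1 hq, marchenko_bPlus hm hq1 hq⟩,
    ⟨marchenko_aMinus hm hq1 hq, marchenko_bMinus hm hq1 hq⟩,
    exists_bound_glmPlus hm hq1 hq, exists_bound_glmMinus hm hq1 hq⟩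
  · have hz0' := norm_pos_iff.1 hz0
    have hP := isJostPlus_sol hm hq1 hq hz0' hz
    have hM := isJostMinus_sol hm hq1 hq hz0' hz
    exact ⟨⟨_, hP, fun w hw => isJostPlus_unique hm hq1 hz0' hz hP hw⟩,
      ⟨_, hM, fun w hw => isJostMinus_unique hm hq1 hz0' hz hM hw⟩⟩
  · exact jost_expansions hm hq1 hq n z hz0 hz
  · rw [eigenPoints_eq hm hq1 hq]
    exact finite_jostZeros hq1 hq
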